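/- A fair division instance consists of agents $[n]$, items $[m]$ and, for each agent $i$, a valuation $v_i : 2^{[m]} \to \mathbb{R}_{\ge 0}$; it is additive if $v_i(S) = \sum_{g \in S} v_i(\{g\})$ for all $i$ and $S$. It is an instance on a loopless multi-graph $G$ with vertex set $[n]$ and edge set $[m]$ if, for all $i$ and $g$, $v_i(\{g\}) > 0$ exactly when $g$ is incident to $i$. It is a multi-cycle instance if, moreover, $n \ge 3$ and the skeleton of $G$ (the simple graph joining two vertices that share at least one edge of $G$) is a cycle through all $n$ vertices. An allocation $X = (X_1, \dots, X_n)$ of pairwise disjoint item sets is complete if $\bigcup_i X_i = [m]$, and it is EFX if $v_i(X_i) \ge v_i(X_j \setminus \{g\})$ for all agents $i, j$ and every $g \in X_j$. **Theorem.** Every multi-cycle instance with additive valuations, of even or odd length $n \ge 3$, has a complete EFX allocation, and such an allocation can be computed in polynomial time. That is, there are a program and a polynomial $p$ such that, on every multi-cycle instance with additive valuations, given as the list of the $m$ items with their two endpoints and their values to these endpoints, the program halts after at most $p(n+m)$ elementary steps and outputs a complete EFX allocation. The elementary steps are those of a random access machine that has memory cells for natural numbers (used as indices and addresses) and for real numbers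 (used for values): reading and writing cells (with computed addresses), addition, subtraction, comparison and branching, each at unit cost, without multiplication, rounding, or conversion between the two kinds of numbers. -/

import Mathlib

namespace FairDivision

/-! ### Fair division instances on multi-graphs -/

/-- A fair division instance with agents `Fin n` and items `Fin m`: every agent has a valuation
assigning a non-negative real to every set of items. -/
structure Instance (n m : ℕ) where
  val : Fin n → Finset (Fin m) → ℝ
  val_nonneg : ∀ i S, 0 ≤ val i S

/-- All valuations are additive. -/
def Instance.IsAdditive {n m : ℕ} (I : Instance n m) : Prop :=
  ∀ i S, I.val i S = ∑ g ∈ S, I.val i {g}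

/-- A multi-graph with vertex set `Fin n` and edge set `Fin m` (parallel edges allowed,
no loops). -/
structure MultiGraph (n m : ℕ) where
  ends : Fin m → Sym2 (Fin n)
  loopless : ∀ g, ¬ (ends g).IsDiag

/-- `I` is a multi-graph instance on `G`: an agent values an item positively if and only if the
item is incident to the agent. -/
def Instance.IsOn {n m : ℕ} (I : Instance n m) (G : MultiGraph n m) : Prop :=
  ∀ i g, 0 < I.val i {g} ↔ i ∈ G.ends g

/-- The skeleton: `i` and `j` are joined when some edge of the multi-graph joins them. -/
def MultiGraph.skeleton {n m : ℕ} (G : MultiGraph n m) : SimpleGraph (Fin n) where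
  Adj i j := ∃ g, G.ends g = s(i, j)
  symm := ⟨fun i j ⟨g, hg⟩ => ⟨g, by rw [hg, Sym2.eq_swap]⟩⟩
  loopless := ⟨fun i ⟨g, hg⟩ => G.loopless g (by rw [hg]; exact Sym2.mk_isDiag_iff.2 rfl)⟩

/-- A multi-cycle: the skeleton is a cycle (of length `n ≥ 3`, through all the vertices). -/
def MultiGraph.IsMultiCycle {n m : ℕ} (G : MultiGraph n m) : Prop :=
  3 ≤ n ∧ Nonempty (G.skeleton ≃g SimpleGraph.cycleGraph n)

/-! ### Allocations and EFX -/

/-- A complete allocation: pairwise disjoint bundles that together contain every item. -/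
def IsCompleteAllocation {n m : ℕ} (X : Fin n → Finset (Fin m)) : Prop :=
  (∀ i j, i ≠ j → Disjoint (X i) (X j)) ∧ ∀ g, ∃ i, g ∈ X i

/-- Agent `i` strongly envies agent `j`. -/
def Instance.StronglyEnvies {n m : ℕ} (I : Instance n m) (X : Fin n → Finset (Fin m))
    (i j : Fin n) : Prop :=
  ∃ g ∈ X j, I.val i (X i) < I.val i (X j \ {g})

/-- Envy-freeness up to any item. -/
def Instance.IsEFX {n m : ℕ} (I : Instance n m) (X : Fin n → Finset (Fin m)) : Prop :=
  ∀ i j, ¬ I.StronglyEnvies X i j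

/-! ### The model of computation

A random access machine with two kinds of memory cells, natural numbers (used for indices and
addresses) and real numbers (used for values).  The cells are organized in arrays: cell `i` of
array `a`, where the name `a` is fixed in the program text and the index `i` is computed at run
time.  The arithmetic is addition and subtraction, with comparisons; there is no multiplication,
no rounding, and no conversion between the two kinds.  Every elementary operation costs one step.
Since numbers at most double with every operation, on rational inputs polynomially many steps
of this machine take polynomial time in the bit model too. -/

/-- The memory: `nat a i` and `real a i` are the contents of cell `i` of array `a`. -/
structure Memory where
  nat : ℕ → ℕ → ℕ
  real : ℕ → ℕ → ℝ

/-- Natural-number expressions. -/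
inductive NatExpr : Type
  | lit (k : ℕ)
  | read (a : ℕ) (i : NatExpr)
  | add (x y : NatExpr)
  | sub (x y : NatExpr)

/-- Real-number expressions. -/
inductive RealExpr : Type
  | zero
  | read (a : ℕ) (i : NatExpr)
  | add (x y : RealExpr)
  | sub (x y : RealExpr)

/-- Tests. -/
inductive Test : Type
  | natLE (x y : NatExpr)
  | realLE (x y : RealExpr)
  | not (b : Test)
  | and (b c : Test)

/-- Programs. -/
inductive Program : Type
  | skip
  | setNat (a : ℕ) (i x : NatExpr)
  | setReal (a : ℕ) (i : NatExpr) (x : RealExpr)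
  | seq (c d : Program)
  | ite (b : Test) (c d : Program)
  | loop (b : Test) (c : Program)

/-- The value of an expression (subtraction of natural numbers is truncated at `0`). -/
def NatExpr.eval (s : Memory) : NatExpr → ℕ
  | lit k => k
  | read a i => s.nat a (i.eval s)
  | add x y => x.eval s + y.eval s
  | sub x y => x.eval s - y.eval s

/-- The number of elementary operations in evaluating an expression. -/
def NatExpr.cost : NatExpr → ℕ
  | lit _ => 1
  | read _ i => i.cost + 1
  | add x y => x.cost + y.cost + 1
  | sub x y => x.cost + y.cost + 1

/-- The value of a real expression. -/
def RealExpr.eval (s : Memory) : RealExpr → ℝ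
  | zero => 0
  | read a i => s.real a (i.eval s)
  | add x y => x.eval s + y.eval s
  | sub x y => x.eval s - y.eval s

/-- The number of elementary operations in evaluating a real expression. -/
def RealExpr.cost : RealExpr → ℕ
  | zero => 1
  | read _ i => i.cost + 1
  | add x y => x.cost + y.cost + 1
  | sub x y => x.cost + y.cost + 1

/-- Whether a test succeeds. -/
def Test.Holds (s : Memory) : Test → Prop
  | natLE x y => x.eval s ≤ y.eval s
  | realLE x y => x.eval s ≤ y.eval s
  | not b => ¬ b.Holds s
  | and b c => b.Holds s ∧ c.Holds s

/-- The number of elementary operations in evaluating a test. -/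
def Test.cost : Test → ℕ
  | natLE x y => x.cost + y.cost + 1
  | realLE x y => x.cost + y.cost + 1
  | not b => b.cost + 1
  | and b c => b.cost + c.cost + 1

/-- Overwrite one natural-number cell. -/
def Memory.writeNat (s : Memory) (a i x : ℕ) : Memory where
  nat := Function.update s.nat a (Function.update (s.nat a) i x)
  real := s.real

/-- Overwrite one real cell. -/
def Memory.writeReal (s : Memory) (a i : ℕ) (x : ℝ) : Memory where
  nat := s.nat
  real := Function.update s.real a (Function.update (s.real a) i x)

/-- `Run c s s' t`: started in memory `s`, the program `c` halts in memory `s'` after exactly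
`t` steps. -/
inductive Run : Program → Memory → Memory → ℕ → Prop
  | skip (s : Memory) : Run .skip s s 1
  | setNat (s : Memory) (a : ℕ) (i x : NatExpr) :
      Run (.setNat a i x) s (s.writeNat a (i.eval s) (x.eval s)) (i.cost + x.cost + 1)
  | setReal (s : Memory) (a : ℕ) (i : NatExpr) (x : RealExpr) :
      Run (.setReal a i x) s (s.writeReal a (i.eval s) (x.eval s)) (i.cost + x.cost + 1)
  | seq {c d : Program} {s s' s'' : Memory} {t t' : ℕ} :
      Run c s s' t → Run d s' s'' t' → Run (.seq c d) s s'' (t + t')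
  | iteTrue {b : Test} {c d : Program} {s s' : Memory} {t : ℕ} :
      b.Holds s → Run c s s' t → Run (.ite b c d) s s' (b.cost + t)
  | iteFalse {b : Test} {c d : Program} {s s' : Memory} {t : ℕ} :
      ¬ b.Holds s → Run d s s' t → Run (.ite b c d) s s' (b.cost + t)
  | loopFalse {b : Test} {c : Program} {s : Memory} :
      ¬ b.Holds s → Run (.loop b c) s s b.cost
  | loopTrue {b : Test} {c : Program} {s s' s'' : Memory} {t t' : ℕ} :
      b.Holds s → Run c s s' t → Run (.loop b c) s' s'' t' →
        Run (.loop b c) s s'' (b.cost + t + t')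

/-- The machine is deterministic: the final memory and the number of steps are determined by the
program and the initial memory. -/
theorem Run.deterministic {c : Program} {s s₁ s₂ : Memory} {t₁ t₂ : ℕ}
    (h₁ : Run c s s₁ t₁) (h₂ : Run c s s₂ t₂) : s₁ = s₂ ∧ t₁ = t₂ := by
  induction h₁ generalizing s₂ t₂ with
  | skip s => cases h₂; exact ⟨rfl, rfl⟩
  | setNat s a i x => cases h₂; exact ⟨rfl, rfl⟩
  | setReal s a i x => cases h₂; exact ⟨rfl, rfl⟩
  | seq _ _ ih ih' =>
    cases h₂ with
    | seq k k' =>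
      obtain ⟨rfl, rfl⟩ := ih k
      obtain ⟨rfl, rfl⟩ := ih' k'
      exact ⟨rfl, rfl⟩
  | iteTrue hb _ ih =>
    cases h₂ with
    | iteTrue _ k => obtain ⟨rfl, rfl⟩ := ih k; exact ⟨rfl, rfl⟩
    | iteFalse hb' _ => exact absurd hb hb'
  | iteFalse hb _ ih =>
    cases h₂ with
    | iteTrue hb' _ => exact absurd hb' hb
    | iteFalse _ k => obtain ⟨rfl, rfl⟩ := ih k; exact ⟨rfl, rfl⟩
  | loopFalse hb =>
    cases h₂ with
    | loopFalse _ => exact ⟨rfl, rfl⟩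
    | loopTrue hb' _ _ => exact absurd hb' hb
  | loopTrue hb _ _ ih ih' =>
    cases h₂ with
    | loopFalse hb' => exact absurd hb hb'
    | loopTrue _ k k' =>
      obtain ⟨rfl, rfl⟩ := ih k
      obtain ⟨rfl, rfl⟩ := ih' k'
      exact ⟨rfl, rfl⟩

/-! ### Input and output -/

/-- The table of a function on the items, padded with zeros, as the contents of an array. -/
def table {m : ℕ} {α : Type} [Zero α] (f : Fin m → α) (k : ℕ) : α :=
  if h : k < m then f ⟨k, h⟩ else 0

/-- The initial memory for the multi-graph instance `I` on `G`.  Natural-number array `0` holds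
`n` and `m` in its cells `0` and `1`; arrays `1` and `2` hold the smaller and the larger endpoint
of every item; real arrays `0` and `1` hold the values of every item to its smaller and to its
larger endpoint.  All other cells are `0`. -/
noncomputable def inputMemory {n m : ℕ} (I : Instance n m) (G : MultiGraph n m) : Memory where
  nat a := match a with
    | 0 => fun k => if k = 0 then n else if k = 1 then m else 0
    | 1 => table fun g => ((G.ends g).inf : ℕ)
    | 2 => table fun g => ((G.ends g).sup : ℕ)
    | _ => fun _ => 0
  real a := match a with
    | 0 => table fun g => I.val (G.ends g).inf {g}
    | 1 => table fun g => I.val (G.ends g).sup {g}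
    | _ => fun _ => 0

/-- The final memory `s` describes the allocation `X`: cell `g` of natural-number array `3` holds
the agent that receives item `g`. -/
def Outputs {n m : ℕ} (s : Memory) (X : Fin n → Finset (Fin m)) : Prop :=
  ∀ i g, g ∈ X i ↔ s.nat 3 (g : ℕ) = (i : ℕ)

end FairDivision

/-!
Number the vertices in the order in which they lie on the cycle; the items are then divided into
edge classes, class `k` joining position `k` (its first endpoint) to position `k + 1` (its second
endpoint), and every position cares about two classes only.

*Splits.*  Each class is split into two parts.  Going through the items of the class by descending
value, and moving an item to the other part whenever its part would be the heavier one even without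
it, gives a split that is EFX for the endpoint whose values are used, and it never increases the
difference between the two parts (`Balancing`, `balance_spec`).  This is done twice: first with the
values of the first endpoint, then, starting from that split, with those of the second endpoint
(`IsCut`, `cut_spec`).  In the final split the better part is worth no more to the second endpoint
than in the first split (`IsCut.le_first`), so the first split can still be used where the second
endpoint is allowed to choose.  An agent can envy the holder of a single part of an EFX split and
still be content, provided that it has at least the value of the other part; this is the only use of
EFX as opposed to envy-freeness (`Split.Content`, `isEFX_of_content`).

*The allocation.*  If no position likes its best part of the next class as much as its best part of
the previous one, everybody takes the best part of the previous class, and nobody is envied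
(`Split.content_of_prev`).  Otherwise the numbering starts from a position that does.  A scan round
the cycle lets the positions choose: a position chooses from its next class if its best part is at
least as good as its share of the previous class; otherwise it relies on that share and leaves the
choice to the next position.  A second scan, downwards, finds the positions whose chosen part the
next position would envy.  Such a position either exchanges the parts of the class with the next
position, or keeps its chosen part only (it is *lonely*), its part of the previous class going to
the next position that is not lonely (`Scan`).  Lonely positions hold a single part of an EFX split,
so they may be envied.  This allocation is EFX (`Scan.IsMain.content_succ`,
`Scan.IsMain.content_zero`) unless a chain of lonely positions that begins at position `0` or `1`
extends nearly all the way round.  In the two exceptional situations it is replaced by an allocation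
in which chosen parts move on to the next position and one class is cut again by its first split
(`Scan.IsRotateAll.content`, `Scan.IsRotateLast.content`).

*The program.*  It is written in a language whose only loops are counting loops bounded by `n` or
`m`.  Halting within a polynomial number of steps is therefore a syntactic matter
(`Cmd.exists_run`), and only its effect has to be analysed, with an invariant for every loop
(`Cmd.run_count`).  The cycle is traced by walking twice round it without turning back
(`cycle_walk`, `traversed`); this gives the order of the vertices, also when it is read from a start
other than vertex `0`.
-/

namespace FairDivision

/-! ### A structured programming language -/

/-- Programs whose only loops are counting loops: `count v b c` runs `c` with cell `0` of array `v`
equal to `0, 1, …, K - 1`, where `K` is the content of cell `b` of the input array `0`. -/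
inductive Cmd : Type
  | skip
  | setNat (a : ℕ) (i x : NatExpr)
  | setReal (a : ℕ) (i : NatExpr) (x : RealExpr)
  | seq (c d : Cmd)
  | ite (b : Test) (c d : Cmd)
  | count (v b : ℕ) (c : Cmd)

/-- The content of cell `0` of array `v`; such cells serve as scalar variables. -/
abbrev NatExpr.var (v : ℕ) : NatExpr := .read v (.lit 0)

namespace Cmd

/-- The machine program that a structured program abbreviates. -/
def toProgram : Cmd → Program
  | skip => .skip
  | setNat a i x => .setNat a i x
  | setReal a i x => .setReal a i x
  | seq c d => .seq c.toProgram d.toProgram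
  | ite b c d => .ite b c.toProgram d.toProgram
  | count v b c => .seq (.setNat v (.lit 0) (.lit 0))
      (.loop (.not (.natLE (.read 0 (.lit b)) (.var v)))
        (.seq c.toProgram (.setNat v (.lit 0) (.add (.var v) (.lit 1)))))

/-- The natural-number arrays that a structured program may write to. -/
def natWrites : Cmd → List ℕ
  | skip => []
  | setNat a _ _ => [a]
  | setReal _ _ _ => []
  | seq c d => c.natWrites ++ d.natWrites
  | ite _ c d => c.natWrites ++ d.natWrites
  | count v _ c => v :: c.natWrites

/-- The real arrays that a structured program may write to. -/
def realWrites : Cmd → List ℕ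
  | skip => []
  | setNat _ _ _ => []
  | setReal a _ _ => [a]
  | seq c d => c.realWrites ++ d.realWrites
  | ite _ c d => c.realWrites ++ d.realWrites
  | count _ _ c => c.realWrites

/-- Every counting loop is bounded by one of the two input sizes, and its body changes neither its
counter nor the array that holds the bound. -/
def wf : Cmd → Bool
  | skip => true
  | setNat _ _ _ => true
  | setReal _ _ _ => true
  | seq c d => c.wf && d.wf
  | ite _ c d => c.wf && d.wf
  | count v b c => c.wf && decide (b ≤ 1) && decide (v ≠ 0) && decide (v ∉ c.natWrites) &&
      decide (0 ∉ c.natWrites)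

/-- The memory after `k` rounds of a counting loop whose body acts as `f`. -/
def rounds (f : Memory → Memory) (v : ℕ) (s : Memory) : ℕ → Memory
  | 0 => s.writeNat v 0 0
  | k + 1 => (f (rounds f v s k)).writeNat v 0 (k + 1)

open Classical in
/-- The effect of a structured program on the memory. -/
noncomputable def run : Cmd → Memory → Memory
  | skip, s => s
  | setNat a i x, s => s.writeNat a (i.eval s) (x.eval s)
  | setReal a i x, s => s.writeReal a (i.eval s) (x.eval s)
  | seq c d, s => d.run (c.run s)
  | ite b c d, s => if b.Holds s then c.run s else d.run s
  | count v b c, s => rounds c.run v s (s.nat 0 b)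

/-- A bound for the number of steps, as a polynomial in any bound for the two input sizes.  In a
counting loop, a round costs at most `12` steps besides its body, and starting and leaving the loop
cost at most `9`. -/
noncomputable def time : Cmd → Polynomial ℕ
  | skip => 1
  | setNat _ i x => Polynomial.C (i.cost + x.cost + 1)
  | setReal _ i x => Polynomial.C (i.cost + x.cost + 1)
  | seq c d => c.time + d.time
  | ite b c d => Polynomial.C b.cost + c.time + d.time
  | count _ _ c => 9 + Polynomial.X * (c.time + 12)

/-- A frame rule: arrays that are not written to do not change. -/
theorem run_nat_of_notMem {a : ℕ} (c : Cmd) (h : a ∉ c.natWrites) (s : Memory) :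
    (c.run s).nat a = s.nat a := by
  induction c generalizing s with
  | skip => rfl
  | setNat a' i x =>
    simp only [natWrites, List.mem_singleton] at h
    simp [run, Memory.writeNat, Function.update_of_ne h]
  | setReal a' i x => simp [run, Memory.writeReal]
  | seq c d hc hd =>
    simp only [natWrites, List.mem_append, not_or] at h
    simp only [run]; rw [hd h.2, hc h.1]
  | ite b c d hc hd =>
    simp only [natWrites, List.mem_append, not_or] at h
    simp only [run]; split_ifs
    · exact hc h.1 s
    · exact hd h.2 s
  | count v b c hc =>
    simp only [natWrites, List.mem_cons, not_or] at h
    have : ∀ k, (rounds c.run v s k).nat a = s.nat a := by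
      intro k
      induction k with
      | zero => simp [rounds, Memory.writeNat, Function.update_of_ne h.1]
      | succ k ih =>
        simp only [rounds, Memory.writeNat, Function.update_of_ne h.1]
        rw [hc h.2, ih]
    exact this _

/-- The frame rule for the real arrays. -/
theorem run_real_of_notMem {a : ℕ} (c : Cmd) (h : a ∉ c.realWrites) (s : Memory) :
    (c.run s).real a = s.real a := by
  induction c generalizing s with
  | skip => rfl
  | setNat a' i x => simp [run, Memory.writeNat]
  | setReal a' i x =>
    simp only [realWrites, List.mem_singleton] at h
    simp [run, Memory.writeReal, Function.update_of_ne h]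
  | seq c d hc hd =>
    simp only [realWrites, List.mem_append, not_or] at h
    simp only [run]; rw [hd h.2, hc h.1]
  | ite b c d hc hd =>
    simp only [realWrites, List.mem_append, not_or] at h
    simp only [run]; split_ifs
    · exact hc h.1 s
    · exact hd h.2 s
  | count v b c hc =>
    simp only [realWrites] at h
    have : ∀ k, (rounds c.run v s k).real a = s.real a := by
      intro k
      induction k with
      | zero => simp [rounds, Memory.writeNat]
      | succ k ih =>
        simp only [rounds, Memory.writeNat]
        rw [hc h, ih]
    exact this _

/-- A structured program halts, in the memory given by `run`, within its time bound. -/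
theorem exists_run (c : Cmd) (hc : c.wf = true) (hz : 0 ∉ c.natWrites) (N : ℕ) (s : Memory)
    (hN : ∀ b ≤ 1, s.nat 0 b ≤ N) :
    ∃ t ≤ c.time.eval N, Run c.toProgram s (c.run s) t := by
  induction c generalizing s with
  | skip => exact ⟨1, by simp [time], .skip s⟩
  | setNat a i x => exact ⟨_, by simp [time], .setNat s a i x⟩
  | setReal a i x => exact ⟨_, by simp [time], .setReal s a i x⟩
  | seq c d ihc ihd =>
    simp only [wf, Bool.and_eq_true] at hc
    simp only [natWrites, List.mem_append, not_or] at hz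
    obtain ⟨t, ht, h⟩ := ihc hc.1 hz.1 s hN
    obtain ⟨t', ht', h'⟩ := ihd hc.2 hz.2 (c.run s) (by rwa [run_nat_of_notMem c hz.1])
    refine ⟨t + t', ?_, .seq h h'⟩
    simp only [time, Polynomial.eval_add]; omega
  | ite b c d ihc ihd =>
    simp only [wf, Bool.and_eq_true] at hc
    simp only [natWrites, List.mem_append, not_or] at hz
    obtain ⟨t, ht, h⟩ := ihc hc.1 hz.1 s hN
    obtain ⟨t', ht', h'⟩ := ihd hc.2 hz.2 s hN
    by_cases hb : b.Holds s
    · refine ⟨b.cost + t, ?_, ?_⟩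
      · simp only [time, Polynomial.eval_add, Polynomial.eval_C]; omega
      · simp only [toProgram, run, if_pos hb]; exact .iteTrue hb h
    · refine ⟨b.cost + t', ?_, ?_⟩
      · simp only [time, Polynomial.eval_add, Polynomial.eval_C]; omega
      · simp only [toProgram, run, if_neg hb]; exact .iteFalse hb h'
  | count v b c ih =>
    simp only [wf, Bool.and_eq_true, decide_eq_true_eq] at hc
    obtain ⟨⟨⟨⟨hwf, hb⟩, hv⟩, hvc⟩, h0⟩ := hc
    have hnat : ∀ k, (rounds c.run v s k).nat 0 = s.nat 0 := by
      intro k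
      induction k with
      | zero => simp [rounds, Memory.writeNat, Function.update_of_ne hv.symm]
      | succ k ih' =>
        simp only [rounds, Memory.writeNat, Function.update_of_ne hv.symm]
        rw [run_nat_of_notMem c h0, ih']
    have hcnt : ∀ k, (rounds c.run v s k).nat v 0 = k := by
      intro k
      cases k <;> simp [rounds, Memory.writeNat]
    -- the loop started after round `k` needs the remaining `s.nat 0 b - k` rounds
    have key : ∀ j k, k + j = s.nat 0 b → ∃ t ≤ 6 + j * (c.time.eval N + 12),
        Run (.loop (.not (.natLE (.read 0 (.lit b)) (.var v)))
          (.seq c.toProgram (.setNat v (.lit 0) (.add (.var v) (.lit 1)))))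
          (rounds c.run v s k) (rounds c.run v s (s.nat 0 b)) t := by
      intro j
      induction j with
      | zero =>
        intro k hk
        have hb' : ¬ Test.Holds (rounds c.run v s k)
            (.not (.natLE (.read 0 (.lit b)) (.var v))) := by
          simp only [Test.Holds, NatExpr.eval, hnat, hcnt]; omega
        refine ⟨_, ?_, (by simpa [hk.symm] using Run.loopFalse hb')⟩
        simp [Test.cost, NatExpr.cost]
      | succ j ihj =>
        intro k hk
        have hb' : Test.Holds (rounds c.run v s k)
            (.not (.natLE (.read 0 (.lit b)) (.var v))) := by
          simp only [Test.Holds, NatExpr.eval, hnat, hcnt]; omega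
        obtain ⟨t, ht, h⟩ := ih hwf h0 (rounds c.run v s k) (by rwa [hnat])
        obtain ⟨t', ht', h'⟩ := ihj (k + 1) (by omega)
        have hset := Run.setNat (c.run (rounds c.run v s k)) v (.lit 0)
          (.add (.var v) (.lit 1))
        have hval : NatExpr.eval (c.run (rounds c.run v s k)) (.add (.var v) (.lit 1)) = k + 1 := by
          simp only [NatExpr.eval]
          rw [run_nat_of_notMem c hvc, hcnt]
        rw [hval] at hset
        refine ⟨_, ?_, .loopTrue hb' (.seq h hset) h'⟩
        simp only [Test.cost, NatExpr.cost]
        have : (j + 1) * (c.time.eval N + 12) =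
          j * (c.time.eval N + 12) + (c.time.eval N + 12) := by ring
        omega
    obtain ⟨t, ht, h⟩ := key (s.nat 0 b) 0 (by omega)
    refine ⟨_, ?_, .seq (.setNat s v (.lit 0) (.lit 0)) h⟩
    have hle := Nat.mul_le_mul_right (c.time.eval N + 12) (hN b hb)
    simp only [time, Polynomial.eval_add, Polynomial.eval_mul, Polynomial.eval_X, NatExpr.cost,
      Polynomial.eval_ofNat]
    omega

/-- The rule for counting loops, with an invariant `I`.  In every round the arrays that the loop
does not write to are as they were at the start. -/
theorem run_count {v b : ℕ} {c : Cmd} {s : Memory} (I : ℕ → Memory → Prop)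
    (h0 : I 0 (s.writeNat v 0 0))
    (hstep : ∀ k s', k < s.nat 0 b → s'.nat v 0 = k →
      (∀ a, a ≠ v → a ∉ c.natWrites → s'.nat a = s.nat a) →
      (∀ a, a ∉ c.realWrites → s'.real a = s.real a) →
      I k s' → I (k + 1) ((c.run s').writeNat v 0 (k + 1))) :
    I (s.nat 0 b) ((count v b c).run s) := by
  have key : ∀ k ≤ s.nat 0 b, I k (rounds c.run v s k) ∧ (rounds c.run v s k).nat v 0 = k ∧
      (∀ a, a ≠ v → a ∉ c.natWrites → (rounds c.run v s k).nat a = s.nat a) ∧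
      (∀ a, a ∉ c.realWrites → (rounds c.run v s k).real a = s.real a) := by
    intro k
    induction k with
    | zero =>
      intro _
      exact ⟨h0, by simp [rounds, Memory.writeNat],
        fun a ha _ => by simp [rounds, Memory.writeNat, Function.update_of_ne ha],
        fun a _ => by simp [rounds, Memory.writeNat]⟩
    | succ k ih =>
      intro hk
      obtain ⟨h1, h2, h3, h4⟩ := ih (by omega)
      refine ⟨hstep k _ (by omega) h2 h3 h4 h1, by simp [rounds, Memory.writeNat], ?_, ?_⟩
      · intro a ha ha'
        simp only [rounds, Memory.writeNat, Function.update_of_ne ha]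
        rw [run_nat_of_notMem c ha', h3 a ha ha']
      · intro a ha
        simp only [rounds, Memory.writeNat]
        rw [run_real_of_notMem c ha, h4 a ha]
  exact (key _ le_rfl).1

end Cmd

/-! ### Splits of the edge classes and the scan -/

/-- The position after `k` on a cycle with positions `0, …, n - 1`. -/
def nextPos (n k : ℕ) : ℕ := if k + 1 = n then 0 else k + 1

/-- The position before `k` on a cycle with positions `0, …, n - 1`. -/
def prevPos (n k : ℕ) : ℕ := if k = 0 then n - 1 else k - 1

/-- Every edge class `k` of the cycle, between the positions `k` and `nextPos n k`, split into two
parts `A` and `B`, with the values of the parts to the two endpoints (`l`: to `k`, `r`: to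
`nextPos n k`), the positions `oA k` and `oB k` that receive them, and whether the split is EFX
for either endpoint. -/
structure Split where
  lA : ℕ → ℝ
  lB : ℕ → ℝ
  rA : ℕ → ℝ
  rB : ℕ → ℝ
  oA : ℕ → ℕ
  oB : ℕ → ℕ
  efxL : ℕ → Prop
  efxR : ℕ → Prop

/-- The value that position `p` assigns to everything that position `j` receives. -/
def Split.val (S : Split) (n p j : ℕ) : ℝ :=
  (if S.oA p = j then S.lA p else 0) + (if S.oB p = j then S.lB p else 0) +
    (if S.oA (prevPos n p) = j then S.rA (prevPos n p) else 0) +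
    (if S.oB (prevPos n p) = j then S.rB (prevPos n p) else 0)

/-- A sufficient condition for `p` not to envy `j` strongly: either there is no envy, or `j` holds
a single part of an edge class whose split is EFX for `p`, and `p` has at least the value of the
other part.  Of the four possibilities for such a part (`A` or `B`, previous or next class) only
two are needed: `efxR` concerns part `A` in the eyes of the second endpoint, `efxL` part `B` in the
eyes of the first. -/
def Split.Content (S : Split) (n p j : ℕ) : Prop :=
  S.val n p j ≤ S.val n p p ∨
  (S.oA (prevPos n p) = j ∧ (∀ k < n, S.oB k ≠ j) ∧ (∀ k < n, k ≠ prevPos n p → S.oA k ≠ j) ∧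
    S.efxR (prevPos n p) ∧ S.rB (prevPos n p) ≤ S.val n p p) ∨
  (S.oB p = j ∧ (∀ k < n, S.oA k ≠ j) ∧ (∀ k < n, k ≠ p → S.oB k ≠ j) ∧
    S.efxL p ∧ S.lA p ≤ S.val n p p)

/-- The data of the scan, for the positions `0, …, n - 1` and the edge classes `k` between `k` and
`k + 1` (the last one between `n - 1` and `0`).

Every class has a chosen half `P` and another half `Q`; `lP`, `lQ` are their values to the left
endpoint and `rP`, `rQ` those to the right endpoint.  If `pr k` the left endpoint has chosen, and
otherwise the right endpoint has.  The endpoint that has chosen holds `P` as its share, the other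
one holds `Q`; `Lsh k` and `Rsh k` are the values to position `k` of its shares of the previous and
of the next class, and `prim k` is the largest of the values to `k` of its share of the previous
class and the two halves of the next.

`env k` says that half `P` of class `k` is envied by `k + 1`: even when `k + 1` holds both its
shares, or because `k + 1` is itself envied and prefers `P` to everything measured by `prim`.  Runs
of envied positions form chains.  Along a chain, `sh k` says that `k` and `k + 1` exchange their
shares of class `k`; this begins at the first position that does not lose by giving up `P` for `Q`
while it has its share of the previous class, and it goes on to the end of the chain.  The envied
positions before are lonely (`lon`), and `d k` is the first position after `k` that is not lonely.

By `start` and `start'`, position `0` likes its half `P` of class `0` at least as much as either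
half of class `n - 1`; it chooses from class `0`, and `n - 1` chooses from class `n - 1`. -/
structure Scan (n : ℕ) where
  lP : ℕ → ℝ
  lQ : ℕ → ℝ
  rP : ℕ → ℝ
  rQ : ℕ → ℝ
  Lsh : ℕ → ℝ
  Rsh : ℕ → ℝ
  prim : ℕ → ℝ
  pr : ℕ → Prop
  env : ℕ → Prop
  sh : ℕ → Prop
  lon : ℕ → Prop
  d : ℕ → ℕ
  three : 3 ≤ n
  lP_nonneg : ∀ k < n, 0 ≤ lP k
  lQ_nonneg : ∀ k < n, 0 ≤ lQ k
  rP_nonneg : ∀ k < n, 0 ≤ rP k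
  rQ_nonneg : ∀ k < n, 0 ≤ rQ k
  left_best : ∀ k < n, pr k → lQ k ≤ lP k
  right_best : ∀ k < n, ¬ pr k → rQ k ≤ rP k
  pr_zero : pr 0
  pr_last : pr (n - 1)
  Lsh_le : ∀ k, 1 ≤ k → k + 1 < n → pr k → Lsh k ≤ lP k
  le_Lsh : ∀ k < n, ¬ pr k → lP k ≤ Lsh k ∧ lQ k ≤ Lsh k
  Lsh_zero : Lsh 0 = rQ (n - 1)
  Lsh_succ : ∀ k, k + 1 < n → pr k → Lsh (k + 1) = rQ k
  Lsh_succ' : ∀ k, k + 1 < n → ¬ pr k → Lsh (k + 1) = rP k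
  Rsh_eq : ∀ k < n, pr k → Rsh k = lP k
  Rsh_eq' : ∀ k < n, ¬ pr k → Rsh k = lQ k
  prim_eq : ∀ k < n, prim k = max (Lsh k) (max (lP k) (lQ k))
  start : rP (n - 1) ≤ lP 0
  start' : rQ (n - 1) ≤ lP 0
  env_last : ¬ env (n - 1)
  env_iff : ∀ k, k + 1 < n → (env k ↔ pr k ∧ (rQ k + Rsh (k + 1) < rP k ∨
    (prim (k + 1) < rP k ∧ env (k + 1))))
  sh_iff : ∀ k < n, (sh k ↔ env k ∧ (lP k ≤ lQ k + Lsh k ∨ (1 ≤ k ∧ sh (k - 1))))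
  lon_iff : ∀ k < n, (lon k ↔ env k ∧ ¬ sh k)
  d_lon : ∀ k, k + 1 < n → lon (k + 1) → d k = d (k + 1)
  d_not : ∀ k, k + 1 < n → ¬ lon (k + 1) → d k = k + 1

namespace Scan

variable {n : ℕ} (S : Scan n)

theorem prim_ge {k : ℕ} (hk : k < n) : S.Lsh k ≤ S.prim k ∧ S.lP k ≤ S.prim k ∧
    S.lQ k ≤ S.prim k := by
  rw [S.prim_eq k hk]; simp

/-- The chosen half of an envied position belongs to that position, not to the next one. -/
theorem env_pr {k : ℕ} (hk : k < n) (h : S.env k) : k + 1 < n ∧ S.pr k := by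
  have hlt : k + 1 < n := by
    by_contra hc
    have : k = n - 1 := by omega
    exact S.env_last (this ▸ h)
  exact ⟨hlt, ((S.env_iff k hlt).1 h).1⟩

/-- The share of `k + 1` in the previous edge class is worth at least the half `Q` to it. -/
theorem rQ_le_Lsh {k : ℕ} (hk : k + 1 < n) : S.rQ k ≤ S.Lsh (k + 1) := by
  by_cases h : S.pr k
  · exact (S.Lsh_succ k hk h).ge
  · rw [S.Lsh_succ' k hk h]; exact S.right_best k (by omega) h

/-- The next position values an envied half `P` more than its best single half or share. -/
theorem env_weak {k : ℕ} (hk : k < n) (h : S.env k) : S.prim (k + 1) < S.rP k := by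
  obtain ⟨hlt, hpr⟩ := S.env_pr hk h
  rcases ((S.env_iff k hlt).1 h).2 with hf | hf
  · rw [S.prim_eq _ hlt, S.Lsh_succ k hlt hpr]
    have h1 := S.rQ_nonneg k hk
    by_cases hp : S.pr (k + 1)
    · rw [S.Rsh_eq _ hlt hp] at hf
      have := S.left_best _ hlt hp
      have := S.lP_nonneg _ hlt
      simp only [max_lt_iff]; refine ⟨?_, ?_, ?_⟩ <;> linarith
    · rw [S.Rsh_eq' _ hlt hp] at hf
      have h2 := S.le_Lsh _ hlt hp
      rw [S.Lsh_succ k hlt hpr] at h2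
      have := S.lQ_nonneg _ hlt
      simp only [max_lt_iff]; refine ⟨?_, ?_, ?_⟩ <;> linarith
  · exact hf.1

/-- To an envied position other than `0`, its half `P` is the best that `prim` measures. -/
theorem prim_of_env {k : ℕ} (hk : k < n) (h : S.env k) (h1 : 1 ≤ k) : S.prim k = S.lP k := by
  obtain ⟨hlt, hpr⟩ := S.env_pr hk h
  rw [S.prim_eq k hk, max_eq_left (S.left_best k hk hpr), max_eq_right (S.Lsh_le k h1 hlt hpr)]

theorem lon_env {k : ℕ} (hk : k < n) (h : S.lon k) : S.env k ∧ ¬ S.sh k := (S.lon_iff k hk).1 h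

theorem lon_lt {k : ℕ} (hk : k < n) (h : S.lon k) : k + 1 < n :=
  (S.env_pr hk (S.lon_env hk h).1).1

/-- A lonely position prefers its half `P` to all its leftovers together. -/
theorem lon_value {k : ℕ} (hk : k < n) (h : S.lon k) : S.lQ k + S.Lsh k < S.lP k := by
  obtain ⟨h1, h2⟩ := S.lon_env hk h
  by_contra hc
  exact h2 ((S.sh_iff k hk).2 ⟨h1, Or.inl (not_lt.1 hc)⟩)

/-- The position `d k` is the first one after `k` that is not lonely, and it is the same for the
whole run of lonely positions. -/
theorem d_spec : ∀ j k, k + j + 1 = n → S.lon k → k < S.d k ∧ S.d k < n ∧ ¬ S.lon (S.d k) ∧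
    (∀ i, k ≤ i → i < S.d k → S.lon i) ∧ ∀ i, k ≤ i → i < S.d k → S.d i = S.d k := by
  intro j
  induction j with
  | zero =>
    intro k hk h
    exact absurd (S.lon_lt (by omega) h) (by omega)
  | succ j ih =>
    intro k hk h
    by_cases hl : S.lon (k + 1)
    · rw [S.d_lon k (by omega) hl]
      obtain ⟨h1, h2, h3, h4, h5⟩ := ih (k + 1) (by omega) hl
      refine ⟨by omega, h2, h3, fun i hi hi' => ?_, fun i hi hi' => ?_⟩
      · rcases Nat.eq_or_lt_of_le hi with rfl | hi
        · exact h
        · exact h4 i hi hi'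
      · rcases Nat.eq_or_lt_of_le hi with rfl | hi
        · exact S.d_lon k (by omega) hl
        · exact h5 i hi hi'
    · rw [S.d_not k (by omega) hl]
      refine ⟨by omega, by omega, hl, fun i hi hi' => ?_, fun i hi hi' => ?_⟩
      · obtain rfl : i = k := by omega
        exact h
      · obtain rfl : i = k := by omega
        exact S.d_not i (by omega) hl

theorem d_of_lon {k : ℕ} (hk : k < n) (h : S.lon k) : k < S.d k ∧ S.d k < n ∧ ¬ S.lon (S.d k) ∧
    (∀ i, k ≤ i → i < S.d k → S.lon i) ∧ ∀ i, k ≤ i → i < S.d k → S.d i = S.d k :=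
  S.d_spec (n - 1 - k) k (by omega) h

/-- Once a chain is shifted, it stays shifted. -/
theorem sh_succ {k : ℕ} (hk : k + 1 < n) (h : S.sh k) (h' : S.env (k + 1)) : S.sh (k + 1) :=
  (S.sh_iff _ hk).2 ⟨h', Or.inr ⟨by omega, by simpa using h⟩⟩

theorem sh_env {k : ℕ} (hk : k < n) (h : S.sh k) : S.env k := ((S.sh_iff k hk).1 h).1

/-! ### The main allocation -/

/-- The parts of the edge classes in the main allocation: part `A` is the share of `k`, after
exchanging shares with `k + 1` where the chain is shifted; part `B` is for the next position, or,
if that is lonely, for the first position after it that is not. -/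
structure IsMain (T : Split) : Prop where
  keep : ∀ k < n, S.pr k → ¬ S.sh k →
    T.lA k = S.lP k ∧ T.lB k = S.lQ k ∧ T.rA k = S.rP k ∧ T.rB k = S.rQ k
  swap : ∀ k < n, (S.pr k → S.sh k) →
    T.lA k = S.lQ k ∧ T.lB k = S.lP k ∧ T.rA k = S.rQ k ∧ T.rB k = S.rP k
  oA : ∀ k < n, T.oA k = k
  oB_lon : ∀ k < n, S.lon (nextPos n k) → T.oB k = S.d (nextPos n k)
  oB_not : ∀ k < n, ¬ S.lon (nextPos n k) → T.oB k = nextPos n k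
  efxR : ∀ k < n, T.efxR k

variable {S} {T : Split}

/-- Nothing but its half `P` goes to a lonely position. -/
theorem IsMain.oB_not_lon (h : S.IsMain T) {k : ℕ} (hk : k < n) : ¬ S.lon (T.oB k) := by
  have hn : nextPos n k < n := by unfold nextPos; have := S.three; split_ifs <;> omega
  by_cases hl : S.lon (nextPos n k)
  · rw [h.oB_lon k hk hl]; exact (S.d_of_lon hn hl).2.2.1
  · rw [h.oB_not k hk hl]; exact hl

theorem IsMain.nonneg (h : S.IsMain T) {k : ℕ} (hk : k < n) :
    0 ≤ T.lA k ∧ 0 ≤ T.lB k ∧ 0 ≤ T.rA k ∧ 0 ≤ T.rB k := by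
  have h1 := S.lP_nonneg k hk
  have h2 := S.lQ_nonneg k hk
  have h3 := S.rP_nonneg k hk
  have h4 := S.rQ_nonneg k hk
  by_cases hc : S.pr k ∧ ¬ S.sh k
  · obtain ⟨e1, e2, e3, e4⟩ := h.keep k hk hc.1 hc.2
    rw [e1, e2, e3, e4]; exact ⟨h1, h2, h3, h4⟩
  · obtain ⟨e1, e2, e3, e4⟩ := h.swap k hk (fun hp => by by_contra hs; exact hc ⟨hp, hs⟩)
    rw [e1, e2, e3, e4]; exact ⟨h2, h1, h4, h3⟩

/-- The share of the previous edge class is what `Lsh` says, unless the chain is shifted there. -/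
theorem IsMain.rB_eq_Lsh (h : S.IsMain T) {k : ℕ} (hk : k + 1 < n) (hs : ¬ S.sh k) :
    T.rB k = S.Lsh (k + 1) := by
  by_cases hp : S.pr k
  · rw [(h.keep k (by omega) hp hs).2.2.2, S.Lsh_succ k hk hp]
  · rw [(h.swap k (by omega) (fun h => absurd h hp)).2.2.2, S.Lsh_succ' k hk hp]

/-- Where the chain is shifted, `k + 1` receives the half of `k` that it envied. -/
theorem IsMain.rB_of_sh (h : S.IsMain T) {k : ℕ} (hk : k < n) (hs : S.sh k) :
    S.prim (k + 1) < T.rB k := by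
  rw [(h.swap k hk (fun _ => hs)).2.2.2]
  exact S.env_weak hk (S.sh_env hk hs)

/-- In either case `k + 1` values its part of the previous edge class at least as `Lsh`. -/
theorem IsMain.Lsh_le_rB (h : S.IsMain T) {k : ℕ} (hk : k + 1 < n) :
    S.Lsh (k + 1) ≤ T.rB k := by
  by_cases hs : S.sh k
  · exact ((S.prim_ge hk).1.trans_lt (h.rB_of_sh (by omega) hs)).le
  · exact (h.rB_eq_Lsh hk hs).ge

/-- To position `k + 1`, part `B` of its next class is worth no more than its own parts of both
classes together. -/
theorem IsMain.lB_le (h : S.IsMain T) {k : ℕ} (hk : k + 1 < n) :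
    T.lB (k + 1) ≤ T.lA (k + 1) + T.rB k := by
  have hL := h.Lsh_le_rB hk
  have hr := (h.nonneg (k := k) (by omega)).2.2.2
  have hQ := S.lQ_nonneg _ hk
  by_cases hs1 : S.sh (k + 1)
  · obtain ⟨e1, e2, -, -⟩ := h.swap _ hk (fun _ => hs1)
    rw [e1, e2]
    rcases ((S.sh_iff _ hk).1 hs1).2 with hw | ⟨-, hw⟩
    · linarith
    · have := h.rB_of_sh (k := k) (by omega) (by simpa using hw)
      have := (S.prim_ge hk).2.1
      linarith
  · by_cases hp : S.pr (k + 1)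
    · obtain ⟨e1, e2, -, -⟩ := h.keep _ hk hp hs1
      rw [e1, e2]
      have := S.left_best _ hk hp
      linarith
    · obtain ⟨e1, e2, -, -⟩ := h.swap _ hk (fun h => absurd h hp)
      rw [e1, e2]
      have := S.le_Lsh _ hk hp
      linarith

/-- To position `k + 1`, part `A` of its previous class is worth no more than its own parts of both
classes together, unless it is held by a lonely position. -/
theorem IsMain.rA_le (h : S.IsMain T) {k : ℕ} (hk : k + 1 < n) (hl : ¬ S.lon k) :
    T.rA k ≤ T.lA (k + 1) + T.rB k := by
  have hk' : k < n := by omega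
  have hA := (h.nonneg hk).1
  by_cases hs : S.sh k
  · have h1 := h.rB_of_sh hk' hs
    rw [(h.swap k hk' (fun _ => hs)).2.2.1]
    have := (S.prim_ge hk).1
    have := S.rQ_le_Lsh hk
    linarith
  · have he : ¬ S.env k := fun he => hl ((S.lon_iff k hk').2 ⟨he, hs⟩)
    by_cases hp : S.pr k
    · obtain ⟨-, -, e3, e4⟩ := h.keep k hk' hp hs
      rw [e3, e4]
      rw [S.env_iff k hk] at he
      have hf : ¬ (S.rQ k + S.Rsh (k + 1) < S.rP k) := fun hf => he ⟨hp, Or.inl hf⟩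
      by_cases hs1 : S.sh (k + 1)
      · have hw : ¬ (S.prim (k + 1) < S.rP k) :=
          fun hw => he ⟨hp, Or.inr ⟨hw, S.sh_env hk hs1⟩⟩
        rw [S.prim_of_env hk (S.sh_env hk hs1) (by omega)] at hw
        rw [(h.swap _ hk (fun _ => hs1)).1]
        rcases ((S.sh_iff _ hk).1 hs1).2 with hw' | ⟨-, hw'⟩
        · rw [S.Lsh_succ k hk hp] at hw'; linarith
        · exact absurd (by simpa using hw') hs
      · by_cases hp1 : S.pr (k + 1)
        · rw [(h.keep _ hk hp1 hs1).1]
          rw [S.Rsh_eq _ hk hp1] at hf; linarith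
        · rw [(h.swap _ hk (fun h => absurd h hp1)).1]
          rw [S.Rsh_eq' _ hk hp1] at hf; linarith
    · obtain ⟨-, -, e3, e4⟩ := h.swap k hk' (fun h => absurd h hp)
      rw [e3, e4]
      have := S.right_best k hk' hp
      linarith

/-- Every position after the first is content in the main allocation.  The hypothesis `hw` excludes
that it is the last one and would envy the position before it, because that receives the leftovers
of a chain that starts at position `0`. -/
theorem IsMain.content_succ (h : S.IsMain T) {k : ℕ} (hk : k + 1 < n)
    (hw : k + 2 = n → S.lon 0 → S.d 0 = k → ¬ S.env k → S.pr k →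
      S.rP k + S.lQ (k + 1) ≤ S.rQ k + S.lP (k + 1))
    (j : ℕ) (hj : j ≠ k + 1) : T.Content n (k + 1) j := by
  have hn := S.three
  have hk' : k < n := by omega
  have hprev : prevPos n (k + 1) = k := by simp [prevPos]
  have hnext : nextPos n k = k + 1 := by unfold nextPos; rw [if_neg (by omega)]
  obtain ⟨a1, a2, -, -⟩ := h.nonneg hk
  obtain ⟨-, -, b3, b4⟩ := h.nonneg hk'
  have oA1 := h.oA _ hk
  have oA0 := h.oA _ hk'
  unfold Split.Content
  simp only [Split.val, hprev, oA1, oA0]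
  by_cases hl : S.lon (k + 1)
  · -- a lonely position
    obtain ⟨d1, d2, d3, -, -⟩ := S.d_of_lon hk hl
    have hlt := S.lon_lt hk hl
    obtain ⟨he, hs⟩ := S.lon_env hk hl
    have hnext1 : nextPos n (k + 1) = k + 2 := by unfold nextPos; rw [if_neg (by omega)]
    have oB0 : T.oB k = S.d (k + 1) := by
      rw [h.oB_lon k hk' (by rwa [hnext]), hnext]
    have oB1 : T.oB (k + 1) = S.d (k + 1) := by
      by_cases hl2 : S.lon (k + 2)
      · rw [h.oB_lon _ hk (by rwa [hnext1]), hnext1, S.d_lon _ hlt hl2]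
      · rw [h.oB_not _ hk (by rwa [hnext1]), hnext1, S.d_not _ hlt hl2]
    have hpr := (S.env_pr hk he).2
    obtain ⟨e1, e2, -, -⟩ := h.keep _ hk hpr hs
    have hs0 : ¬ S.sh k := fun hs0 => hs (S.sh_succ hk hs0 he)
    have hv := S.lon_value hk hl
    have hB := h.rB_eq_Lsh hk hs0
    have hprim := S.prim_of_env hk he (by omega)
    have hQL := S.rQ_le_Lsh hk
    have hge := S.prim_ge hk
    rw [oB0, oB1, e1, e2, hB]
    have hd : ¬ S.d (k + 1) = k + 1 := by omega
    have hkk : ¬ k = k + 1 := by omega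
    simp only [if_true, if_neg hd, if_neg hkk, add_zero]
    by_cases hjk : k = j
    · subst hjk
      have h1 : ¬ k + 1 = k := by omega
      have h2 : ¬ S.d (k + 1) = k := by omega
      simp only [if_true, if_neg h1, if_neg h2, add_zero, zero_add]
      by_cases hlk : S.lon k
      · right; left
        refine ⟨trivial, fun i hi hc => h.oB_not_lon hi (hc ▸ hlk), fun i hi hik hc => ?_,
          h.efxR k hk', by linarith⟩
        rw [h.oA i hi] at hc; exact hik hc
      · left
        have hek : ¬ S.env k := fun hc => hlk ((S.lon_iff k hk').2 ⟨hc, hs0⟩)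
        by_cases hp : S.pr k
        · rw [(h.keep k hk' hp hs0).2.2.1]
          by_contra hc
          exact hek ((S.env_iff k hk).2 ⟨hp, Or.inr ⟨by rw [hprim]; linarith, he⟩⟩)
        · rw [(h.swap k hk' (fun hc => absurd hc hp)).2.2.1]
          linarith
    · left
      have h1 : ¬ k + 1 = j := fun hc => hj hc.symm
      rw [if_neg h1, if_neg hjk]
      split_ifs <;> linarith [S.lP_nonneg _ hk]
  · have oB0 : T.oB k = k + 1 := by rw [h.oB_not k hk' (by rwa [hnext]), hnext]
    have h1 : ¬ k + 1 = j := fun hc => hj hc.symm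
    have hkk : ¬ k = k + 1 := by omega
    rw [oB0]
    simp only [if_true, if_neg hkk, if_neg h1, add_zero, zero_add]
    have hlB := h.lB_le hk
    have hown : T.lA (k + 1) + T.rB k ≤
        T.lA (k + 1) + (if T.oB (k + 1) = k + 1 then T.lB (k + 1) else 0) + T.rB k := by
      split_ifs <;> linarith
    by_cases hjk : k = j
    · subst hjk
      simp only [if_true]
      by_cases hw' : T.oB (k + 1) = k
      · -- the position after `k + 1` is `0`, whose leftovers go to `k`
        have hlast : k + 2 = n := by
          by_contra hc
          have hnext1 : nextPos n (k + 1) = k + 2 := by unfold nextPos; rw [if_neg (by omega)]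
          by_cases hl2 : S.lon (k + 2)
          · rw [h.oB_lon _ hk (by rwa [hnext1]), hnext1] at hw'
            have := (S.d_of_lon (by omega) hl2).1
            omega
          · rw [h.oB_not _ hk (by rwa [hnext1]), hnext1] at hw'
            omega
        have hnext1 : nextPos n (k + 1) = 0 := by unfold nextPos; rw [if_pos (by omega)]
        have hl0 : S.lon 0 := by
          by_contra hc
          rw [h.oB_not _ hk (by rwa [hnext1]), hnext1] at hw'
          omega
        have hd0 : S.d 0 = k := by
          rw [h.oB_lon _ hk (by rwa [hnext1]), hnext1] at hw'
          exact hw'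
        have hlk : ¬ S.lon k := by rw [← hd0]; exact (S.d_of_lon (by omega) hl0).2.2.1
        left
        rw [if_pos hw', if_neg (by omega)]
        have hplast : S.pr (k + 1) := by
          have := S.pr_last; rwa [show n - 1 = k + 1 by omega] at this
        have hslast : ¬ S.sh (k + 1) := fun hc => by
          have := S.env_last
          rw [show n - 1 = k + 1 by omega] at this
          exact this (S.sh_env hk hc)
        obtain ⟨e1, e2, -, -⟩ := h.keep _ hk hplast hslast
        have hb := S.left_best _ hk hplast
        rw [e1, e2]
        by_cases hs : S.sh k
        · obtain ⟨-, -, e3, e4⟩ := h.swap k hk' (fun _ => hs)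
          have := S.env_weak hk' (S.sh_env hk' hs)
          have := S.rQ_le_Lsh hk
          have := (S.prim_ge hk).1
          rw [e3, e4]; linarith
        · by_cases hp : S.pr k
          · obtain ⟨-, -, e3, e4⟩ := h.keep k hk' hp hs
            have := hw hlast hl0 hd0 (fun hc => hlk ((S.lon_iff k hk').2 ⟨hc, hs⟩)) hp
            rw [e3, e4]; linarith
          · obtain ⟨-, -, e3, e4⟩ := h.swap k hk' (fun hc => absurd hc hp)
            have := S.right_best k hk' hp
            rw [e3, e4]; linarith
      · by_cases hlk : S.lon k
        · right; left
          refine ⟨trivial, fun i hi hc => h.oB_not_lon hi (hc ▸ hlk), fun i hi hik hc => ?_,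
            h.efxR k hk', by linarith⟩
          rw [h.oA i hi] at hc; exact hik hc
        · left
          have := h.rA_le hk hlk
          rw [if_neg hw']
          linarith
    · left
      rw [if_neg hjk]
      split_ifs <;> linarith

/-- Position `0` is content in the main allocation.  The hypotheses `hw` and `hw'` exclude that it
would envy the last position, because that receives the leftovers of a chain that starts at
position `0` or `1`. -/
theorem IsMain.content_zero (h : S.IsMain T) (hw : S.lon 0 → S.d 0 ≠ n - 1)
    (hw' : ¬ S.lon 0 → S.lon 1 → S.d 1 = n - 1 →
      S.lQ 0 + S.rP (n - 1) ≤ S.lP 0 + S.rQ (n - 1))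
    (j : ℕ) (hj : j ≠ 0) : T.Content n 0 j := by
  have hn := S.three
  have h0 : 0 < n := by omega
  have hl : n - 1 < n := by omega
  have hprev : prevPos n 0 = n - 1 := by simp [prevPos]
  have hnext : nextPos n (n - 1) = 0 := by unfold nextPos; rw [if_pos (by omega)]
  have hnext0 : nextPos n 0 = 1 := by unfold nextPos; rw [if_neg (by omega)]
  obtain ⟨a1, a2, -, -⟩ := h.nonneg h0
  obtain ⟨-, -, b3, b4⟩ := h.nonneg hl
  have oA0 := h.oA _ h0
  have oAl := h.oA _ hl
  have hsl : ¬ S.sh (n - 1) := fun hc => S.env_last (S.sh_env hl hc)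
  obtain ⟨-, -, e3, e4⟩ := h.keep _ hl S.pr_last hsl
  have st := S.start
  have st' := S.start'
  have hL := S.Lsh_zero
  have hoB0 : T.oB 0 ≠ 0 := by
    by_cases hl1 : S.lon 1
    · rw [h.oB_lon 0 h0 (by rwa [hnext0]), hnext0]
      have := (S.d_of_lon (by omega) hl1).1
      omega
    · rw [h.oB_not 0 h0 (by rwa [hnext0]), hnext0]; omega
  left
  have hj' : ¬ 0 = j := fun hc => hj hc.symm
  have hl0 : ¬ n - 1 = 0 := by omega
  simp only [Split.val, hprev, oA0, oAl, if_true, if_neg hj', if_neg hoB0, if_neg hl0, add_zero,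
    zero_add]
  by_cases hlon : S.lon 0
  · obtain ⟨d1, d2, d3, -, -⟩ := S.d_of_lon h0 hlon
    have hs := (S.lon_env h0 hlon).2
    obtain ⟨e1, e2, -, -⟩ := h.keep 0 h0 S.pr_zero hs
    have oBl : T.oB (n - 1) = S.d 0 := by rw [h.oB_lon _ hl (by rwa [hnext]), hnext]
    have hv := S.lon_value h0 hlon
    have hd0 := hw hlon
    have oB0 : T.oB 0 = S.d 0 := by
      by_cases hl1 : S.lon 1
      · rw [h.oB_lon 0 h0 (by rwa [hnext0]), hnext0, S.d_lon 0 (by omega) hl1]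
      · rw [h.oB_not 0 h0 (by rwa [hnext0]), hnext0, S.d_not 0 (by omega) hl1]
    rw [oBl, oB0, e1, e2, e3, e4, if_neg (by omega : ¬ S.d 0 = 0)]
    by_cases hjl : n - 1 = j
    · rw [if_pos hjl, if_neg (by omega), if_neg (by omega)]; linarith
    · rw [if_neg hjl]
      split_ifs <;> linarith [S.lP_nonneg 0 h0]
  · have oBl : T.oB (n - 1) = 0 := by rw [h.oB_not _ hl (by rwa [hnext]), hnext]
    rw [oBl, e3, e4, if_pos rfl, if_neg hj']
    have hQ := S.rQ_nonneg _ hl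
    have hA : S.lP 0 ≤ T.lA 0 + S.rQ (n - 1) ∧ T.lB 0 ≤ T.lA 0 + S.rQ (n - 1) := by
      by_cases hs : S.sh 0
      · obtain ⟨e1, e2, -, -⟩ := h.swap 0 h0 (fun _ => hs)
        rcases ((S.sh_iff 0 h0).1 hs).2 with hc | hc
        · rw [e1, e2]; constructor <;> linarith
        · exact absurd hc.1 (by omega)
      · obtain ⟨e1, e2, -, -⟩ := h.keep 0 h0 S.pr_zero hs
        have := S.left_best 0 h0 S.pr_zero
        rw [e1, e2]; constructor <;> linarith
    by_cases hjl : n - 1 = j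
    · rw [if_pos hjl]
      by_cases hB : T.oB 0 = j
      · rw [if_pos hB]
        have hl1 : S.lon 1 := by
          by_contra hc
          rw [h.oB_not 0 h0 (by rwa [hnext0]), hnext0] at hB
          omega
        have hd1 : S.d 1 = n - 1 := by
          rw [h.oB_lon 0 h0 (by rwa [hnext0]), hnext0] at hB
          omega
        have hs : ¬ S.sh 0 := fun hs =>
          (S.lon_env (by omega) hl1).2 (S.sh_succ (by omega) hs (S.lon_env (by omega) hl1).1)
        obtain ⟨e1, e2, -, -⟩ := h.keep 0 h0 S.pr_zero hs
        have := hw' hlon hl1 hd1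
        rw [e1, e2]; linarith
      · rw [if_neg hB]; linarith
    · rw [if_neg hjl]
      split_ifs <;> linarith

/-! ### The two exceptional allocations -/

variable (S)

/-- The part labels follow the halves `P` and `Q` of edge class `k`. -/
def Keeps (T : Split) (k : ℕ) : Prop :=
  T.lA k = S.lP k ∧ T.lB k = S.lQ k ∧ T.rA k = S.rP k ∧ T.rB k = S.rQ k

/-- The part labels are exchanged against the halves `P` and `Q` of edge class `k`. -/
def Swaps (T : Split) (k : ℕ) : Prop :=
  T.lA k = S.lQ k ∧ T.lB k = S.lP k ∧ T.rA k = S.rQ k ∧ T.rB k = S.rP k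

/-- Edge class `k` is split by an EFX cut of its left endpoint, at least as balanced for the right
endpoint as `P` and `Q`, and the right endpoint prefers part `B`. -/
structure Recut (T : Split) (k : ℕ) : Prop where
  efxL : T.efxL k
  best : T.rA k ≤ T.rB k
  sum : T.rA k + T.rB k = S.rP k + S.rQ k
  ge : S.rP k ≤ T.rB k
  lA_nonneg : 0 ≤ T.lA k
  lB_nonneg : 0 ≤ T.lB k

/-- A chain of lonely positions starts at position `0` and its leftovers would go to position
`n - 1`, next to position `0`, or to position `n - 2`, where position `n - 1` would envy them. -/
def RotateAll : Prop :=
  S.lon 0 ∧ (S.d 0 = n - 1 ∨ (S.d 0 = n - 2 ∧ ¬ S.env (n - 2) ∧ S.pr (n - 2) ∧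
    S.rQ (n - 2) + S.lP (n - 1) < S.rP (n - 2) + S.lQ (n - 1)))

/-- The allocation in which the halves `P` of the classes `1, …, n - 2` move on to the next
position.  Class `0` is cut again, and position `1` receives its better part of it and nothing else;
its half `Q` of edge class `1` goes to position `0`. -/
structure IsRotateAll (T : Split) : Prop where
  recut : S.Recut T 0
  swap : ∀ k, 1 ≤ k → k + 1 < n → S.Swaps T k
  last : S.Keeps T (n - 1) ∨ S.Swaps T (n - 1)
  last_best : T.rA (n - 1) ≤ T.rB (n - 1)
  oA : ∀ k < n, k ≠ 1 → T.oA k = k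
  oA_one : T.oA 1 = 0
  oB : ∀ k < n, T.oB k = nextPos n k

/-- A chain of lonely positions starts at position `1` and its leftovers would go to position
`n - 1`, where position `0` would envy them. -/
def RotateLast : Prop :=
  ¬ S.lon 0 ∧ S.lon 1 ∧ S.d 1 = n - 1 ∧ S.lP 0 + S.rQ (n - 1) < S.lQ 0 + S.rP (n - 1)

/-- The allocation in which the positions `1, …, n - 3` are lonely, position `n - 1` receives its
better part of a new cut of edge class `n - 2` and nothing else, and position `n - 2` receives all
leftovers except the half `P` of the last class, which goes to position `0`.  For `n = 3` there are
no lonely positions, and position `1` receives its better half of class `0`. -/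
structure IsRotateLast (T : Split) : Prop where
  recut : S.Recut T (n - 2)
  keep : ∀ k, 1 ≤ k → k + 2 < n → S.Keeps T k
  first : S.Keeps T 0 ∨ (n = 3 ∧ S.Swaps T 0)
  first_best : n = 3 → T.rA 0 ≤ T.rB 0
  last : S.Keeps T (n - 1)
  oA : ∀ k, k + 1 < n → T.oA k = k
  oA_last : T.oA (n - 1) = 0
  oB : ∀ k < n, k ≠ n - 2 → T.oB k = n - 2
  oB_last : T.oB (n - 2) = n - 1
  efxR : ∀ k, 1 ≤ k → k + 2 < n → T.efxR k

variable {S}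

/-- The position after the end of a chain envies the end of the chain even when it holds both its
shares. -/
theorem full_of_env {k : ℕ} (hk : k + 1 < n) (h : S.env k) (h' : ¬ S.env (k + 1)) :
    S.rQ k + S.Rsh (k + 1) < S.rP k :=
  (((S.env_iff k hk).1 h).2).resolve_right (fun hc => h' hc.2)

/-- The positions `2, …, n - 1` gain more from the half `P` that moves on to them than they can lose
otherwise. Position `1` is the only one that may be envied, by position `0`, and it holds a single
part of a class whose split is EFX for position `0`. -/
theorem IsRotateAll.content (h : S.IsRotateAll T) (hS : S.RotateAll) {p : ℕ} (hp : p < n) (j : ℕ)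
    (hj : j ≠ p) : T.Content n p j := by
  have hn := S.three
  obtain ⟨hl0, hd⟩ := hS
  obtain ⟨d1, d2, d3, d4, -⟩ := S.d_of_lon (by omega) hl0
  have hd' : n - 2 ≤ S.d 0 := by omega
  have lonk : ∀ k, k + 2 < n → S.lon k := fun k hk => d4 k (by omega) (by omega)
  have envk : ∀ k, k + 2 < n → S.env k := fun k hk => (S.lon_env (by omega) (lonk k hk)).1
  have prl := S.pr_last
  have hlast : n - 2 + 1 = n - 1 := by omega
  -- what position `n - 1` gains in class `n - 2` exceeds anything that it can lose in class `n - 1`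
  have hF : S.rQ (n - 2) + S.lP (n - 1) < S.rP (n - 2) + S.lQ (n - 1) ∧ S.pr (n - 2) := by
    rcases hd with hd | hd
    · have he := (S.lon_env (by omega) (d4 (n - 2) (by omega) (by omega))).1
      have := full_of_env (S := S) (k := n - 2) (by omega) he (by rw [hlast]; exact S.env_last)
      rw [hlast, S.Rsh_eq _ (by omega) prl] at this
      exact ⟨by linarith [S.lQ_nonneg (n - 1) (by omega)], (S.env_pr (by omega) he).2⟩
    · exact ⟨hd.2.2.2, hd.2.2.1⟩
  obtain ⟨hF, hpr2⟩ := hF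
  have prk : ∀ k, k + 1 < n → S.pr k := by
    intro k hk
    by_cases hk2 : k + 2 < n
    · exact (S.env_pr (by omega) (envk k hk2)).2
    · obtain rfl : k = n - 2 := by omega
      exact hpr2
  have hnx : ∀ k, k + 1 < n → nextPos n k = k + 1 := fun k hk => by
    unfold nextPos; rw [if_neg (by omega)]
  have hnl : nextPos n (n - 1) = 0 := by unfold nextPos; rw [if_pos (by omega)]
  obtain ⟨r1, r2, r3, r4, r5, r6⟩ := h.recut
  unfold Split.Content
  have hbl := S.left_best _ (by omega) prl
  have hrP := S.rP_nonneg (n - 2) (by omega)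
  have hrQ := S.rQ_nonneg (n - 2) (by omega)
  have hlQ := S.lQ_nonneg (n - 1) (by omega)
  obtain rfl | hp0 := Nat.eq_zero_or_pos p
  · have hprev : prevPos n 0 = n - 1 := by simp [prevPos]
    have hr0 : 0 ≤ T.rB (n - 1) := by
      rcases h.last with ⟨-, -, -, e⟩ | ⟨-, -, -, e⟩ <;> rw [e]
      · exact S.rQ_nonneg _ (by omega)
      · exact S.rP_nonneg _ (by omega)
    simp only [Split.val, hprev, h.oA 0 hp (by omega), h.oA (n - 1) (by omega) (by omega),
      h.oB 0 hp, h.oB (n - 1) (by omega), hnx 0 (by omega), hnl]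
    by_cases hj1 : j = 1
    · right; right
      subst hj1
      refine ⟨rfl, fun k hk hc => ?_, fun k hk hk0 hc => ?_, r1, ?_⟩
      · by_cases hk1 : k = 1
        · rw [hk1, h.oA_one] at hc; omega
        · rw [h.oA k hk hk1] at hc; exact hk1 hc
      · rw [h.oB k hk] at hc
        by_cases hkl : k + 1 < n
        · rw [hnx k hkl] at hc; omega
        · rw [show k = n - 1 by omega, hnl] at hc; omega
      · simp only [if_true, if_neg (by omega : ¬ 0 + 1 = 0), if_neg (by omega : ¬ n - 1 = 0)]
        linarith
    · left
      have := h.last_best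
      simp only [if_true]
      split_ifs <;> first | omega | linarith
  · obtain ⟨k, rfl⟩ : ∃ k, p = k + 1 := ⟨p - 1, by omega⟩
    have hprev : prevPos n (k + 1) = k := by simp [prevPos]
    have hw := S.env_weak (k := k) (by omega)
    have hge := S.prim_ge hp
    have hQL := S.rQ_le_Lsh hp
    have hLk := S.Lsh_succ k hp (prk k hp)
    left
    by_cases hk0 : k = 0
    · subst hk0
      obtain ⟨e1, e2, -, -⟩ := h.swap 1 le_rfl (by omega)
      have hw := hw (envk 0 (by omega))
      have key : S.lQ 1 + T.rA 0 ≤ T.rB 0 := by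
        by_cases hl1 : S.lon 1
        · have := S.lon_value (by omega) hl1
          simp only [zero_add] at hw hge hLk
          linarith
        · have he1 : ¬ S.env 1 := by
            intro he
            have hs : S.sh 1 := by
              by_contra hs; exact hl1 ((S.lon_iff 1 hp).2 ⟨he, hs⟩)
            rcases (S.sh_iff 1 hp).1 hs with ⟨-, -⟩
            have hd1 : S.d 0 = 1 := S.d_not 0 (by omega) hl1
            rcases hd with hd | ⟨hd, hne, -⟩
            · omega
            · exact hne (by rwa [show n - 2 = 1 by omega])
          have hf := full_of_env (S := S) (by omega) (envk 0 (by omega)) he1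
          rw [S.Rsh_eq 1 hp (prk 1 (by
            by_contra hc
            have : S.d 0 = 1 := S.d_not 0 (by omega) hl1
            omega))] at hf
          have hb := S.left_best 1 hp (prk 1 (by
            by_contra hc
            have : S.d 0 = 1 := S.d_not 0 (by omega) hl1
            omega))
          linarith
      simp only [zero_add] at hw hge hp hj
      simp only [Split.val, prevPos, zero_add, if_neg (one_ne_zero), Nat.sub_self,
        h.oA 0 (by omega) (by omega), h.oA_one, h.oB 0 (by omega), h.oB 1 hp, hnx 0 (by omega),
        hnx 1 (by omega), e1, e2]
      simp only [if_true, if_neg (zero_ne_one), if_neg (by omega : ¬ 1 = j),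
        if_neg (by omega : ¬ 1 + 1 = 1), add_zero, zero_add]
      have := S.lP_nonneg 1 hp
      split_ifs <;> first | omega | linarith
    · obtain ⟨e1, e2, e3, e4⟩ := h.swap k (by omega) hp
      have oAk : T.oA k = if k = 1 then 0 else k := by
        split_ifs with hk1
        · rw [hk1, h.oA_one]
        · exact h.oA k (by omega) hk1
      by_cases hkl : k + 2 < n
      · obtain ⟨f1, f2, -, -⟩ := h.swap (k + 1) (by omega) (by omega)
        have hw := hw (envk k hkl)
        have := S.lQ_nonneg _ hp
        have := S.rQ_nonneg k (by omega)
        have hak : (if k = 1 then 0 else k) ≤ k := by split_ifs <;> omega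
        simp only [Split.val, hprev, oAk, h.oA (k + 1) hp (by omega), h.oB k (by omega),
          h.oB (k + 1) hp, hnx k hp, hnx (k + 1) hkl, e3, e4, f1, f2]
        rw [if_neg (by omega : ¬ k + 1 = j), if_true, if_true,
          if_neg (by omega : ¬ k + 1 + 1 = k + 1),
          if_neg (by omega : ¬ (if k = 1 then 0 else k) = k + 1)]
        split_ifs <;> first | omega | linarith
      · obtain rfl : k = n - 2 := by omega
        have hkk : n - 2 + 1 = n - 1 := by omega
        simp only [hkk] at *
        have hkk : n - 2 + 1 = n - 1 := by omega
        have hlA : S.lQ (n - 1) ≤ T.lA (n - 1) ∧ T.lB (n - 1) ≤ S.lP (n - 1) := by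
          rcases h.last with ⟨g1, g2, -, -⟩ | ⟨g1, g2, -, -⟩ <;> rw [g1, g2] <;>
            constructor <;> linarith
        simp only [Split.val, hprev, oAk, h.oA (n - 1) hp (by omega), h.oB (n - 2) (by omega),
          h.oB (n - 1) hp, hnx (n - 2) (by omega), hnl, e3, e4, hkk]
        rw [if_neg (by omega : ¬ n - 1 = j), if_true, if_true,
          if_neg (by omega : ¬ 0 = n - 1),
          if_neg (by split_ifs <;> omega : ¬ (if n - 2 = 1 then 0 else n - 2) = n - 1)]
        split_ifs <;> first | omega | linarith

/-- The lonely positions hold a single half of a class whose split is EFX for their right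
neighbours, and position `n - 1` holds a single part of a class whose split is EFX for its left
neighbour; nobody else is envied. Position `0` holds its better halves of both its classes, except
possibly for `n = 3`, where the last condition of `RotateLast` is used. -/
theorem IsRotateLast.content (h : S.IsRotateLast T) (hS : S.RotateLast) {p : ℕ} (hp : p < n)
    (j : ℕ) (hj : j ≠ p) : T.Content n p j := by
  have hn := S.three
  obtain ⟨hl0, hl1, hd, hc⟩ := hS
  obtain ⟨-, -, -, d4, -⟩ := S.d_of_lon (by omega) hl1
  have lonk : ∀ k, 1 ≤ k → k + 1 < n → S.lon k := fun k hk hk' => d4 k hk (by omega)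
  have envk : ∀ k, 1 ≤ k → k + 1 < n → S.env k := fun k hk hk' =>
    (S.lon_env (by omega) (lonk k hk hk')).1
  have prk : ∀ k, k + 1 < n → S.pr k := by
    intro k hk
    obtain rfl | hk0 := Nat.eq_zero_or_pos k
    · exact S.pr_zero
    · exact (S.env_pr (by omega) (envk k hk0 hk)).2
  have env0 : ¬ S.env 0 := by
    intro he
    have hs : S.sh 0 := by by_contra hs; exact hl0 ((S.lon_iff 0 (by omega)).2 ⟨he, hs⟩)
    have := S.lon_env (by omega) hl1
    exact this.2 (S.sh_succ (by omega) hs this.1)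
  have prl := S.pr_last
  have hbl := S.left_best _ (by omega) prl
  have hlQ := S.lQ_nonneg (n - 1) (by omega)
  have hb0 := S.left_best 0 (by omega) S.pr_zero
  obtain ⟨g1, g2, g3, g4⟩ := h.last
  have hPQ : S.rQ (n - 1) ≤ S.rP (n - 1) := by linarith
  have hQl := S.rQ_nonneg (n - 1) (by omega)
  have hQ0 := S.lQ_nonneg 0 (by omega)
  have hP0 := S.lP_nonneg 0 (by omega)
  obtain ⟨r1, r2, r3, r4, r5, r6⟩ := h.recut
  unfold Split.Content
  have oA_lt : ∀ k < n, T.oA k < n - 1 := by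
    intro k hk
    by_cases hk' : k + 1 < n
    · rw [h.oA k hk']; omega
    · rw [show k = n - 1 by omega, h.oA_last]; omega
  have oB_ge : ∀ k < n, n - 2 ≤ T.oB k := by
    intro k hk
    by_cases hk' : k = n - 2
    · rw [hk', h.oB_last]; omega
    · rw [h.oB k hk hk']
  -- a position that holds a single half `P`
  have single : ∀ k, 1 ≤ k → k + 2 < n → (T.oA k = k ∧ (∀ i < n, T.oB i ≠ k) ∧
      (∀ i < n, i ≠ k → T.oA i ≠ k) ∧ T.efxR k) := by
    intro k hk hk'
    refine ⟨h.oA k (by omega), fun i hi hc => ?_, fun i hi hik hc => ?_, h.efxR k hk hk'⟩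
    · have := oB_ge i hi; omega
    · by_cases hi' : i + 1 < n
      · rw [h.oA i hi'] at hc; exact hik hc
      · rw [show i = n - 1 by omega, h.oA_last] at hc; omega
  have single' : T.oB (n - 2) = n - 1 ∧ (∀ k < n, T.oA k ≠ n - 1) ∧
      (∀ k < n, k ≠ n - 2 → T.oB k ≠ n - 1) := by
    refine ⟨h.oB_last, fun k hk hc => ?_, fun k hk hk' hc => ?_⟩
    · have := oA_lt k hk; omega
    · rw [h.oB k hk hk'] at hc; omega
  obtain rfl | hp0 := Nat.eq_zero_or_pos p
  · have hprev : prevPos n 0 = n - 1 := by simp [prevPos]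
    left
    simp only [Split.val, hprev, h.oA 0 (by omega), h.oA_last, h.oB 0 hp (by omega),
      h.oB (n - 1) (by omega) (by omega), g3, g4]
    simp only [if_true]
    rcases h.first with ⟨e1, e2, -, -⟩ | ⟨-, e1, e2, -, -⟩ <;> rw [e1, e2] <;>
      split_ifs <;> first | omega | linarith
  · obtain ⟨k, rfl⟩ : ∃ k, p = k + 1 := ⟨p - 1, by omega⟩
    have hprev : prevPos n (k + 1) = k := by simp [prevPos]
    have hk : k < n := by omega
    have hge := S.prim_ge hp
    have hQL := S.rQ_le_Lsh hp
    by_cases hk3 : k + 3 < n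
    · -- a lonely position
      obtain ⟨f1, f2, -, -⟩ := h.keep (k + 1) (by omega) hk3
      have hl := lonk (k + 1) (by omega) (by omega)
      have hv := S.lon_value hp hl
      have hpe := S.prim_of_env hp (envk (k + 1) (by omega) (by omega)) (by omega)
      have e4 : T.rA k = S.rP k ∧ T.rB k = S.rQ k := by
        obtain rfl | hk0 := Nat.eq_zero_or_pos k
        · rcases h.first with ⟨-, -, e3, e4⟩ | ⟨hn3, -⟩
          · exact ⟨e3, e4⟩
          · omega
        · exact (h.keep k hk0 (by omega)).2.2
      have hLs := S.Lsh_succ k hp (prk k (by omega))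
      have oBk := h.oB k hk (by omega)
      have oBk1 := h.oB (k + 1) hp (by omega)
      have oAk := h.oA k (by omega)
      have oAk1 := h.oA (k + 1) (by omega)
      have hlP := S.lP_nonneg _ hp
      have hown : T.val n (k + 1) (k + 1) = S.lP (k + 1) := by
        simp only [Split.val, hprev, oBk, oBk1, oAk, oAk1, f1]
        rw [if_true, if_neg (by omega), if_neg (by omega), if_neg (by omega)]
        ring
      rw [hown]
      by_cases hjk : j = k ∧ 1 ≤ k
      · obtain ⟨rfl, hk1⟩ := hjk
        right; left
        obtain ⟨s1, s2, s3, s4⟩ := single j hk1 (by omega)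
        rw [hprev]
        exact ⟨s1, s2, s3, s4, by rw [e4.2]; linarith⟩
      · left
        simp only [Split.val, hprev, oBk, oBk1, oAk, oAk1, f1, f2, e4]
        rw [if_neg (by omega : ¬ k + 1 = j)]
        by_cases hj0 : k = j
        · obtain rfl : k = 0 := by omega
          have hw : S.rP 0 ≤ S.prim (0 + 1) := by
            by_contra hcc
            exact env0 ((S.env_iff 0 hp).2 ⟨S.pr_zero, Or.inr ⟨not_le.1 hcc,
              envk _ le_rfl (by omega)⟩⟩)
          simp only [zero_add] at *
          split_ifs <;> first | omega | linarith
        · rw [if_neg hj0]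
          split_ifs <;> linarith
    · by_cases hk2 : k + 2 < n
      · -- position `n - 2`
        obtain rfl : k = n - 3 := by omega
        have hkk : n - 3 + 1 = n - 2 := by omega
        simp only [hkk] at *
        have oBk := h.oB (n - 3) hk (by omega)
        have oAk := h.oA (n - 3) (by omega)
        have oAk1 := h.oA (n - 2) (by omega)
        have hlast := h.oB_last
        have hown : T.val n (n - 2) (n - 2) = T.lA (n - 2) + T.rB (n - 3) := by
          simp only [Split.val, hprev, oBk, hlast, oAk, oAk1]
          simp only [if_true]
          rw [if_neg (by omega), if_neg (by omega)]
          ring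
        have hrB : 0 ≤ T.rB (n - 3) ∧ 0 ≤ T.rA (n - 3) := by
          have := S.rQ_nonneg (n - 3) hk
          have := S.rP_nonneg (n - 3) hk
          by_cases h3 : n = 3
          · rw [show n - 3 = 0 by omega] at *
            rcases h.first with ⟨-, -, e3, e4⟩ | ⟨-, -, -, e3, e4⟩ <;> rw [e3, e4] <;>
              constructor <;> assumption
          · obtain ⟨-, -, e3, e4⟩ := h.keep (n - 3) (by omega) (by omega)
            rw [e3, e4]; constructor <;> assumption
        rw [hown]
        by_cases hjl : j = n - 1
        · right; right
          subst hjl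
          exact ⟨single'.1, single'.2.1, single'.2.2, r1, by linarith⟩
        · by_cases hjk : j = n - 3 ∧ n ≠ 3
          · right; left
            obtain ⟨rfl, h3⟩ := hjk
            obtain ⟨s1, s2, s3, s4⟩ := single (n - 3) (by omega) (by omega)
            rw [hprev]
            exact ⟨s1, s2, s3, s4, by linarith⟩
          · left
            simp only [Split.val, hprev, oBk, hlast, oAk, oAk1]
            rw [if_neg (by omega : ¬ n - 2 = j), if_neg (by omega : ¬ n - 1 = j)]
            by_cases hj3 : n - 3 = j
            · have := h.first_best (by omega)
              rw [if_pos hj3, show n - 3 = 0 by omega]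
              split_ifs <;> first | omega | linarith
            · rw [if_neg hj3]; split_ifs <;> first | omega | linarith
      · -- position `n - 1`
        obtain rfl : k = n - 2 := by omega
        have hkk : n - 2 + 1 = n - 1 := by omega
        simp only [hkk] at *
        have hkk : n - 2 + 1 = n - 1 := by omega
        have oAk := h.oA (n - 2) (by omega)
        have hlast := h.oB_last
        have hf := full_of_env (S := S) (k := n - 2) (by omega) (envk _ (by omega) (by omega))
          (by rw [hkk]; exact S.env_last)
        rw [hkk, S.Rsh_eq _ hp prl] at hf
        left
        simp only [Split.val, hprev, h.oA_last, h.oB (n - 1) hp (by omega), hlast, oAk, g1, g2]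
        have := S.rQ_nonneg (n - 2) (by omega)
        simp only [if_true]
        split_ifs <;> first | omega | linarith

end Scan

/-! ### The allocation from the previous classes -/

/-- If no position values its best half of the next edge class as much as its best half of the
previous one, then every position takes its best half of the previous edge class. -/
theorem Split.content_of_prev {T : Split} {n : ℕ} (hn : 3 ≤ n) (hA : ∀ k < n, T.oA k = k)
    (hB : ∀ k < n, T.oB k = nextPos n k) (h0 : ∀ k < n, 0 ≤ T.lA k)
    (hr : ∀ k < n, T.rA k ≤ T.rB k) (hr0 : ∀ k < n, 0 ≤ T.rB k)
    (hl : ∀ p < n, T.lB p ≤ T.rB (prevPos n p)) {p : ℕ} (hp : p < n) (j : ℕ) (hj : j ≠ p) :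
    T.Content n p j := by
  left
  have hq : prevPos n p < n := by unfold prevPos; split_ifs <;> omega
  have hnq : nextPos n (prevPos n p) = p := by
    unfold nextPos prevPos; split_ifs <;> omega
  have hpq : nextPos n p ≠ prevPos n p := by
    unfold nextPos prevPos; split_ifs <;> omega
  have hp' : nextPos n p ≠ p := by
    unfold nextPos; split_ifs <;> omega
  have hq' : prevPos n p ≠ p := by
    unfold prevPos; split_ifs <;> omega
  simp only [Split.val, hA p hp, hA _ hq, hB p hp, hB _ hq, hnq]
  rw [if_neg (Ne.symm hj), if_neg (Ne.symm hj), if_true, if_true, if_neg hp', if_neg hq']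
  have := hl p hp
  have := hr _ hq
  have := h0 p hp
  have := hr0 _ hq
  by_cases h1 : nextPos n p = j
  · rw [if_pos h1, if_neg (fun hc => hpq (h1.trans hc.symm))]; linarith
  · rw [if_neg h1]; split_ifs <;> linarith

/-! ### From parts to items -/

/-- By additivity the criterion `Split.Content` for parts implies EFX for items.  Item `g` belongs
to edge class `kk g`, has values `a g` and `b g` to the endpoints, and lies in part `A` if
`inA g`. -/
theorem isEFX_of_content {n m : ℕ} (hn : 2 ≤ n) (I : Instance n m) (hadd : I.IsAdditive)
    (w : ℕ → Fin n) (hsurj : ∀ i, ∃ p < n, w p = i)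
    (kk : Fin m → ℕ) (hkk : ∀ g, kk g < n) (a b : Fin m → ℝ)
    (hval : ∀ p < n, ∀ g, I.val (w p) {g} =
      (if kk g = p then a g else 0) + (if kk g = prevPos n p then b g else 0))
    (inA : Fin m → Prop) [DecidablePred inA] (T : Split)
    (hlA : ∀ k < n, T.lA k = ∑ g, if kk g = k ∧ inA g then a g else 0)
    (hlB : ∀ k < n, T.lB k = ∑ g, if kk g = k ∧ ¬ inA g then a g else 0)
    (hrA : ∀ k < n, T.rA k = ∑ g, if kk g = k ∧ inA g then b g else 0)
    (hrB : ∀ k < n, T.rB k = ∑ g, if kk g = k ∧ ¬ inA g then b g else 0)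
    (hoA : ∀ k < n, T.oA k < n) (hoB : ∀ k < n, T.oB k < n)
    (hefxL : ∀ k < n, T.efxL k → ∀ g, kk g = k → ¬ inA g → T.lB k - a g ≤ T.lA k)
    (hefxR : ∀ k < n, T.efxR k → ∀ g, kk g = k → inA g → T.rA k - b g ≤ T.rB k)
    (hc : ∀ p < n, ∀ j < n, j ≠ p → T.Content n p j)
    (X : Fin n → Finset (Fin m))
    (hX : ∀ p < n, ∀ g, g ∈ X (w p) ↔ (if inA g then T.oA (kk g) else T.oB (kk g)) = p) :
    IsCompleteAllocation X ∧ I.IsEFX X := by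
  have hq : ∀ p < n, prevPos n p < n := fun p hp => by unfold prevPos; split_ifs <;> omega
  have hqp : ∀ p < n, prevPos n p ≠ p := fun p hp => by unfold prevPos; split_ifs <;> omega
  refine ⟨⟨fun i j hij => ?_, fun g => ?_⟩, fun i j hij => ?_⟩
  · obtain ⟨p, hp, rfl⟩ := hsurj i
    obtain ⟨p', hp', rfl⟩ := hsurj j
    rw [Finset.disjoint_left]
    intro g hg hg'
    rw [hX p hp] at hg
    rw [hX p' hp', hg] at hg'
    exact hij (by rw [hg'])
  · have h : (if inA g then T.oA (kk g) else T.oB (kk g)) < n := by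
      split_ifs
      · exact hoA _ (hkk g)
      · exact hoB _ (hkk g)
    exact ⟨_, (hX _ h g).2 rfl⟩
  · obtain ⟨p, hp, rfl⟩ := hsurj i
    obtain ⟨j, hj, rfl⟩ := hsurj j
    obtain ⟨g, hg, hlt⟩ := hij
    have hv : ∀ j < n, I.val (w p) (X (w j)) = T.val n p j := by
      intro j hj
      have e1 : ∀ (c : Prop) [Decidable c] (f : Fin m → ℝ),
          (if c then ∑ g, f g else 0) = ∑ g, if c then f g else 0 := by
        intro c _ f; split_ifs <;> simp
      rw [hadd, Split.val, hlA p hp, hlB p hp, hrA _ (hq p hp), hrB _ (hq p hp), e1, e1, e1, e1,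
        ← Finset.sum_add_distrib, ← Finset.sum_add_distrib, ← Finset.sum_add_distrib,
        ← Finset.sum_filter_add_sum_filter_not Finset.univ (fun g => g ∈ X (w j))
          (fun g => _ + _ + _ + _)]
      have hfil : Finset.univ.filter (fun g => g ∈ X (w j)) = X (w j) := by ext; simp
      rw [hfil]
      have hz : ∀ g, g ∉ X (w j) →
          (if T.oA p = j then if kk g = p ∧ inA g then a g else 0 else 0) +
          (if T.oB p = j then if kk g = p ∧ ¬ inA g then a g else 0 else 0) +
          (if T.oA (prevPos n p) = j then if kk g = prevPos n p ∧ inA g then b g else 0 else 0) +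
          (if T.oB (prevPos n p) = j then if kk g = prevPos n p ∧ ¬ inA g then b g else 0 else 0)
            = 0 := by
        intro g hg
        rw [hX j hj] at hg
        by_cases hA : inA g
        · simp only [hA, if_true] at hg
          have h1 : ∀ k, ¬ (T.oA k = j ∧ kk g = k) := fun k ⟨h, h'⟩ => hg (by rw [h', h])
          simp only [hA, and_true, not_true, and_false, if_false, ite_self, add_zero]
          rw [← ite_and, ← ite_and, if_neg (h1 _), if_neg (h1 _), add_zero]
        · simp only [hA, if_false] at hg
          have h1 : ∀ k, ¬ (T.oB k = j ∧ kk g = k) := fun k ⟨h, h'⟩ => hg (by rw [h', h])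
          simp only [hA, and_true, not_false_iff, and_false, if_false, ite_self, add_zero, zero_add]
          rw [← ite_and, ← ite_and, if_neg (h1 _), if_neg (h1 _), add_zero]
      rw [Finset.sum_eq_zero (s := Finset.univ.filter (fun g => ¬ g ∈ X (w j)))
        (fun g hg => hz g (Finset.mem_filter.1 hg).2), add_zero]
      refine Finset.sum_congr rfl fun g hg => ?_
      rw [hX j hj] at hg
      rw [hval p hp]
      by_cases hA : inA g
      · simp only [hA, if_true] at hg
        simp only [hA, and_true, not_true, and_false, if_false, ite_self, add_zero]
        congr 1
        · by_cases hk : kk g = p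
          · rw [if_pos hk, if_pos (by rw [← hk, hg])]
          · simp [hk]
        · by_cases hk : kk g = prevPos n p
          · rw [if_pos hk, if_pos (by rw [← hk, hg])]
          · simp [hk]
      · simp only [hA, if_false] at hg
        simp only [hA, and_true, not_false_iff, and_false, if_false, ite_self, add_zero, zero_add]
        congr 1
        · by_cases hk : kk g = p
          · rw [if_pos hk, if_pos (by rw [← hk, hg])]
          · simp [hk]
        · by_cases hk : kk g = prevPos n p
          · rw [if_pos hk, if_pos (by rw [← hk, hg])]
          · simp [hk]
    have hsd : I.val (w p) (X (w j) \ {g}) = I.val (w p) (X (w j)) - I.val (w p) {g} := by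
      rw [hadd, hadd _ (X (w j)), ← Finset.sum_sdiff (Finset.singleton_subset_iff.2 hg)]
      simp
    have hg0 := I.val_nonneg (w p) {g}
    rw [hsd, hv p hp, hv j hj] at hlt
    by_cases hjp : j = p
    · subst hjp; linarith
    rw [hX j hj] at hg
    have hpj : ∀ k, k = p → k ≠ prevPos n p := fun k hk hk' => hqp p hp (hk'.symm.trans hk)
    rcases hc p hp j hj hjp with h | ⟨h1, h2, h3, h4, h5⟩ | ⟨h1, h2, h3, h4, h5⟩
    · linarith
    · have hA : inA g := by
        by_contra hA
        rw [if_neg hA] at hg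
        exact h2 _ (hkk g) hg
      rw [if_pos hA] at hg
      have hk : kk g = prevPos n p := by
        by_contra hk
        exact h3 _ (hkk g) hk hg
      have hvj : T.val n p j = T.rA (prevPos n p) := by
        rw [Split.val, if_neg (h3 p hp (hqp p hp).symm), if_neg (h2 p hp), if_pos h1,
          if_neg (h2 _ (hq p hp))]
        ring
      have := hefxR _ (hq p hp) h4 g hk hA
      rw [hvj, hval p hp, if_neg (by rw [hk]; exact hqp p hp), if_pos hk] at hlt
      linarith
    · have hA : ¬ inA g := by
        intro hA
        rw [if_pos hA] at hg
        exact h2 _ (hkk g) hg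
      rw [if_neg hA] at hg
      have hk : kk g = p := by
        by_contra hk
        exact h3 _ (hkk g) hk hg
      have hvj : T.val n p j = T.lB p := by
        rw [Split.val, if_neg (h2 p hp), if_pos h1, if_neg (h2 _ (hq p hp)),
          if_neg (h3 _ (hq p hp) (hqp p hp))]
        ring
      have := hefxL _ hp h4 g hk hA
      rw [hvj, hval p hp, if_pos hk, if_neg (by rw [hk]; exact (hqp p hp).symm)] at hlt
      linarith

/-! ### Walks round a cycle -/

open Fin.CommRing in
/-- A walk of length at least `n` in a cycle of length `n` that never turns back goes round and
round, and it traverses every edge. -/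
theorem cycle_walk {n : ℕ} (hn : 3 ≤ n) {H : SimpleGraph (Fin n)}
    (φ : H ≃g SimpleGraph.cycleGraph n) (w : ℕ → Fin n) (K : ℕ) (hK : n ≤ K)
    (hadj : ∀ k < K, H.Adj (w k) (w (k + 1)))
    (hback : ∀ k, k + 1 < K → w (k + 2) ≠ w k) :
    (∀ i ≤ K, ∀ j ≤ K, w i = w j ↔ i ≡ j [MOD n]) ∧
    ∀ u v, H.Adj u v → ∃ k < n, (u = w k ∧ v = w (k + 1)) ∨ (v = w k ∧ u = w (k + 1)) := by
  obtain ⟨N, rfl⟩ : ∃ N, n = N + 2 := ⟨n - 2, by omega⟩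
  have hstep : ∀ u v, H.Adj u v → φ v - φ u = 1 ∨ φ v - φ u = -1 := by
    intro u v h
    rcases SimpleGraph.cycleGraph_adj.1 (φ.map_adj_iff.2 h) with h | h
    · right; rw [← h]; ring
    · left; exact h
  obtain ⟨e, he, he1⟩ : ∃ e : Fin (N + 2), (e = 1 ∨ e = -1) ∧ φ (w 1) - φ (w 0) = e :=
    ⟨_, hstep _ _ (hadj 0 (by omega)), rfl⟩
  have hee : e * e = 1 := by rcases he with rfl | rfl <;> ring
  have hdiff : ∀ k < K, φ (w (k + 1)) - φ (w k) = e := by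
    intro k
    induction k with
    | zero => intro _; exact he1
    | succ k ih =>
      intro hk
      have h1 := ih (by omega)
      have h2 := hstep _ _ (hadj (k + 1) hk)
      have h3 : φ (w (k + 1 + 1)) - φ (w (k + 1)) ≠ -e := by
        intro h3
        apply hback k hk
        apply φ.injective
        have : φ (w (k + 2)) - φ (w k) =
          (φ (w (k + 1 + 1)) - φ (w (k + 1))) + (φ (w (k + 1)) - φ (w k)) := by ring
        rw [h1, h3, neg_add_cancel] at this
        exact sub_eq_zero.1 this
      rcases he with rfl | rfl
      · exact h2.resolve_right h3
      · rw [neg_neg] at h3; exact h2.resolve_left h3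
  have hpos : ∀ k ≤ K, φ (w k) = φ (w 0) + (k : Fin (N + 2)) * e := by
    intro k
    induction k with
    | zero => intro _; simp
    | succ k ih =>
      intro hk
      have h1 := ih (by omega)
      have h2 := hdiff k (by omega)
      rw [sub_eq_iff_eq_add] at h2
      rw [h2, h1]; push_cast; ring
  have hcast : ∀ i j : ℕ, (i : Fin (N + 2)) = (j : Fin (N + 2)) ↔ i ≡ j [MOD (N + 2)] := by
    intro i j
    rw [Fin.ext_iff]; simp [Nat.ModEq]
  have hmain : ∀ i ≤ K, ∀ j ≤ K, w i = w j ↔ i ≡ j [MOD (N + 2)] := by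
    intro i hi j hj
    rw [← hcast, ← φ.injective.eq_iff, hpos i hi, hpos j hj, add_right_inj]
    constructor
    · intro h
      have := congrArg (· * e) h
      simpa [mul_assoc, hee] using this
    · intro h; rw [h]
  refine ⟨hmain, fun u v huv => ?_⟩
  -- every vertex lies on the walk
  have hex : ∀ u, ∃ k < N + 2, u = w k := by
    intro u
    let x : Fin (N + 2) := (φ u - φ (w 0)) * e
    refine ⟨x.val, x.isLt, φ.injective ?_⟩
    rw [hpos _ (by have := x.isLt; omega), Fin.cast_val_eq_self, mul_assoc, hee]
    ring
  obtain ⟨k, hk, rfl⟩ := hex u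
  obtain ⟨j, hj, rfl⟩ := hex v
  have h1 : φ (w j) - φ (w k) = e ∨ φ (w k) - φ (w j) = e := by
    rcases hstep _ _ huv with h | h <;> rcases he with rfl | rfl
    · exact Or.inl h
    · right; rw [← h]; ring
    · right; rw [← neg_sub, h]; ring
    · exact Or.inl h
  rcases h1 with h1 | h1
  · refine ⟨k, hk, Or.inl ⟨rfl, φ.injective ?_⟩⟩
    have := hdiff k (by omega)
    rw [sub_eq_iff_eq_add] at this h1
    rw [h1, this]
  · refine ⟨j, hj, Or.inr ⟨rfl, φ.injective ?_⟩⟩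
    have := hdiff j (by omega)
    rw [sub_eq_iff_eq_add] at this h1
    rw [h1, this]

open Fin.CommRing in
/-- In a cycle every vertex has a neighbour different from a given vertex. -/
theorem exists_adj_ne {n : ℕ} (hn : 3 ≤ n) {H : SimpleGraph (Fin n)}
    (φ : H ≃g SimpleGraph.cycleGraph n) (u z : Fin n) : ∃ v, H.Adj u v ∧ v ≠ z := by
  obtain ⟨N, rfl⟩ : ∃ N, n = N + 3 := ⟨n - 3, by omega⟩
  have h1 : H.Adj u (φ.symm (φ u + 1)) := by
    rw [← φ.map_adj_iff, SimpleGraph.cycleGraph_adj]; right; simp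
  have h2 : H.Adj u (φ.symm (φ u - 1)) := by
    rw [← φ.map_adj_iff, SimpleGraph.cycleGraph_adj]; left; simp
  by_cases hz : φ.symm (φ u + 1) = z
  · refine ⟨_, h2, fun h => ?_⟩
    have := φ.symm.injective (h.trans hz.symm)
    have h3 : (1 : Fin (N + 3)) + 1 = 0 := by
      have h4 : (1 : Fin (N + 3)) + 1 = (φ u + 1) - (φ u - 1) := by ring
      rw [h4, this, sub_self]
    have := congrArg Fin.val h3
    simp [Fin.val_add] at this
    rw [Nat.mod_eq_of_lt (by omega)] at this
    omega
  · exact ⟨_, h1, hz⟩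

/-! ### The program -/

namespace Test

/-- Equality of natural numbers. -/
def natEq (x y : NatExpr) : Test := .and (.natLE x y) (.natLE y x)

/-- Strict comparison of real numbers. -/
def realLT (x y : RealExpr) : Test := .not (.realLE y x)

/-- Disjunction. -/
def or (b c : Test) : Test := .not (.and (.not b) (.not c))

theorem holds_natLE (s : Memory) (x y : NatExpr) :
    (Test.natLE x y).Holds s ↔ x.eval s ≤ y.eval s := Iff.rfl

theorem holds_realLE (s : Memory) (x y : RealExpr) :
    (Test.realLE x y).Holds s ↔ x.eval s ≤ y.eval s := Iff.rfl

theorem holds_not (s : Memory) (b : Test) : (Test.not b).Holds s ↔ ¬ b.Holds s := Iff.rfl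

theorem holds_and (s : Memory) (b c : Test) :
    (Test.and b c).Holds s ↔ b.Holds s ∧ c.Holds s := Iff.rfl

theorem holds_natEq (s : Memory) (x y : NatExpr) :
    (natEq x y).Holds s ↔ x.eval s = y.eval s := le_antisymm_iff.symm

theorem holds_realLT (s : Memory) (x y : RealExpr) :
    (realLT x y).Holds s ↔ x.eval s < y.eval s := not_le

theorem holds_or (s : Memory) (b c : Test) :
    (or b c).Holds s ↔ b.Holds s ∨ c.Holds s := by
  simp only [or, Holds, not_and_or, not_not]

end Test

namespace Cmd

/-- Programs run one after the other. -/
def block : List Cmd → Cmd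
  | [] => skip
  | c :: cs => seq c (block cs)

theorem run_block_nil (s : Memory) : (block []).run s = s := rfl

theorem run_block_cons (c : Cmd) (cs : List Cmd) (s : Memory) :
    (block (c :: cs)).run s = (block cs).run (c.run s) := rfl

end Cmd

namespace CycleEFX

open NatExpr Cmd

/-- The number of agents. -/
abbrev nn : NatExpr := .read 0 (.lit 0)

/-- The number of items. -/
abbrev mm : NatExpr := .read 0 (.lit 1)

/-- The counter of an outer loop. -/
abbrev kk : NatExpr := .var 10

/-- The counter of an inner loop. -/
abbrev gg : NatExpr := .var 11

/-- The expression `2 * e + side`, the index of one of the two parts of edge class `e`. -/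
abbrev half (e side : NatExpr) : NatExpr := .add (.add e e) side

/-- If the current item leads from vertex number `K` of the walk in array `4` to a vertex other than
vertex number `K - 1`, extend the walk by that vertex.  For `K = 0` the truncated `K - 1` is `K`
itself, so that the second condition holds for every item, since there are no loops. -/
def stepBody (K : NatExpr) : Cmd :=
  ite (.and (.natEq (.read 1 gg) (.read 4 K))
      (.not (.natEq (.read 2 gg) (.read 4 (.sub K (.lit 1))))))
    (setNat 4 (.add K (.lit 1)) (.read 2 gg))
    (ite (.and (.natEq (.read 2 gg) (.read 4 K))
        (.not (.natEq (.read 1 gg) (.read 4 (.sub K (.lit 1))))))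
      (setNat 4 (.add K (.lit 1)) (.read 1 gg)) skip)

/-- Extend the walk by a neighbour of its vertex number `K` that is different from its vertex
number `K - 1`. -/
def step (K : NatExpr) : Cmd := count 11 1 (stepBody K)

/-- Walk twice round the cycle, starting at vertex `0`; the walk is stored in array `4`. -/
def trace : Cmd := block [count 10 0 (step kk), count 10 0 (step (.add nn kk))]

/-- Classify the current item if it joins the vertices number `k` and `k + 1` of the walk, where `k`
is the inner counter. -/
def classifyBody : Cmd :=
  ite (.and (.natEq (.read 1 kk) (.read 4 gg)) (.natEq (.read 2 kk) (.read 4 (.add gg (.lit 1)))))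
    (block [setNat 5 kk gg, setReal 2 kk (.read 0 kk), setReal 3 kk (.read 1 kk)])
    (ite (.and (.natEq (.read 2 kk) (.read 4 gg))
        (.natEq (.read 1 kk) (.read 4 (.add gg (.lit 1)))))
      (block [setNat 5 kk gg, setReal 2 kk (.read 1 kk), setReal 3 kk (.read 0 kk)])
      skip)

/-- Store the edge class of every item in array `5`, and its values to the two endpoints, in the
order of the walk, in the real arrays `2` and `3`. -/
def classify : Cmd := count 10 1 (count 11 0 classifyBody)

/-- Mark all items as open in array `8`, and add up in real array `4` the signed weights of the
items of every edge class.  Item `g` has weight `real 8 g` and lies in part `nat 7 g`. -/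
def addDifferences : Cmd :=
  count 10 1 (block [
    setNat 8 kk (.lit 0),
    ite (.natEq (.read 7 kk) (.lit 0))
      (setReal 4 (.read 5 kk) (.add (.read 4 (.read 5 kk)) (.read 8 kk)))
      (setReal 4 (.read 5 kk) (.sub (.read 4 (.read 5 kk)) (.read 8 kk)))])

/-- Store in real array `4` the difference of the weights of the two parts of every edge class. -/
def differences : Cmd := block [count 10 0 (setReal 4 kk .zero), addDifferences]

/-- Store in cell `0` of array `9` an open item of largest weight, or the number `m` of items if no
item is open. -/
def select : Cmd := block [
  setNat 9 (.lit 0) mm,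
  count 11 1 (ite (.and (.natEq (.read 8 gg) (.lit 0))
      (.or (.natEq (.var 9) mm) (.realLE (.read 8 (.var 9)) (.read 8 gg))))
    (setNat 9 (.lit 0) gg) skip)]

/-- Close the selected item, and move it to the other part of its edge class if its part has the
larger weight even without it. -/
def flip : Cmd :=
  ite (.natEq (.var 9) mm) skip (block [
    setNat 8 (.var 9) (.lit 1),
    ite (.natEq (.read 7 (.var 9)) (.lit 0))
      (ite (.realLT (.read 8 (.var 9)) (.read 4 (.read 5 (.var 9))))
        (block [setNat 7 (.var 9) (.lit 1),
          setReal 4 (.read 5 (.var 9)) (.sub (.sub (.read 4 (.read 5 (.var 9))) (.read 8 (.var 9)))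
            (.read 8 (.var 9)))]) skip)
      (ite (.realLT (.add (.read 4 (.read 5 (.var 9))) (.read 8 (.var 9))) .zero)
        (block [setNat 7 (.var 9) (.lit 0),
          setReal 4 (.read 5 (.var 9)) (.add (.add (.read 4 (.read 5 (.var 9))) (.read 8 (.var 9)))
            (.read 8 (.var 9)))]) skip)])

/-- Make the split of every edge class EFX with respect to the weights, by going through the items
in the order of descending weights. -/
def balance : Cmd := seq differences (count 10 1 (seq select flip))

/-- Use the values to the first endpoints as weights. -/
def loadFirst : Cmd := count 10 1 (setReal 8 kk (.read 2 kk))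

/-- Keep a copy of the splits, and use the values to the second endpoints as weights. -/
def loadSecond : Cmd := count 10 1 (block [setNat 6 kk (.read 7 kk), setReal 8 kk (.read 3 kk)])

/-- Compute the splits that are EFX for the first endpoints (kept in array `6`), and from them
splits that are EFX for the second endpoints (in array `7`). -/
def cut : Cmd := block [loadFirst, balance, loadSecond, balance]

/-- Set the values of all parts to zero. -/
def clearSums : Cmd :=
  count 10 0 (block [
    setReal 5 (half kk (.lit 0)) .zero, setReal 5 (half kk (.lit 1)) .zero,
    setReal 6 (half kk (.lit 0)) .zero, setReal 6 (half kk (.lit 1)) .zero,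
    setReal 7 (half kk (.lit 0)) .zero, setReal 7 (half kk (.lit 1)) .zero])

/-- Add all items to the values of their parts. -/
def addSums : Cmd :=
  count 10 1 (block [
    setReal 5 (half (.read 5 kk) (.read 7 kk))
      (.add (.read 5 (half (.read 5 kk) (.read 7 kk))) (.read 2 kk)),
    setReal 6 (half (.read 5 kk) (.read 7 kk))
      (.add (.read 6 (half (.read 5 kk) (.read 7 kk))) (.read 3 kk)),
    setReal 7 (half (.read 5 kk) (.read 6 kk))
      (.add (.read 7 (half (.read 5 kk) (.read 6 kk))) (.read 3 kk))])

/-- The values of all parts: the final splits for the first and the second endpoints in the real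
arrays `5` and `6`, the first splits for the second endpoints in real array `7`. -/
def sums : Cmd := seq clearSums addSums

/-- Store the next position of every position in array `13`. -/
def nextPositions : Cmd :=
  count 10 0 (ite (.natEq (.add kk (.lit 1)) nn) (setNat 13 kk (.lit 0))
    (setNat 13 kk (.add kk (.lit 1))))

/-- Look for a position that values its best half of the next edge class at least as much as its
best half of the previous one, where the loop goes through the previous classes.  Cell
`0` of array `24` tells whether there is one, and cell `0` of array `12` is such a position, or
`0`. -/
def findStart : Cmd :=
  count 10 0 (ite
    (.and
      (.or (.realLE (.read 6 (half kk (.lit 0))) (.read 5 (half (.read 13 kk) (.lit 0))))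
        (.realLE (.read 6 (half kk (.lit 0))) (.read 5 (half (.read 13 kk) (.lit 1)))))
      (.or (.realLE (.read 6 (half kk (.lit 1))) (.read 5 (half (.read 13 kk) (.lit 0))))
        (.realLE (.read 6 (half kk (.lit 1))) (.read 5 (half (.read 13 kk) (.lit 1))))))
    (block [setNat 12 (.lit 0) (.read 13 kk), setNat 24 (.lit 0) (.lit 1)]) skip)

/-- Renumber the edge classes so that the start has position `0`. -/
def reindex : Cmd :=
  count 10 1 (ite (.natLE (.var 12) (.read 5 kk))
    (setNat 5 kk (.sub (.read 5 kk) (.var 12)))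
    (setNat 5 kk (.sub (.add (.read 5 kk) nn) (.var 12))))

/-- The half of edge class `k` for position `k` in the scan; array `15` holds its side. -/
abbrev sideP (k : NatExpr) : NatExpr := half k (.read 15 k)

/-- The other half of edge class `k`. -/
abbrev sideQ (k : NatExpr) : NatExpr := half k (.sub (.lit 1) (.read 15 k))

/-- Choose a side of the current edge class, better or equal in real array `A`. -/
def chooseSide (A : ℕ) : Cmd :=
  ite (.realLE (.read A (half kk (.lit 1))) (.read A (half kk (.lit 0))))
    (setNat 15 kk (.lit 0)) (setNat 15 kk (.lit 1))

/-- Does the current position choose from its next edge class?  It does if the best half is at least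
as good as its share of the previous class; the first and the last position do so in any case. -/
def primaryTest : Test :=
  .or (.or (.natEq kk (.lit 0)) (.natEq (.add kk (.lit 1)) nn))
    (.or (.realLE (.read 12 kk) (.read 5 (half kk (.lit 0))))
      (.realLE (.read 12 kk) (.read 5 (half kk (.lit 1)))))

/-- The scan of the primary halves: array `14` tells whether the choice at edge class `k` is that
of position `k`, array `15` holds the chosen side, the real arrays `12` and `13` hold the values of
the shares of the previous and of the next edge class. -/
def scanPrimaryLoop : Cmd :=
  count 10 0 (ite primaryTest
    (block [setNat 14 kk (.lit 1), chooseSide 5,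
      setReal 12 (.add kk (.lit 1)) (.read 6 (sideQ kk)), setReal 13 kk (.read 5 (sideP kk))])
    (block [setNat 14 kk (.lit 0), chooseSide 6,
      setReal 12 (.add kk (.lit 1)) (.read 6 (sideP kk)), setReal 13 kk (.read 5 (sideQ kk))]))

/-- The scan of the primary halves; the share of the last edge class is that of position `0`. -/
def scanPrimary : Cmd := seq scanPrimaryLoop (setReal 12 (.lit 0) (.read 12 nn))

/-- The position that a downward loop visits. -/
abbrev down : NatExpr := .sub (.sub nn (.lit 1)) kk

/-- The position above the position that a downward loop visits. -/
abbrev above : NatExpr := .add down (.lit 1)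

/-- The scan of the envied positions, downwards (array `16`). -/
def scanEnvy : Cmd :=
  count 10 0 (ite
    (.and (.natLE (.lit 1) kk) (.and (.natEq (.read 14 down) (.lit 1))
      (.or (.realLT (.add (.read 6 (sideQ down)) (.read 13 above)) (.read 6 (sideP down)))
        (.and (.and (.realLT (.read 12 above) (.read 6 (sideP down)))
            (.and (.realLT (.read 5 (sideP above)) (.read 6 (sideP down)))
              (.realLT (.read 5 (sideQ above)) (.read 6 (sideP down)))))
          (.natEq (.read 16 above) (.lit 1))))))
    (setNat 16 down (.lit 1)) (setNat 16 down (.lit 0)))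

/-- The scan of the shifted positions (array `17`) and the lonely positions (array `18`). -/
def scanShift : Cmd :=
  count 10 0 (ite (.natEq (.read 16 kk) (.lit 1))
    (ite (.or (.realLE (.read 5 (sideP kk)) (.add (.read 5 (sideQ kk)) (.read 12 kk)))
        (.and (.natLE (.lit 1) kk) (.natEq (.read 17 (.sub kk (.lit 1))) (.lit 1))))
      (block [setNat 17 kk (.lit 1), setNat 18 kk (.lit 0)])
      (block [setNat 17 kk (.lit 0), setNat 18 kk (.lit 1)]))
    (block [setNat 17 kk (.lit 0), setNat 18 kk (.lit 0)]))

/-- The scan of the ends of the chains of lonely positions, downwards (array `19`). -/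
def scanEnd : Cmd :=
  count 10 0 (ite (.natEq (.read 18 above) (.lit 1))
    (setNat 19 down (.read 19 above)) (setNat 19 down above))

/-- The four scans. -/
def scans : Cmd := block [scanPrimary, scanEnvy, scanShift, scanEnd]

/-- Record for the current edge class: which split is used (array `23`), which side is part `A`
(array `20`), and the positions that receive the parts `A` and `B` (arrays `21` and `22`). -/
def assign (c sA oA oB : NatExpr) : Cmd :=
  block [setNat 23 kk c, setNat 20 kk sA, setNat 21 kk oA, setNat 22 kk oB]

/-- As `assign`, with the side of smaller value in real array `A` as part `A`. -/
def assignWorse (A : ℕ) (c oA oB : NatExpr) : Cmd :=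
  ite (.realLE (.read A (half kk (.lit 0))) (.read A (half kk (.lit 1))))
    (assign c (.lit 0) oA oB) (assign c (.lit 1) oA oB)

/-- The side of the current edge class that is not chosen by the scan. -/
abbrev otherSide : NatExpr := .sub (.lit 1) (.read 15 kk)

/-- Every position takes its best half of the previous edge class. -/
def assignPrev : Cmd := count 10 0 (assignWorse 6 (.lit 0) kk (.read 13 kk))

/-- The main allocation. -/
def assignMain : Cmd :=
  count 10 0 (ite (.and (.natEq (.read 14 kk) (.lit 1)) (.natEq (.read 17 kk) (.lit 0)))
    (ite (.natEq (.read 18 (.read 13 kk)) (.lit 1))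
      (assign (.lit 0) (.read 15 kk) kk (.read 19 (.read 13 kk)))
      (assign (.lit 0) (.read 15 kk) kk (.read 13 kk)))
    (ite (.natEq (.read 18 (.read 13 kk)) (.lit 1))
      (assign (.lit 0) otherSide kk (.read 19 (.read 13 kk)))
      (assign (.lit 0) otherSide kk (.read 13 kk))))

/-- The allocation in which the chosen halves of all classes but the first and the last move on. -/
def assignRotateAll : Cmd :=
  count 10 0 (ite (.natEq kk (.lit 0)) (assignWorse 7 (.lit 1) (.lit 0) (.lit 1))
    (ite (.natEq kk (.lit 1)) (assign (.lit 0) otherSide (.lit 0) (.read 13 kk))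
      (ite (.natEq (.add kk (.lit 1)) nn) (assignWorse 6 (.lit 0) kk (.read 13 kk))
        (assign (.lit 0) otherSide kk (.read 13 kk)))))

/-- The allocation in which only the chosen half of the last but one edge class moves on. -/
def assignRotateLast : Cmd :=
  count 10 0 (ite (.natEq (.add kk (.lit 1)) nn)
    (assign (.lit 0) (.read 15 kk) (.lit 0) (.sub nn (.lit 2)))
    (ite (.natEq (.add kk (.lit 2)) nn) (assignWorse 7 (.lit 1) kk (.sub nn (.lit 1)))
      (ite (.and (.natEq nn (.lit 3)) (.natEq kk (.lit 0)))
        (assignWorse 6 (.lit 0) kk (.sub nn (.lit 2)))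
        (assign (.lit 0) (.read 15 kk) kk (.sub nn (.lit 2))))))

/-- The last position. -/
abbrev lastPos : NatExpr := .sub nn (.lit 1)

/-- The last position but one. -/
abbrev lastPos2 : NatExpr := .sub nn (.lit 2)

/-- Does the situation call for `assignRotateAll`? -/
def rotateAllTest : Test :=
  .and (.natEq (.read 18 (.lit 0)) (.lit 1))
    (.or (.natEq (.read 19 (.lit 0)) lastPos)
      (.and (.natEq (.read 19 (.lit 0)) lastPos2)
        (.and (.not (.natEq (.read 16 lastPos2) (.lit 1)))
          (.and (.natEq (.read 14 lastPos2) (.lit 1))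
            (.realLT (.add (.read 6 (sideQ lastPos2)) (.read 5 (sideP lastPos)))
              (.add (.read 6 (sideP lastPos2)) (.read 5 (sideQ lastPos))))))))

/-- Does the situation call for `assignRotateLast`? -/
def rotateLastTest : Test :=
  .and (.not (.natEq (.read 18 (.lit 0)) (.lit 1)))
    (.and (.natEq (.read 18 (.lit 1)) (.lit 1))
      (.and (.natEq (.read 19 (.lit 1)) lastPos)
        (.realLT (.add (.read 5 (sideP (.lit 0))) (.read 6 (sideQ lastPos)))
          (.add (.read 5 (sideQ (.lit 0))) (.read 6 (sideP lastPos))))))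

/-- Decide which position receives which part. -/
def allocate : Cmd :=
  ite (.natEq (.var 24) (.lit 1))
    (seq scans (ite rotateAllTest assignRotateAll (ite rotateLastTest assignRotateLast assignMain)))
    assignPrev

/-- Write the owner of every item to array `3`. -/
def output : Cmd :=
  count 10 1 (ite
    (.or (.and (.natEq (.read 23 (.read 5 kk)) (.lit 0))
        (.natEq (.read 7 kk) (.read 20 (.read 5 kk))))
      (.and (.not (.natEq (.read 23 (.read 5 kk)) (.lit 0)))
        (.natEq (.read 6 kk) (.read 20 (.read 5 kk)))))
    (setNat 3 kk (.read 4 (.add (.var 12) (.read 21 (.read 5 kk)))))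
    (setNat 3 kk (.read 4 (.add (.var 12) (.read 22 (.read 5 kk))))))

/-- The part of the program between the classification of the items and the allocation: the cuts,
the choice of the start, and the values of all parts. -/
def prepare : Cmd := block [cut, nextPositions, sums, findStart, reindex, sums]

/-- The whole program. -/
def program : Cmd := block [trace, classify, prepare, allocate, output]

/-- The side conditions on the loops of the program are decidable. -/
theorem program_wf : program.wf = true := by decide

theorem zero_notMem_program : 0 ∉ program.natWrites := by decide

end CycleEFX

/-! ### Rules for the effect of a program -/

attribute [simp] NatExpr.eval RealExpr.eval Test.holds_natLE Test.holds_realLE Test.holds_not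
  Test.holds_and Test.holds_natEq Test.holds_realLT Test.holds_or

namespace Memory

@[simp] theorem writeNat_nat (s : Memory) (a i x b j : ℕ) :
    (s.writeNat a i x).nat b j = if b = a ∧ j = i then x else s.nat b j := by
  simp only [writeNat, Function.update_apply]
  split_ifs <;> simp_all

@[simp] theorem writeNat_nat_of_ne (s : Memory) {a b : ℕ} (h : b ≠ a) (i x : ℕ) :
    (s.writeNat a i x).nat b = s.nat b := by
  simp only [writeNat, Function.update_of_ne h]

@[simp] theorem writeNat_real (s : Memory) (a i x : ℕ) : (s.writeNat a i x).real = s.real := rfl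

@[simp] theorem writeReal_nat (s : Memory) (a i : ℕ) (x : ℝ) :
    (s.writeReal a i x).nat = s.nat := rfl

@[simp] theorem writeReal_real_of_ne (s : Memory) {a b : ℕ} (h : b ≠ a) (i : ℕ) (x : ℝ) :
    (s.writeReal a i x).real b = s.real b := by
  simp only [writeReal, Function.update_of_ne h]

@[simp] theorem writeReal_real (s : Memory) (a i : ℕ) (x : ℝ) (b j : ℕ) :
    (s.writeReal a i x).real b j = if b = a ∧ j = i then x else s.real b j := by
  simp only [writeReal, Function.update_apply]
  split_ifs <;> simp_all

end Memory

namespace Cmd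

attribute [simp] run_block_nil run_block_cons

@[simp] theorem run_skip (s : Memory) : skip.run s = s := rfl

@[simp] theorem run_setNat (s : Memory) (a : ℕ) (i x : NatExpr) :
    (setNat a i x).run s = s.writeNat a (i.eval s) (x.eval s) := rfl

@[simp] theorem run_setReal (s : Memory) (a : ℕ) (i : NatExpr) (x : RealExpr) :
    (setReal a i x).run s = s.writeReal a (i.eval s) (x.eval s) := rfl

open Classical in
theorem run_ite (s : Memory) (b : Test) (c d : Cmd) :
    (ite b c d).run s = if b.Holds s then c.run s else d.run s := rfl

end Cmd

namespace CycleEFX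

open NatExpr Cmd

/-! ### Tracing the cycle -/

/-- Some item joins the vertices `u` and `x`, by the tables of endpoints in the memory. -/
def Joined (s : Memory) (u x : ℕ) : Prop :=
  ∃ g < s.nat 0 1, (s.nat 1 g = u ∧ s.nat 2 g = x) ∨ (s.nat 2 g = u ∧ s.nat 1 g = x)

/-- A step extends the walk to a neighbour that is not the vertex before, if there is one, whichever
of the suitable items comes last. -/
theorem step_spec (K : NatExpr) (K₀ : ℕ) (s : Memory)
    (hK : ∀ s' : Memory, s'.nat 0 = s.nat 0 → s'.nat 10 = s.nat 10 → K.eval s' = K₀)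
    (hex : ∃ x, Joined s (s.nat 4 K₀) x ∧ x ≠ s.nat 4 (K₀ - 1)) :
    (∀ j, j ≠ K₀ + 1 → ((step K).run s).nat 4 j = s.nat 4 j) ∧
    Joined s (s.nat 4 K₀) (((step K).run s).nat 4 (K₀ + 1)) ∧
    ((step K).run s).nat 4 (K₀ + 1) ≠ s.nat 4 (K₀ - 1) := by
  have key : _ ∧ _ := run_count (s := s) (fun i s' =>
    (∀ j, j ≠ K₀ + 1 → s'.nat 4 j = s.nat 4 j) ∧
    ((∃ g < i, (s.nat 1 g = s.nat 4 K₀ ∧ s.nat 2 g ≠ s.nat 4 (K₀ - 1)) ∨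
      (s.nat 2 g = s.nat 4 K₀ ∧ s.nat 1 g ≠ s.nat 4 (K₀ - 1))) →
      Joined s (s.nat 4 K₀) (s'.nat 4 (K₀ + 1)) ∧ s'.nat 4 (K₀ + 1) ≠ s.nat 4 (K₀ - 1)))
    (v := 11) (b := 1) (c := stepBody K) ?_ ?_
  · refine ⟨key.1, key.2 ?_⟩
    obtain ⟨x, ⟨g, hg, h⟩, hx⟩ := hex
    refine ⟨g, hg, ?_⟩
    rcases h with ⟨h1, rfl⟩ | ⟨h1, rfl⟩
    · exact Or.inl ⟨h1, hx⟩
    · exact Or.inr ⟨h1, hx⟩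
  · simp
  · intro i s' hi hv hf _ ⟨h1, h2⟩
    have f0 := hf 0 (by decide) (by simp [stepBody, natWrites])
    have f1 := hf 1 (by decide) (by simp [stepBody, natWrites])
    have f2 := hf 2 (by decide) (by simp [stepBody, natWrites])
    have f10 := hf 10 (by decide) (by simp [stepBody, natWrites])
    have hK1 := h1 K₀ (by omega)
    have hK2 := h1 (K₀ - 1) (by omega)
    have hK := hK s' f0 f10
    simp only [stepBody, run_ite]
    split_ifs with hA hB
    · simp [hK, hv, f1, f2, hK1, hK2] at hA ⊢
      refine ⟨fun j hj => by simp [hj, h1], fun _ _ _ => ⟨⟨i, hi, Or.inl ⟨hA.1, rfl⟩⟩, hA.2⟩⟩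
    · simp [hK, hv, f1, f2, hK1, hK2] at hB ⊢
      refine ⟨fun j hj => by simp [hj, h1], fun _ _ _ => ⟨⟨i, hi, Or.inr ⟨hB.1, rfl⟩⟩, hB.2⟩⟩
    · simp [hK, hv, f1, f2, hK1, hK2] at hA hB ⊢
      refine ⟨h1, fun g hg h => h2 ⟨g, ?_, h⟩⟩
      rcases Nat.le_iff_lt_or_eq.1 hg with hg | rfl
      · exact hg
      · rcases h with h | h
        · exact absurd (hA h.1) h.2
        · exact absurd (hB h.1) h.2

/-- The state after the walk has made `L` steps: every vertex is joined to the next one, and the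
walk does not turn back. -/
def Traced (s : Memory) (L : ℕ) : Prop :=
  s.nat 4 0 = 0 ∧ ∀ k < L, Joined s (s.nat 4 k) (s.nat 4 (k + 1)) ∧
    s.nat 4 (k + 1) ≠ s.nat 4 (k - 1)

/-- If every vertex has a neighbour different from any given vertex, the walk can be extended. -/
theorem step_traced (K : NatExpr) (K₀ : ℕ) (s : Memory)
    (hK : ∀ s' : Memory, s'.nat 0 = s.nat 0 → s'.nat 10 = s.nat 10 → K.eval s' = K₀)
    (hn : 0 < s.nat 0 0)
    (hex : ∀ u < s.nat 0 0, ∀ z, ∃ x, Joined s u x ∧ x ≠ z)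
    (hlt : ∀ u x, Joined s u x → x < s.nat 0 0) (h : Traced s K₀) :
    Traced ((step K).run s) (K₀ + 1) := by
  have hJ : ∀ u x, Joined ((step K).run s) u x ↔ Joined s u x := by
    intro u x
    unfold Joined
    rw [run_nat_of_notMem _ (by simp [step, stepBody, natWrites]),
      run_nat_of_notMem _ (by simp [step, stepBody, natWrites]),
      run_nat_of_notMem _ (by simp [step, stepBody, natWrites])]
  have hu : s.nat 4 K₀ < s.nat 0 0 := by
    rcases Nat.eq_zero_or_pos K₀ with rfl | hpos
    · rw [h.1]; exact hn
    · have := (h.2 (K₀ - 1) (by omega)).1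
      rw [Nat.sub_add_cancel hpos] at this
      exact hlt _ _ this
  obtain ⟨h1, h2, h3⟩ := step_spec K K₀ s hK (hex _ hu _)
  refine ⟨by rw [h1 _ (by omega)]; exact h.1, fun k hk => ?_⟩
  rw [hJ, h1 k (by omega), h1 (k - 1) (by omega)]
  rcases Nat.lt_succ_iff_lt_or_eq.1 hk with hk | rfl
  · rw [h1 (k + 1) (by omega)]; exact h.2 k hk
  · exact ⟨h2, h3⟩

/-- The two loops make `2 n` steps of the walk. -/
theorem trace_spec (s : Memory) (hn : 0 < s.nat 0 0) (h0 : s.nat 4 0 = 0)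
    (hex : ∀ u < s.nat 0 0, ∀ z, ∃ x, Joined s u x ∧ x ≠ z)
    (hlt : ∀ u x, Joined s u x → x < s.nat 0 0) :
    Traced (trace.run s) (s.nat 0 0 + s.nat 0 0) := by
  have hJ : ∀ s' : Memory, s'.nat 0 = s.nat 0 → s'.nat 1 = s.nat 1 → s'.nat 2 = s.nat 2 →
      ∀ u x, Joined s' u x ↔ Joined s u x := by
    intro s' e0 e1 e2 u x
    unfold Joined
    rw [e0, e1, e2]
  have hT : ∀ s' s'' : Memory, s''.nat 0 = s'.nat 0 → s''.nat 1 = s'.nat 1 → s''.nat 2 = s'.nat 2 →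
      s''.nat 4 = s'.nat 4 → ∀ L, Traced s' L → Traced s'' L := by
    intro s' s'' e0 e1 e2 e4 L h
    unfold Traced Joined at *
    rwa [e0, e1, e2, e4]
  have hw : ∀ (s' : Memory) x, Traced s' x → ∀ y, Traced (s'.writeNat 10 0 y) x := by
    intro s' x h y
    unfold Traced Joined at *
    simpa using h
  set s₁ := (count 10 0 (step kk)).run s with hs₁
  have k1 : Traced s₁ (s.nat 0 0) := by
    refine run_count (fun k s' => Traced s' k) ?_ ?_
    · exact ⟨by simpa using h0, by simp⟩
    · intro k s' hk hv hf _ h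
      have f0 := hf 0 (by decide) (by simp [step, stepBody, natWrites])
      have f1 := hf 1 (by decide) (by simp [step, stepBody, natWrites])
      have f2 := hf 2 (by decide) (by simp [step, stepBody, natWrites])
      refine hw _ _ (step_traced kk k s' (fun s'' e0 e10 => by simp [e10, hv])
        (by rwa [f0]) ?_ ?_ h) _
      · simpa only [hJ s' f0 f1 f2, f0] using hex
      · simpa only [hJ s' f0 f1 f2, f0] using hlt
  have g0 : s₁.nat 0 = s.nat 0 := run_nat_of_notMem _ (by simp [step, stepBody, natWrites]) _
  have g1 : s₁.nat 1 = s.nat 1 := run_nat_of_notMem _ (by simp [step, stepBody, natWrites]) _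
  have g2 : s₁.nat 2 = s.nat 2 := run_nat_of_notMem _ (by simp [step, stepBody, natWrites]) _
  have k2 : Traced ((count 10 0 (step (.add nn kk))).run s₁) (s.nat 0 0 + s₁.nat 0 0) := by
    refine run_count (fun k s' => Traced s' (s.nat 0 0 + k)) ?_ ?_
    · exact hw _ _ k1 _
    · intro k s' hk hv hf _ h
      have f0 := hf 0 (by decide) (by simp [step, stepBody, natWrites])
      have f1 := hf 1 (by decide) (by simp [step, stepBody, natWrites])
      have f2 := hf 2 (by decide) (by simp [step, stepBody, natWrites])
      rw [g0] at f0; rw [g1] at f1; rw [g2] at f2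
      refine hw _ _ (step_traced _ (s.nat 0 0 + k) s' (fun s'' e0 e10 => by simp [e10, hv, e0, f0])
        (by rwa [f0]) ?_ ?_ h) _
      · simpa only [hJ s' f0 f1 f2, f0] using hex
      · simpa only [hJ s' f0 f1 f2, f0] using hlt
  rw [g0] at k2
  exact k2

/-! ### The edge classes -/

/-- Item `g` belongs to edge class `k` of the walk, and `a`, `b` are its values to the two
endpoints. -/
def Classified (s : Memory) (g k : ℕ) (a b : ℝ) : Prop :=
  (s.nat 1 g = s.nat 4 k ∧ s.nat 2 g = s.nat 4 (k + 1) ∧ a = s.real 0 g ∧ b = s.real 1 g) ∨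
  (s.nat 2 g = s.nat 4 k ∧ s.nat 1 g = s.nat 4 (k + 1) ∧ a = s.real 1 g ∧ b = s.real 0 g)

/-- Every item that belongs to some class of the walk is assigned to such a class, and its values
are put in the order of the walk. -/
theorem classify_spec (s : Memory)
    (hex : ∀ g < s.nat 0 1, ∃ k < s.nat 0 0, ∃ a b, Classified s g k a b) :
    ∀ g < s.nat 0 1, (classify.run s).nat 5 g < s.nat 0 0 ∧
      Classified s g ((classify.run s).nat 5 g) ((classify.run s).real 2 g)
        ((classify.run s).real 3 g) := by
  refine run_count (fun i s' => ∀ g < i, s'.nat 5 g < s.nat 0 0 ∧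
    Classified s g (s'.nat 5 g) (s'.real 2 g) (s'.real 3 g)) (by simp) ?_
  intro i s' hi hv hf hfr hI
  have f0 := hf 0 (by decide) (by simp [classifyBody, block, natWrites])
  have f1 := hf 1 (by decide) (by simp [classifyBody, block, natWrites])
  have f2 := hf 2 (by decide) (by simp [classifyBody, block, natWrites])
  have f4 := hf 4 (by decide) (by simp [classifyBody, block, natWrites])
  have r0 := hfr 0 (by simp [classifyBody, block, realWrites])
  have r1 := hfr 1 (by simp [classifyBody, block, realWrites])
  have key : _ ∧ _ := run_count (s := s') (v := 11) (b := 0) (c := classifyBody) (fun k s'' =>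
    (∀ g, g ≠ i → s''.nat 5 g = s'.nat 5 g ∧ s''.real 2 g = s'.real 2 g ∧
      s''.real 3 g = s'.real 3 g) ∧
    ((∃ j < k, ∃ a b, Classified s i j a b) → s''.nat 5 i < s.nat 0 0 ∧
      Classified s i (s''.nat 5 i) (s''.real 2 i) (s''.real 3 i))) ?_ ?_
  · obtain ⟨k1, k2⟩ := key
    intro g hg
    simp only [Memory.writeNat_nat, Memory.writeNat_real]
    rcases Nat.lt_succ_iff_lt_or_eq.1 hg with hg | rfl
    · obtain ⟨e1, e2, e3⟩ := k1 g (by omega)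
      simpa [e1, e2, e3] using hI g hg
    · simpa using k2 (by simpa [f0] using hex g hi)
  · simp
  · intro k s'' hk hv' hf' hfr' ⟨h1, h2⟩
    have e1 := (hf' 1 (by decide) (by simp [classifyBody, block, natWrites])).trans f1
    have e2 := (hf' 2 (by decide) (by simp [classifyBody, block, natWrites])).trans f2
    have e4 := (hf' 4 (by decide) (by simp [classifyBody, block, natWrites])).trans f4
    have e10 := congrFun (hf' 10 (by decide) (by simp [classifyBody, block, natWrites])) 0
    rw [hv] at e10
    have q0 := (hfr' 0 (by simp [classifyBody, block, realWrites])).trans r0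
    have q1 := (hfr' 1 (by simp [classifyBody, block, realWrites])).trans r1
    rw [f0] at hk
    simp only [classifyBody, run_ite]
    split_ifs with hA hB
    · simp [e1, e2, e4, e10, hv', q0, q1] at hA ⊢
      refine ⟨fun g hg => by simp [hg, h1], fun _ _ _ _ _ => ⟨hk, Or.inl ⟨hA.1, hA.2, rfl, rfl⟩⟩⟩
    · simp [e1, e2, e4, e10, hv', q0, q1] at hB ⊢
      refine ⟨fun g hg => by simp [hg, h1], fun _ _ _ _ _ => ⟨hk, Or.inr ⟨hB.1, hB.2, rfl, rfl⟩⟩⟩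
    · simp [e1, e2, e4, e10, hv'] at hA hB ⊢
      refine ⟨h1, fun j hj a b h => h2 ⟨j, ?_, a, b, h⟩⟩
      rcases Nat.le_iff_lt_or_eq.1 hj with hj | rfl
      · exact hj
      · rcases h with h | h
        · exact absurd h.2.1 (hA h.1)
        · exact absurd h.2.1 (hB h.1)

/-! ### Balancing the splits -/

/-- The sign with which the items of a part are counted. -/
noncomputable def sgn (σ : ℕ) : ℝ := if σ = 0 then 1 else -1

/-- The state in the course of balancing: item `g < m` has edge class `e g`, weight `w g` and part
`σ g`, and is open if `done g = 0`.  By `small`, the part of a closed item is not heavier than the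
other part once the item is removed.  This persists when an open item is moved from the heavier
part: the difference `Df` does not grow in absolute value (`bound`), and it changes sign only to
become smaller than the moved item, which is no heavier than the closed ones (`order`). -/
structure Balancing (m n : ℕ) (e : ℕ → ℕ) (w : ℕ → ℝ) (D₀ : ℕ → ℝ) (σ done : ℕ → ℕ)
    (Df : ℕ → ℝ) : Prop where
  side : ∀ g < m, σ g ≤ 1
  diff : ∀ k < n, Df k = ∑ g ∈ Finset.range m, if e g = k then sgn (σ g) * w g else 0
  small : ∀ g < m, done g ≠ 0 → sgn (σ g) * Df (e g) ≤ w g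
  order : ∀ g < m, ∀ h < m, done g ≠ 0 → done h = 0 → w h ≤ w g
  bound : ∀ k < n, |Df k| ≤ D₀ k

section Balancing

variable {m n : ℕ} {e : ℕ → ℕ} {w : ℕ → ℝ} {D₀ : ℕ → ℝ} {σ done σ' done' : ℕ → ℕ}
  {Df Df' : ℕ → ℝ}

/-- The heaviest open item `b` may be closed where it is if its part is not heavier without it. -/
theorem Balancing.close (h : Balancing m n e w D₀ σ done Df) {b : ℕ}
    (hbest : ∀ g < m, done g = 0 → w g ≤ w b) (hs : sgn (σ b) * Df (e b) ≤ w b)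
    (hd : ∀ g, done' g = if g = b then 1 else done g) : Balancing m n e w D₀ σ done' Df := by
  refine ⟨h.side, h.diff, fun g hg hdg => ?_, fun g hg x hx hdg hdx => ?_, h.bound⟩
  · by_cases hgb : g = b
    · rw [hgb]; exact hs
    · rw [hd, if_neg hgb] at hdg; exact h.small g hg hdg
  · have hxb : x ≠ b := by rintro rfl; simp [hd] at hdx
    rw [hd, if_neg hxb] at hdx
    by_cases hgb : g = b
    · rw [hgb]; exact hbest x hx hdx
    · rw [hd, if_neg hgb] at hdg; exact h.order g hg x hx hdg hdx

theorem sgn_eq_or (σ : ℕ) : sgn σ = 1 ∨ sgn σ = -1 := by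
  unfold sgn; split_ifs <;> simp

/-- If the heaviest open item `b` lies in a part that is heavier even without it, it may be moved to
the other part and closed. -/
theorem Balancing.flip (h : Balancing m n e w D₀ σ done Df) {b : ℕ} (hb : b < m)
    (hw : 0 ≤ w b) (hdb : done b = 0)
    (hbest : ∀ g < m, done g = 0 → w g ≤ w b) (hs : w b < sgn (σ b) * Df (e b))
    (hd : ∀ g, done' g = if g = b then 1 else done g)
    (hσ : ∀ g, g ≠ b → σ' g = σ g) (hσb : σ' b ≤ 1) (hσb' : sgn (σ' b) = - sgn (σ b))
    (hD : ∀ k, Df' k = if k = e b then Df k - 2 * (sgn (σ b) * w b) else Df k) :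
    Balancing m n e w D₀ σ' done' Df' := by
  have hsq : sgn (σ b) * sgn (σ b) = 1 := by
    rcases sgn_eq_or (σ b) with h | h <;> rw [h] <;> norm_num
  refine ⟨fun g hg => ?_, fun k hk => ?_, fun g hg hdg => ?_, fun g hg x hx hdg hdx => ?_,
    fun k hk => ?_⟩
  · by_cases hgb : g = b
    · rw [hgb]; exact hσb
    · rw [hσ g hgb]; exact h.side g hg
  · have h1 : ∑ g ∈ Finset.range m, (if e g = k then sgn (σ' g) * w g else 0) -
        ∑ g ∈ Finset.range m, (if e g = k then sgn (σ g) * w g else 0) =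
        if e b = k then - 2 * (sgn (σ b) * w b) else 0 := by
      rw [← Finset.sum_sub_distrib, Finset.sum_eq_single b]
      · split_ifs
        · rw [hσb']; ring
        · ring
      · intro g _ hgb; rw [hσ g hgb]; ring
      · intro hc; exact absurd (Finset.mem_range.2 hb) hc
    rw [hD, h.diff k hk]
    by_cases hk : e b = k
    · rw [if_pos hk.symm]; rw [if_pos hk] at h1; linarith
    · rw [if_neg (Ne.symm hk)]; rw [if_neg hk] at h1; linarith
  · rw [hD]
    by_cases hgb : g = b
    · subst hgb
      rw [if_pos rfl, hσb']
      have : -sgn (σ g) * (Df (e g) - 2 * (sgn (σ g) * w g)) =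
        - (sgn (σ g) * Df (e g)) + 2 * (sgn (σ g) * sgn (σ g)) * w g := by ring
      rw [this, hsq]; linarith
    · rw [hσ g hgb]
      rw [hd, if_neg hgb] at hdg
      have h1 := h.small g hg hdg
      have h2 := h.order g hg b hb hdg hdb
      split_ifs with he
      · rw [he] at h1 ⊢
        rcases sgn_eq_or (σ b) with hb1 | hb1 <;> rcases sgn_eq_or (σ g) with hg1 | hg1 <;>
          rw [hb1] at hs ⊢ <;> rw [hg1] at h1 ⊢ <;> linarith
      · exact h1
  · have hxb : x ≠ b := by rintro rfl; simp [hd] at hdx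
    rw [hd, if_neg hxb] at hdx
    by_cases hgb : g = b
    · rw [hgb]; exact hbest x hx hdx
    · rw [hd, if_neg hgb] at hdg; exact h.order g hg x hx hdg hdx
  · refine le_trans ?_ (h.bound k hk)
    rw [hD]
    split_ifs with he
    · subst he
      rcases sgn_eq_or (σ b) with hb1 | hb1 <;> rw [hb1] at hs ⊢
      · rw [abs_of_pos (a := Df (e b)) (by linarith), abs_le]; constructor <;> linarith
      · rw [abs_of_neg (a := Df (e b)) (by linarith), abs_le]; constructor <;> linarith
    · exact le_rfl

end Balancing

/-- The memory is in the course of balancing. -/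
def InBalance (D₀ : ℕ → ℝ) (s : Memory) : Prop :=
  Balancing (s.nat 0 1) (s.nat 0 0) (s.nat 5) (s.real 8) D₀ (s.nat 7) (s.nat 8) (s.real 4)

/-- The difference of the weights of the two parts of edge class `k`, where item `g < m` has edge
class `e g`, part `σ g` and weight `w g`. -/
noncomputable def signedSum (m : ℕ) (e σ : ℕ → ℕ) (w : ℕ → ℝ) (k : ℕ) : ℝ :=
  ∑ g ∈ Finset.range m, if e g = k then sgn (σ g) * w g else 0

/-- The differences of the two parts of the edge classes, by the tables in the memory. -/
noncomputable def differenceOf (s : Memory) (k : ℕ) : ℝ :=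
  signedSum (s.nat 0 1) (s.nat 5) (s.nat 7) (s.real 8) k

theorem differences_spec (s : Memory) :
    (∀ g < s.nat 0 1, (differences.run s).nat 8 g = 0) ∧
    ∀ k < s.nat 0 0, (differences.run s).real 4 k = differenceOf s k := by
  set s₁ := (count 10 0 (setReal 4 kk .zero)).run s with hs₁
  have e0 : s₁.nat 0 = s.nat 0 := run_nat_of_notMem _ (by decide) _
  have e5 : s₁.nat 5 = s.nat 5 := run_nat_of_notMem _ (by decide) _
  have e7 : s₁.nat 7 = s.nat 7 := run_nat_of_notMem _ (by decide) _
  have e8 : s₁.real 8 = s.real 8 := run_real_of_notMem _ (by decide) _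
  have k1 : ∀ k < s.nat 0 0, s₁.real 4 k = 0 := by
    refine run_count (fun i s' => ∀ k < i, s'.real 4 k = 0) (by simp) ?_
    intro i s' hi hv hf hfr hI k hk
    simp [hv]
    intro hki
    exact hI k (by omega)
  have k2 : (∀ g < s₁.nat 0 1, (addDifferences.run s₁).nat 8 g = 0) ∧ ∀ k < s.nat 0 0,
      (addDifferences.run s₁).real 4 k = ∑ g ∈ Finset.range (s₁.nat 0 1),
        if s.nat 5 g = k then sgn (s.nat 7 g) * s.real 8 g else 0 := by
    refine run_count (fun i s' => (∀ g < i, s'.nat 8 g = 0) ∧ ∀ k < s.nat 0 0,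
      s'.real 4 k = ∑ g ∈ Finset.range i,
        if s.nat 5 g = k then sgn (s.nat 7 g) * s.real 8 g else 0) ?_ ?_
    · simpa using k1
    · intro i s' hi hv hf hfr ⟨h1, h2⟩
      have f5 := (hf 5 (by decide) (by decide)).trans e5
      have f7 := (hf 7 (by decide) (by decide)).trans e7
      have f8 := (hfr 8 (by decide)).trans e8
      simp only [run_block_cons, run_block_nil, run_ite]
      split_ifs with hc
      · simp [hv, f5, f7, f8] at hc ⊢
        refine ⟨fun g hg hgi => h1 g (by omega), fun k hk => ?_⟩
        rw [Finset.sum_range_succ, ← h2 k hk]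
        by_cases hk : k = s.nat 5 i
        · simp [hk, hc, sgn]
        · simp [hk, Ne.symm hk]
      · simp [hv, f5, f7, f8] at hc ⊢
        refine ⟨fun g hg hgi => h1 g (by omega), fun k hk => ?_⟩
        rw [Finset.sum_range_succ, ← h2 k hk]
        by_cases hk : k = s.nat 5 i
        · simp [hk, hc, sgn, sub_eq_add_neg]
        · simp [hk, Ne.symm hk]
  have hr : differences.run s = addDifferences.run s₁ := rfl
  rw [hr]
  refine ⟨?_, fun k hk => ?_⟩
  · simpa only [e0] using k2.1
  · have := k2.2 k hk
    unfold differenceOf signedSum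
    simpa only [e0] using this

/-- The loop finds the heaviest open item, unless all items are closed. -/
theorem select_spec (s : Memory) :
    ((select.run s).nat 9 0 = s.nat 0 1 ∧ ∀ g < s.nat 0 1, s.nat 8 g ≠ 0) ∨
    ((select.run s).nat 9 0 < s.nat 0 1 ∧ s.nat 8 ((select.run s).nat 9 0) = 0 ∧
      ∀ g < s.nat 0 1, s.nat 8 g = 0 → s.real 8 g ≤ s.real 8 ((select.run s).nat 9 0)) := by
  have h0 : (s.writeNat 9 0 (s.nat 0 1)).nat 0 1 = s.nat 0 1 := by simp
  have := run_count (s := s.writeNat 9 0 (s.nat 0 1)) (v := 11) (b := 1)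
    (c := ite (.and (.natEq (.read 8 gg) (.lit 0))
      (.or (.natEq (.var 9) mm) (.realLE (.read 8 (.var 9)) (.read 8 gg))))
    (setNat 9 (.lit 0) gg) skip) (fun i s' =>
    (s'.nat 9 0 = s.nat 0 1 ∧ ∀ g < i, s.nat 8 g ≠ 0) ∨
    (s'.nat 9 0 < s.nat 0 1 ∧ s.nat 8 (s'.nat 9 0) = 0 ∧
      ∀ g < i, s.nat 8 g = 0 → s.real 8 g ≤ s.real 8 (s'.nat 9 0))) (by simp) ?_
  · rw [h0] at this
    simpa [select] using this
  · intro i s' hi hv hf hfr hI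
    rw [h0] at hi
    have f0 : s'.nat 0 = s.nat 0 := by
      rw [hf 0 (by decide) (by decide)]; ext; simp
    have f8 : s'.nat 8 = s.nat 8 := by
      rw [hf 8 (by decide) (by decide)]; ext; simp
    have r8 : s'.real 8 = s.real 8 := by
      rw [hfr 8 (by decide)]; ext; simp
    simp only [run_ite]
    split_ifs with hc
    · simp [hv, f0, f8, r8] at hc ⊢
      right
      refine ⟨hi, hc.1, fun g hg hg0 => ?_⟩
      rcases Nat.le_iff_lt_or_eq.1 hg with hg | rfl
      · rcases hc.2 with hc2 | hc2
        · rcases hI with hI | hI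
          · exact absurd hg0 (hI.2 g hg)
          · omega
        · rcases hI with hI | hI
          · exact absurd hg0 (hI.2 g hg)
          · exact (hI.2.2 g hg hg0).trans hc2
      · exact le_rfl
    · simp [hv, f0, f8, r8] at hc ⊢
      rcases hI with hI | hI
      · left
        refine ⟨hI.1, fun g hg hg0 => ?_⟩
        rcases Nat.le_iff_lt_or_eq.1 hg with hg | rfl
        · exact hI.2 g hg hg0
        · exact (hc hg0).1 hI.1
      · right
        refine ⟨hI.1, hI.2.1, fun g hg hg0 => ?_⟩
        rcases Nat.le_iff_lt_or_eq.1 hg with hg | rfl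
        · exact hI.2.2 g hg hg0
        · exact (hc hg0).2.le

/-- The selected item is treated by `Balancing.close` or `Balancing.flip`, according to the test. -/
theorem flip_spec (s : Memory) {D₀ : ℕ → ℝ} (h : InBalance D₀ s)
    (hw : ∀ g < s.nat 0 1, 0 ≤ s.real 8 g)
    (hsel : (s.nat 9 0 = s.nat 0 1 ∧ ∀ g < s.nat 0 1, s.nat 8 g ≠ 0) ∨
      (s.nat 9 0 < s.nat 0 1 ∧ s.nat 8 (s.nat 9 0) = 0 ∧
        ∀ g < s.nat 0 1, s.nat 8 g = 0 → s.real 8 g ≤ s.real 8 (s.nat 9 0))) :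
    InBalance D₀ (flip.run s) ∧ ∀ g < s.nat 0 1,
      (flip.run s).nat 8 g = if g = s.nat 9 0 then 1 else s.nat 8 g := by
  unfold InBalance at *
  rw [run_nat_of_notMem flip (a := 0) (by decide), run_nat_of_notMem flip (a := 5) (by decide),
    run_real_of_notMem flip (a := 8) (by decide)]
  unfold flip
  simp only [run_ite, run_block_cons, run_block_nil]
  rcases hsel with ⟨h1, h2⟩ | ⟨h1, h2, h3⟩
  · rw [if_pos (by simpa using h1)]
    exact ⟨h, fun g hg => by rw [if_neg (by omega)]; simp⟩
  · rw [if_neg (by simp; omega)]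
    have hs1 := h.side _ h1
    have hsel0 : s.nat 7 (s.nat 9 0) = 0 → sgn (s.nat 7 (s.nat 9 0)) = 1 := fun h => by
      simp [h, sgn]
    have hsel1 : s.nat 7 (s.nat 9 0) ≠ 0 → sgn (s.nat 7 (s.nat 9 0)) = -1 := fun h => by
      simp [h, sgn]
    split_ifs with hA hB hB <;> simp at hA hB
    · refine ⟨h.flip h1 (hw _ h1) h2 h3 (by rw [hsel0 hA]; linarith) (fun g => by simp)
        (fun g hg => by simp [hg]) (by simp) (by simp [hA, sgn]) (fun k => ?_), by simp⟩
      simp only [run_setReal, run_setNat, Memory.writeReal_real, Memory.writeNat_nat,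
        Memory.writeNat_real, eval, RealExpr.eval]
      simp only [hsel0 hA]
      by_cases hk : k = s.nat 5 (s.nat 9 0)
      · simp [hk]; ring
      · simp [hk]
    · exact ⟨h.close h3 (by rw [hsel0 hA]; simpa using hB) (fun g => by simp), by simp⟩
    · refine ⟨h.flip h1 (hw _ h1) h2 h3 (by rw [hsel1 hA]; linarith) (fun g => by simp)
        (fun g hg => by simp [hg]) (by simp) (by simp [hA, sgn]) (fun k => ?_), by simp⟩
      simp only [run_setReal, run_setNat, Memory.writeReal_real, Memory.writeNat_nat,
        Memory.writeNat_real, eval, RealExpr.eval]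
      simp only [hsel1 hA]
      by_cases hk : k = s.nat 5 (s.nat 9 0)
      · simp [hk]; ring
      · simp [hk]
    · exact ⟨h.close h3 (by rw [hsel1 hA]; linarith) (fun g => by simp), by simp⟩

/-- Balancing makes the split of every edge class EFX with respect to the weights: the excess of a
part over the other one is at most the weight of any of its items.  The difference of the two parts
does not grow in absolute value. -/
theorem balance_spec (s : Memory) (hs : ∀ g < s.nat 0 1, s.nat 7 g ≤ 1)
    (hw : ∀ g < s.nat 0 1, 0 ≤ s.real 8 g) (he : ∀ g < s.nat 0 1, s.nat 5 g < s.nat 0 0) :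
    (∀ g < s.nat 0 1, (balance.run s).nat 7 g ≤ 1) ∧
    (∀ g < s.nat 0 1, sgn ((balance.run s).nat 7 g) * differenceOf (balance.run s) (s.nat 5 g) ≤
      s.real 8 g) ∧
    ∀ k < s.nat 0 0, |differenceOf (balance.run s) k| ≤ |differenceOf s k| := by
  have hd := differences_spec s
  set s₁ := differences.run s with hs₁
  have e0 : s₁.nat 0 = s.nat 0 := run_nat_of_notMem _ (by decide) _
  have e5 : s₁.nat 5 = s.nat 5 := run_nat_of_notMem _ (by decide) _
  have e7 : s₁.nat 7 = s.nat 7 := run_nat_of_notMem _ (by decide) _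
  have e8 : s₁.real 8 = s.real 8 := run_real_of_notMem _ (by decide) _
  have key : InBalance (fun k => |differenceOf s k|) (balance.run s) ∧
      ((Finset.range (s.nat 0 1)).filter fun g => (balance.run s).nat 8 g = 0).card + s₁.nat 0 1 ≤
        s.nat 0 1 := by
    refine run_count (s := s₁) (v := 10) (b := 1) (c := seq select flip)
      (fun i s' => InBalance (fun k => |differenceOf s k|) s' ∧
      ((Finset.range (s.nat 0 1)).filter fun g => s'.nat 8 g = 0).card + i ≤ s.nat 0 1) ?_ ?_
    · refine ⟨?_, ?_⟩
      · refine ⟨?_, ?_, ?_, ?_, ?_⟩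
        · simpa [e0, e7] using hs
        · intro k hk
          simp [e0, e5, e7, e8] at hk ⊢
          exact hd.2 k hk
        · intro g hg hdg
          simp [e0] at hg hdg
          exact absurd (hd.1 g hg) hdg
        · intro g hg x hx hdg
          simp [e0] at hg hdg
          exact absurd (hd.1 g hg) hdg
        · intro k hk
          simp [e0] at hk ⊢
          rw [hd.2 k hk]
      · simpa using Finset.card_filter_le (Finset.range (s.nat 0 1)) _
    · intro i s' hi hv hf hfr ⟨h1, h2⟩
      have f0 := (hf 0 (by decide) (by decide)).trans e0
      have r8 := (hfr 8 (by decide)).trans e8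
      set s₂ := select.run s' with hs₂
      have g0 : s₂.nat 0 = s'.nat 0 := run_nat_of_notMem _ (by decide) _
      have g5 : s₂.nat 5 = s'.nat 5 := run_nat_of_notMem _ (by decide) _
      have g7 : s₂.nat 7 = s'.nat 7 := run_nat_of_notMem _ (by decide) _
      have g8 : s₂.nat 8 = s'.nat 8 := run_nat_of_notMem _ (by decide) _
      have q4 : s₂.real 4 = s'.real 4 := run_real_of_notMem _ (by decide) _
      have q8 : s₂.real 8 = s'.real 8 := run_real_of_notMem _ (by decide) _
      have hsel := select_spec s'
      rw [← hs₂, ← g0, ← g8, ← q8] at hsel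
      have h1' : InBalance (fun k => |differenceOf s k|) s₂ := by
        unfold InBalance at *
        rwa [g0, g5, g7, g8, q4, q8]
      have hfl := flip_spec s₂ h1' (by rw [g0, f0, q8, r8]; exact hw) hsel
      refine ⟨?_, ?_⟩
      · unfold InBalance at *
        simpa [run, hs₂] using hfl.1
      · have e : (((seq select flip).run s').writeNat 10 0 (i + 1)).nat 8 =
            (flip.run s₂).nat 8 := by
          ext; simp [hs₂, run]
        rw [e]
        rw [g0, f0] at hfl hsel
        rcases hsel with ⟨hb, hall⟩ | ⟨hb, hb0, -⟩
        · rw [Finset.filter_false_of_mem]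
          · simp only [Finset.card_empty]; rw [e0] at hi; omega
          · intro g hg
            rw [Finset.mem_range] at hg
            rw [hfl.2 g hg, if_neg (by omega)]
            exact hall g hg
        · have hlt : ((Finset.range (s.nat 0 1)).filter fun g => (flip.run s₂).nat 8 g = 0).card <
              ((Finset.range (s.nat 0 1)).filter fun g => s'.nat 8 g = 0).card := by
            refine Finset.card_lt_card ((Finset.ssubset_iff_of_subset ?_).2 ⟨s₂.nat 9 0, ?_, ?_⟩)
            · intro g hg
              simp only [Finset.mem_filter, Finset.mem_range] at hg ⊢
              rw [hfl.2 g hg.1] at hg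
              refine ⟨hg.1, ?_⟩
              rw [← g8]
              by_contra hc
              have := hg.2
              split_ifs at this
              exact hc this
            · simp only [Finset.mem_filter, Finset.mem_range]
              exact ⟨hb, by rw [← g8]; exact hb0⟩
            · simp only [Finset.mem_filter, Finset.mem_range, not_and]
              intro hlt'
              rw [hfl.2 _ hlt', if_pos rfl]
              exact one_ne_zero
          omega
  obtain ⟨k1, k2⟩ := key
  have b0 : (balance.run s).nat 0 = s.nat 0 := run_nat_of_notMem _ (by decide) _
  have b5 : (balance.run s).nat 5 = s.nat 5 := run_nat_of_notMem _ (by decide) _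
  have b8 : (balance.run s).real 8 = s.real 8 := run_real_of_notMem _ (by decide) _
  have hD : ∀ k < s.nat 0 0, (balance.run s).real 4 k = differenceOf (balance.run s) k := by
    intro k hk
    exact k1.diff k (by rwa [b0])
  refine ⟨fun g hg => k1.side g (by rwa [b0]), fun g hg => ?_, fun k hk => ?_⟩
  · rw [← hD _ (he g hg), ← b5, ← b8]
    refine k1.small g (by rwa [b0]) ?_
    have h0 :
        ((Finset.range (s.nat 0 1)).filter fun g => (balance.run s).nat 8 g = 0).card = 0 := by
      rw [e0] at k2; omega
    rw [Finset.card_eq_zero, Finset.filter_eq_empty_iff] at h0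
    exact h0 (Finset.mem_range.2 hg)
  · rw [← hD k hk]
    exact k1.bound k (by rwa [b0])

theorem signedSum_congr {m : ℕ} {e σ σ' : ℕ → ℕ} {w w' : ℕ → ℝ} (hσ : ∀ g < m, σ' g = σ g)
    (hw : ∀ g < m, w' g = w g) (k : ℕ) : signedSum m e σ' w' k = signedSum m e σ w k := by
  refine Finset.sum_congr rfl fun g hg => ?_
  rw [Finset.mem_range] at hg
  rw [hσ g hg, hw g hg]

theorem loadFirst_spec (s : Memory) :
    ∀ g < s.nat 0 1, (loadFirst.run s).real 8 g = s.real 2 g := by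
  refine run_count (fun i s' => ∀ g < i, s'.real 8 g = s.real 2 g) (by simp) ?_
  intro i s' hi hv hf hfr hI g hg
  have r2 := hfr 2 (by decide)
  rcases Nat.lt_succ_iff_lt_or_eq.1 hg with hg | rfl
  · simpa [hv, r2, hg.ne] using hI g hg
  · simp [hv, r2]

theorem loadSecond_spec (s : Memory) : ∀ g < s.nat 0 1,
    (loadSecond.run s).nat 6 g = s.nat 7 g ∧ (loadSecond.run s).real 8 g = s.real 3 g := by
  refine run_count (fun i s' => ∀ g < i, s'.nat 6 g = s.nat 7 g ∧ s'.real 8 g = s.real 3 g)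
    (by simp) ?_
  intro i s' hi hv hf hfr hI g hg
  have r3 := hfr 3 (by decide)
  have f7 := hf 7 (by decide) (by decide)
  rcases Nat.lt_succ_iff_lt_or_eq.1 hg with hg | rfl
  · simpa [hv, r3, f7, hg.ne] using hI g hg
  · simp [hv, r3, f7]

/-- Two families of splits of the edge classes: the splits `σB` are EFX for the first endpoints,
with values `a`, the splits `σD` are EFX for the second endpoints, with values `b`, and the latter
are at least as balanced for the second endpoints. -/
structure IsCut (m n : ℕ) (e σB σD : ℕ → ℕ) (a b : ℕ → ℝ) : Prop where
  left_nonneg : ∀ g < m, 0 ≤ a g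
  right_nonneg : ∀ g < m, 0 ≤ b g
  edge : ∀ g < m, e g < n
  sideB : ∀ g < m, σB g ≤ 1
  sideD : ∀ g < m, σD g ≤ 1
  efxB : ∀ g < m, sgn (σB g) * signedSum m e σB a (e g) ≤ a g
  efxD : ∀ g < m, sgn (σD g) * signedSum m e σD b (e g) ≤ b g
  bound : ∀ k < n, |signedSum m e σD b k| ≤ |signedSum m e σB b k|

/-- Cutting produces splits of both kinds. All items start in part `0`; the second balancing starts
from the result of the first, which gives the bound. -/
theorem cut_spec (s : Memory) (hs : ∀ g < s.nat 0 1, s.nat 7 g = 0)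
    (ha : ∀ g < s.nat 0 1, 0 ≤ s.real 2 g) (hb : ∀ g < s.nat 0 1, 0 ≤ s.real 3 g)
    (he : ∀ g < s.nat 0 1, s.nat 5 g < s.nat 0 0) :
    IsCut (s.nat 0 1) (s.nat 0 0) (s.nat 5) ((cut.run s).nat 6) ((cut.run s).nat 7)
      (s.real 2) (s.real 3) := by
  set s₁ := loadFirst.run s with hs₁
  set s₂ := balance.run s₁ with hs₂
  set s₃ := loadSecond.run s₂ with hs₃
  set s₄ := balance.run s₃ with hs₄
  have hr : cut.run s = s₄ := rfl
  rw [hr]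
  have h1 := loadFirst_spec s
  rw [← hs₁] at h1
  have e10 : s₁.nat 0 = s.nat 0 := run_nat_of_notMem _ (by decide) _
  have e15 : s₁.nat 5 = s.nat 5 := run_nat_of_notMem _ (by decide) _
  have e17 : s₁.nat 7 = s.nat 7 := run_nat_of_notMem _ (by decide) _
  have r13 : s₁.real 3 = s.real 3 := run_real_of_notMem _ (by decide) _
  have e20 : s₂.nat 0 = s.nat 0 := (run_nat_of_notMem _ (by decide) _).trans e10
  have e25 : s₂.nat 5 = s.nat 5 := (run_nat_of_notMem _ (by decide) _).trans e15
  have r23 : s₂.real 3 = s.real 3 := (run_real_of_notMem _ (by decide) _).trans r13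
  have r28 : s₂.real 8 = s₁.real 8 := run_real_of_notMem _ (by decide) _
  have e30 : s₃.nat 0 = s.nat 0 := (run_nat_of_notMem _ (by decide) _).trans e20
  have e35 : s₃.nat 5 = s.nat 5 := (run_nat_of_notMem _ (by decide) _).trans e25
  have e37 : s₃.nat 7 = s₂.nat 7 := run_nat_of_notMem _ (by decide) _
  have e40 : s₄.nat 0 = s.nat 0 := (run_nat_of_notMem _ (by decide) _).trans e30
  have e45 : s₄.nat 5 = s.nat 5 := (run_nat_of_notMem _ (by decide) _).trans e35
  have e46 : s₄.nat 6 = s₃.nat 6 := run_nat_of_notMem _ (by decide) _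
  have r48 : s₄.real 8 = s₃.real 8 := run_real_of_notMem _ (by decide) _
  obtain ⟨a1, a2, -⟩ := balance_spec s₁ (by rw [e10, e17]; intro g hg; rw [hs g hg]; omega)
    (by rw [e10]; intro g hg; rw [h1 g hg]; exact ha g hg) (by rwa [e10, e15])
  rw [← hs₂, e10] at a1 a2
  have h3 := loadSecond_spec s₂
  rw [← hs₃, e20, r23] at h3
  obtain ⟨b1, b2, b3⟩ := balance_spec s₃ (by rw [e30, e37]; exact a1)
    (by rw [e30]; intro g hg; rw [(h3 g hg).2]; exact hb g hg) (by rwa [e30, e35])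
  rw [← hs₄, e30] at b1 b2 b3
  have d2 : ∀ k, differenceOf s₂ k = signedSum (s.nat 0 1) (s.nat 5) (s₄.nat 6) (s.real 2) k := by
    intro k
    unfold differenceOf
    rw [e20, e25, r28, e46]
    exact signedSum_congr (fun g hg => ((h3 g hg).1).symm) h1 k
  have d3 : ∀ k, differenceOf s₃ k = signedSum (s.nat 0 1) (s.nat 5) (s₄.nat 6) (s.real 3) k := by
    intro k
    unfold differenceOf
    rw [e30, e35, e37, e46]
    exact signedSum_congr (fun g hg => ((h3 g hg).1).symm) (fun g hg => (h3 g hg).2) k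
  have d4 : ∀ k, differenceOf s₄ k = signedSum (s.nat 0 1) (s.nat 5) (s₄.nat 7) (s.real 3) k := by
    intro k
    unfold differenceOf
    rw [e40, e45, r48]
    exact signedSum_congr (fun g hg => rfl) (fun g hg => (h3 g hg).2) k
  refine ⟨ha, hb, he, fun g hg => ?_, b1, fun g hg => ?_, fun g hg => ?_, fun k hk => ?_⟩
  · rw [e46, (h3 g hg).1]; exact a1 g hg
  · rw [← d2, e46, (h3 g hg).1, ← h1 g hg, ← e15]; exact a2 g hg
  · rw [← d4, ← (h3 g hg).2, ← e35]; exact b2 g hg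
  · rw [← d4, ← d3]; exact b3 k hk

/-! ### The values of the parts, the start and the output -/

/-- The weight of part `side` of edge class `k`. -/
noncomputable def partSum (m : ℕ) (e σ : ℕ → ℕ) (w : ℕ → ℝ) (k side : ℕ) : ℝ :=
  ∑ g ∈ Finset.range m, if e g = k ∧ σ g = side then w g else 0

theorem clearSums_spec (s : Memory) : ∀ k < s.nat 0 0, ∀ i ≤ 1,
    (clearSums.run s).real 5 (k + k + i) = 0 ∧ (clearSums.run s).real 6 (k + k + i) = 0 ∧
      (clearSums.run s).real 7 (k + k + i) = 0 := by
  refine run_count (fun j s' => ∀ k < j, ∀ i ≤ 1, s'.real 5 (k + k + i) = 0 ∧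
    s'.real 6 (k + k + i) = 0 ∧ s'.real 7 (k + k + i) = 0) (by simp) ?_
  intro j s' hj hv hf hfr hI k hk i hi
  rcases Nat.lt_succ_iff_lt_or_eq.1 hk with hk | rfl
  · have h1 : k + k + i ≠ j + j + 1 := by omega
    have h2 : k + k + i ≠ j + j := by omega
    simpa [hv, h1, h2] using hI k hk i hi
  · have : i = 0 ∨ i = 1 := by omega
    rcases this with rfl | rfl <;> simp [hv]

theorem sums_spec (s : Memory) (h6 : ∀ g < s.nat 0 1, s.nat 6 g ≤ 1)
    (h7 : ∀ g < s.nat 0 1, s.nat 7 g ≤ 1) : ∀ k < s.nat 0 0, ∀ i ≤ 1,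
    (sums.run s).real 5 (k + k + i) = partSum (s.nat 0 1) (s.nat 5) (s.nat 7) (s.real 2) k i ∧
    (sums.run s).real 6 (k + k + i) = partSum (s.nat 0 1) (s.nat 5) (s.nat 7) (s.real 3) k i ∧
    (sums.run s).real 7 (k + k + i) = partSum (s.nat 0 1) (s.nat 5) (s.nat 6) (s.real 3) k i := by
  have h1 := clearSums_spec s
  set s₁ := clearSums.run s with hs₁
  have e0 : s₁.nat 0 = s.nat 0 := run_nat_of_notMem _ (by decide) _
  have e5 : s₁.nat 5 = s.nat 5 := run_nat_of_notMem _ (by decide) _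
  have e6 : s₁.nat 6 = s.nat 6 := run_nat_of_notMem _ (by decide) _
  have e7 : s₁.nat 7 = s.nat 7 := run_nat_of_notMem _ (by decide) _
  have r2 : s₁.real 2 = s.real 2 := run_real_of_notMem _ (by decide) _
  have r3 : s₁.real 3 = s.real 3 := run_real_of_notMem _ (by decide) _
  have hr : sums.run s = addSums.run s₁ := rfl
  have key : ∀ k < s.nat 0 0, ∀ i ≤ 1,
      (addSums.run s₁).real 5 (k + k + i) =
        partSum (s₁.nat 0 1) (s.nat 5) (s.nat 7) (s.real 2) k i ∧
      (addSums.run s₁).real 6 (k + k + i) =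
        partSum (s₁.nat 0 1) (s.nat 5) (s.nat 7) (s.real 3) k i ∧
      (addSums.run s₁).real 7 (k + k + i) =
        partSum (s₁.nat 0 1) (s.nat 5) (s.nat 6) (s.real 3) k i := by
    refine run_count (fun j s' => ∀ k < s.nat 0 0, ∀ i ≤ 1,
      s'.real 5 (k + k + i) = partSum j (s.nat 5) (s.nat 7) (s.real 2) k i ∧
      s'.real 6 (k + k + i) = partSum j (s.nat 5) (s.nat 7) (s.real 3) k i ∧
      s'.real 7 (k + k + i) = partSum j (s.nat 5) (s.nat 6) (s.real 3) k i) ?_ ?_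
    · simpa [partSum] using h1
    · intro j s' hj hv hf hfr hI k hk i hi
      rw [e0] at hj
      have f5 := (hf 5 (by decide) (by decide)).trans e5
      have f6 := (hf 6 (by decide) (by decide)).trans e6
      have f7 := (hf 7 (by decide) (by decide)).trans e7
      have q2 := (hfr 2 (by decide)).trans r2
      have q3 := (hfr 3 (by decide)).trans r3
      obtain ⟨i1, i2, i3⟩ := hI k hk i hi
      have g6 := h6 j hj
      have g7 := h7 j hj
      have c6 : k + k + i = s.nat 5 j + s.nat 5 j + s.nat 6 j ↔ s.nat 5 j = k ∧ s.nat 6 j = i := by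
        omega
      have c7 : k + k + i = s.nat 5 j + s.nat 5 j + s.nat 7 j ↔ s.nat 5 j = k ∧ s.nat 7 j = i := by
        omega
      unfold partSum at *
      rw [Finset.sum_range_succ, Finset.sum_range_succ, Finset.sum_range_succ, ← i1, ← i2, ← i3]
      simp [hv, f5, f6, f7, q2, q3, c6, c7]
      refine ⟨?_, ?_, ?_⟩
      all_goals split_ifs with hc
      all_goals first
        | rw [← c7.2 hc]
        | rw [← c6.2 hc]
        | simp
  rw [hr]
  simpa only [e0] using key

theorem nextPositions_spec (s : Memory) : ∀ k < s.nat 0 0,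
    (nextPositions.run s).nat 13 k = nextPos (s.nat 0 0) k := by
  refine run_count (fun i s' => ∀ k < i, s'.nat 13 k = nextPos (s.nat 0 0) k) (by simp) ?_
  intro i s' hi hv hf hfr hI k hk
  have f0 := hf 0 (by decide) (by decide)
  simp only [run_ite]
  rcases Nat.lt_succ_iff_lt_or_eq.1 hk with hk | rfl
  · rw [← hI k hk]
    split_ifs with h1 <;> simp [hv, hk.ne]
  · unfold nextPos
    split_ifs with h1 h2 h2 <;> simp [hv, f0] at h1 ⊢ <;> omega

/-- The position after `k` values its best half of the next edge class at least as much as its best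
half of edge class `k`. -/
def Prefers (s : Memory) (k : ℕ) : Prop :=
  ∀ i ≤ 1, ∃ j ≤ 1, s.real 6 (k + k + i) ≤ s.real 5 (s.nat 13 k + s.nat 13 k + j)

/-- The loop finds a start if there is one, and leaves the start at position `0` otherwise. -/
theorem findStart_spec (s : Memory) (h12 : s.nat 12 0 = 0) (h24 : s.nat 24 0 = 0) :
    ((findStart.run s).nat 24 0 = 0 ∧ (findStart.run s).nat 12 0 = 0 ∧
      ∀ k < s.nat 0 0, ¬ Prefers s k) ∨
    ((findStart.run s).nat 24 0 = 1 ∧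
      ∃ k < s.nat 0 0, (findStart.run s).nat 12 0 = s.nat 13 k ∧ Prefers s k) := by
  have hP : ∀ k, Prefers s k ↔ ((s.real 6 (k + k) ≤ s.real 5 (s.nat 13 k + s.nat 13 k) ∨
      s.real 6 (k + k) ≤ s.real 5 (s.nat 13 k + s.nat 13 k + 1)) ∧
      (s.real 6 (k + k + 1) ≤ s.real 5 (s.nat 13 k + s.nat 13 k) ∨
      s.real 6 (k + k + 1) ≤ s.real 5 (s.nat 13 k + s.nat 13 k + 1))) := by
    intro k
    have : ∀ P : ℕ → Prop, (∀ i ≤ 1, P i) ↔ P 0 ∧ P 1 := fun P =>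
      ⟨fun h => ⟨h 0 (by omega), h 1 le_rfl⟩, fun h i hi => by
        obtain rfl | rfl : i = 0 ∨ i = 1 := by omega
        exacts [h.1, h.2]⟩
    have h' : ∀ P : ℕ → Prop, (∃ i ≤ 1, P i) ↔ P 0 ∨ P 1 := fun P =>
      ⟨fun ⟨i, hi, h⟩ => by
        obtain rfl | rfl : i = 0 ∨ i = 1 := by omega
        exacts [Or.inl h, Or.inr h], fun h => h.elim (fun h => ⟨0, by omega, h⟩)
          fun h => ⟨1, le_rfl, h⟩⟩
    unfold Prefers
    rw [this, h', h']
    rfl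
  refine run_count (fun i s' => (s'.nat 24 0 = 0 ∧ s'.nat 12 0 = 0 ∧ ∀ k < i, ¬ Prefers s k) ∨
    (s'.nat 24 0 = 1 ∧ ∃ k < s.nat 0 0, s'.nat 12 0 = s.nat 13 k ∧ Prefers s k))
    (by simp [h12, h24]) ?_
  intro i s' hi hv hf hfr hI
  have f13 := hf 13 (by decide) (by decide)
  have r5 := hfr 5 (by decide)
  have r6 := hfr 6 (by decide)
  simp only [run_ite]
  split_ifs with hc
  · simp [hv, f13, r5, r6] at hc ⊢
    exact ⟨i, hi, rfl, (hP i).2 hc⟩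
  · simp [hv, f13, r5, r6] at hc ⊢
    rcases hI with ⟨i1, i2, i3⟩ | hI
    · left
      refine ⟨i1, i2, fun k hk => ?_⟩
      rcases Nat.le_iff_lt_or_eq.1 hk with hk | rfl
      · exact i3 k hk
      · rw [hP]
        rintro ⟨h1, h2⟩
        obtain ⟨h3, h4⟩ := hc h1
        rcases h2 with h2 | h2 <;> linarith
    · right; exact hI

/-- The position of an edge class relative to the start `st`. -/
def relPos (n st e : ℕ) : ℕ := if st ≤ e then e - st else e + n - st

/-- The renumbering is in place; it is correct because it treats every item once. -/
theorem reindex_spec (s : Memory) : ∀ g < s.nat 0 1,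
    (reindex.run s).nat 5 g = relPos (s.nat 0 0) (s.nat 12 0) (s.nat 5 g) := by
  have key : (∀ g < s.nat 0 1,
      (reindex.run s).nat 5 g = relPos (s.nat 0 0) (s.nat 12 0) (s.nat 5 g)) ∧
      ∀ g, s.nat 0 1 ≤ g → (reindex.run s).nat 5 g = s.nat 5 g := by
    refine run_count (fun i s' =>
      (∀ g < i, s'.nat 5 g = relPos (s.nat 0 0) (s.nat 12 0) (s.nat 5 g)) ∧
      ∀ g, i ≤ g → s'.nat 5 g = s.nat 5 g) (by simp) ?_
    intro i s' hi hv hf hfr ⟨h1, h2⟩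
    have f0 := hf 0 (by decide) (by decide)
    have f12 := hf 12 (by decide) (by decide)
    have hi2 := h2 i le_rfl
    simp only [run_ite]
    constructor
    · intro g hg
      rcases Nat.lt_succ_iff_lt_or_eq.1 hg with hg | rfl
      · split_ifs <;> simpa [hv, hg.ne] using h1 g hg
      · unfold relPos
        split_ifs with c1 c2 c2 <;> simp [hv, f0, f12, hi2] at c1 ⊢ <;> omega
    · intro g hg
      have : g ≠ i := by omega
      split_ifs <;> simpa [hv, this] using h2 g (by omega)
  exact key.1

/-- Item `g` lies in part `A` of its edge class, by the assignment in the memory. -/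
def InA (s : Memory) (g : ℕ) : Prop :=
  (s.nat 23 (s.nat 5 g) = 0 ∧ s.nat 7 g = s.nat 20 (s.nat 5 g)) ∨
  (s.nat 23 (s.nat 5 g) ≠ 0 ∧ s.nat 6 g = s.nat 20 (s.nat 5 g))

instance (s : Memory) : DecidablePred (InA s) := fun g => by unfold InA; infer_instance

theorem output_spec (s : Memory) : ∀ g < s.nat 0 1,
    (InA s g → (output.run s).nat 3 g = s.nat 4 (s.nat 12 0 + s.nat 21 (s.nat 5 g))) ∧
    (¬ InA s g → (output.run s).nat 3 g = s.nat 4 (s.nat 12 0 + s.nat 22 (s.nat 5 g))) := by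
  refine run_count (fun i s' => ∀ g < i,
    (InA s g → s'.nat 3 g = s.nat 4 (s.nat 12 0 + s.nat 21 (s.nat 5 g))) ∧
    (¬ InA s g → s'.nat 3 g = s.nat 4 (s.nat 12 0 + s.nat 22 (s.nat 5 g)))) (by simp) ?_
  intro i s' hi hv hf hfr hI g hg
  have f4 := hf 4 (by decide) (by decide)
  have f5 := hf 5 (by decide) (by decide)
  have f6 := hf 6 (by decide) (by decide)
  have f7 := hf 7 (by decide) (by decide)
  have f12 := hf 12 (by decide) (by decide)
  have f20 := hf 20 (by decide) (by decide)
  have f21 := hf 21 (by decide) (by decide)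
  have f22 := hf 22 (by decide) (by decide)
  have f23 := hf 23 (by decide) (by decide)
  simp only [run_ite]
  rcases Nat.lt_succ_iff_lt_or_eq.1 hg with hg | rfl
  · split_ifs <;> simpa [hv, hg.ne] using hI g hg
  · unfold InA
    split_ifs with hc
    · simp only [Test.holds_or, Test.holds_and, Test.holds_natEq, Test.holds_not, eval, hv, f5, f6,
        f7, f20, f23] at hc
      exact ⟨fun _ => by simp [hv, f4, f5, f12, f21], fun h => absurd hc h⟩
    · simp only [Test.holds_or, Test.holds_and, Test.holds_natEq, Test.holds_not, eval, hv, f5, f6,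
        f7, f20, f23] at hc
      exact ⟨fun h => absurd h hc, fun _ => by simp [hv, f4, f5, f12, f22]⟩

/-! ### The scans -/

/-- The index of the half of edge class `k` that the scan chooses. -/
def idxP (s : Memory) (k : ℕ) : ℕ := k + k + s.nat 15 k

/-- The index of the other half of edge class `k`. -/
def idxQ (s : Memory) (k : ℕ) : ℕ := k + k + (1 - s.nat 15 k)

/-- The scan of the primary halves is correct at `k`: the choice, the chosen side and the shares. -/
def PrimaryAt (s : Memory) (k : ℕ) : Prop :=
  s.nat 15 k ≤ 1 ∧
  (s.nat 14 k = 1 ↔ ((k = 0 ∨ k + 1 = s.nat 0 0) ∨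
    (s.real 12 k ≤ s.real 5 (k + k) ∨ s.real 12 k ≤ s.real 5 (k + k + 1)))) ∧
  (s.nat 14 k = 1 → s.real 5 (idxQ s k) ≤ s.real 5 (idxP s k) ∧
    s.real 12 (k + 1) = s.real 6 (idxQ s k) ∧ s.real 13 k = s.real 5 (idxP s k)) ∧
  (s.nat 14 k ≠ 1 → s.real 6 (idxQ s k) ≤ s.real 6 (idxP s k) ∧
    s.real 12 (k + 1) = s.real 6 (idxP s k) ∧ s.real 13 k = s.real 5 (idxQ s k))

theorem scanPrimary_spec (s : Memory) (hn : 0 < s.nat 0 0) :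
    (∀ k < s.nat 0 0, PrimaryAt (scanPrimary.run s) k) ∧
    (scanPrimary.run s).real 12 0 = (scanPrimary.run s).real 12 (s.nat 0 0) := by
  set s₁ := scanPrimaryLoop.run s with hs₁
  have e0 : s₁.nat 0 = s.nat 0 := run_nat_of_notMem _ (by decide) _
  have hr : scanPrimary.run s = s₁.writeReal 12 0 (s₁.real 12 (s₁.nat 0 0)) := rfl
  have key : ∀ k < s.nat 0 0, PrimaryAt s₁ k := by
    refine run_count (fun i s' => ∀ k < i, PrimaryAt s' k) (by simp) ?_
    intro i s' hi hv hf hfr hI k hk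
    simp only [run_ite]
    rcases Nat.lt_succ_iff_lt_or_eq.1 hk with hk | rfl
    · have h1 : k ≠ i := hk.ne
      have h2 : k ≠ i + 1 := by omega
      have h3 := hI k hk
      unfold PrimaryAt idxP idxQ at *
      split_ifs with hc <;> simp only [run_block_cons, run_block_nil, chooseSide, run_ite] <;>
        split_ifs with hc2 <;> simpa [hv, h1, h2] using h3
    · unfold PrimaryAt idxP idxQ
      split_ifs with hc <;> simp only [run_block_cons, run_block_nil, chooseSide, run_ite] <;>
        split_ifs with hc2 <;> simp [primaryTest, hv] at hc hc2 ⊢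
      · exact ⟨hc, hc2⟩
      · exact ⟨hc, hc2.le⟩
      · exact ⟨hc, hc2⟩
      · exact ⟨hc, hc2.le⟩
  rw [hr]
  refine ⟨fun k hk => ?_, ?_⟩
  · have h := key k hk
    unfold PrimaryAt idxP idxQ at *
    rcases Nat.eq_zero_or_pos k with rfl | hpos
    · simpa using h
    · simpa [hpos.ne'] using h
  · simp [e0, hn.ne']

/-- The scan of the envied positions is correct at `k`. -/
def EnvyAt (s : Memory) (k : ℕ) : Prop :=
  s.nat 16 k = 1 ↔ k + 1 < s.nat 0 0 ∧ s.nat 14 k = 1 ∧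
    (s.real 6 (idxQ s k) + s.real 13 (k + 1) < s.real 6 (idxP s k) ∨
    ((s.real 12 (k + 1) < s.real 6 (idxP s k) ∧ s.real 5 (idxP s (k + 1)) < s.real 6 (idxP s k) ∧
      s.real 5 (idxQ s (k + 1)) < s.real 6 (idxP s k)) ∧ s.nat 16 (k + 1) = 1))

theorem scanEnvy_spec (s : Memory) : ∀ k < s.nat 0 0, EnvyAt (scanEnvy.run s) k := by
  have key : ∀ k < s.nat 0 0, s.nat 0 0 ≤ k + s.nat 0 0 → EnvyAt (scanEnvy.run s) k := by
    refine run_count (fun i s' => ∀ k < s.nat 0 0, s.nat 0 0 ≤ k + i → EnvyAt s' k) ?_ ?_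
    · intro k hk hk'; omega
    · intro i s' hi hv hf hfr hI k hk hki
      have f0 := hf 0 (by decide) (by decide)
      simp only [run_ite]
      by_cases hki' : s.nat 0 0 ≤ k + i
      · have h1 : k ≠ s.nat 0 0 - 1 - i := by omega
        have h2 : k + 1 ≠ s.nat 0 0 - 1 - i := by omega
        have h3 := hI k hk hki'
        unfold EnvyAt idxP idxQ at *
        split_ifs with hc <;> simpa [hv, f0, h1, h2] using h3
      · obtain rfl : k = s.nat 0 0 - 1 - i := by omega
        have h4 : 1 ≤ i ↔ s.nat 0 0 - 1 - i + 1 < s.nat 0 0 := by omega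
        unfold EnvyAt idxP idxQ
        split_ifs with hc
        · simp [hv, f0, h4] at hc ⊢
          exact hc
        · simp [hv, f0, h4] at hc ⊢
          exact hc
  exact fun k hk => key k hk (by omega)

/-- The scan of the shifted and the lonely positions is correct at `k`. -/
def ShiftAt (s : Memory) (k : ℕ) : Prop :=
  s.nat 17 k ≤ 1 ∧
  (s.nat 17 k = 1 ↔ s.nat 16 k = 1 ∧ (s.real 5 (idxP s k) ≤ s.real 5 (idxQ s k) + s.real 12 k ∨
    (1 ≤ k ∧ s.nat 17 (k - 1) = 1))) ∧
  (s.nat 18 k = 1 ↔ s.nat 16 k = 1 ∧ ¬ s.nat 17 k = 1)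

theorem scanShift_spec (s : Memory) : ∀ k < s.nat 0 0, ShiftAt (scanShift.run s) k := by
  refine run_count (fun i s' => ∀ k < i, ShiftAt s' k) (by simp) ?_
  intro i s' hi hv hf hfr hI k hk
  simp only [run_ite]
  rcases Nat.lt_succ_iff_lt_or_eq.1 hk with hk | rfl
  · have h1 : k ≠ i := hk.ne
    have h2 : k - 1 ≠ i := by omega
    have h3 := hI k hk
    unfold ShiftAt idxP idxQ at *
    split_ifs with hc hc2 <;> simpa [hv, h1, h2] using h3
  · have h2 : 1 ≤ k → k - 1 ≠ k := by omega
    unfold ShiftAt idxP idxQ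
    split_ifs with hc hc2 <;> simp [hv] at hc ⊢
    · simp [hv] at hc2
      refine ⟨hc, ?_⟩
      rcases hc2 with hc2 | hc2
      · exact Or.inl hc2
      · exact Or.inr ⟨hc2.1, fun _ => hc2.2⟩
    · simp [hv] at hc2
      refine ⟨fun _ => ⟨hc2.1, fun hk => ?_⟩, hc⟩
      rw [if_neg (h2 hk)]
      exact hc2.2 hk
    · exact ⟨fun h => absurd h hc, hc⟩

/-- The scan of the ends of chains is correct at `k`. -/
def EndAt (s : Memory) (k : ℕ) : Prop :=
  (s.nat 18 (k + 1) = 1 → s.nat 19 k = s.nat 19 (k + 1)) ∧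
  (s.nat 18 (k + 1) ≠ 1 → s.nat 19 k = k + 1)

theorem scanEnd_spec (s : Memory) : ∀ k < s.nat 0 0, EndAt (scanEnd.run s) k := by
  have key : ∀ k < s.nat 0 0, s.nat 0 0 ≤ k + s.nat 0 0 → EndAt (scanEnd.run s) k := by
    refine run_count (fun i s' => ∀ k < s.nat 0 0, s.nat 0 0 ≤ k + i → EndAt s' k) ?_ ?_
    · intro k hk hk'; omega
    · intro i s' hi hv hf hfr hI k hk hki
      have f0 := hf 0 (by decide) (by decide)
      simp only [run_ite]
      by_cases hki' : s.nat 0 0 ≤ k + i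
      · have h1 : k ≠ s.nat 0 0 - 1 - i := by omega
        have h2 : k + 1 ≠ s.nat 0 0 - 1 - i := by omega
        have h3 := hI k hk hki'
        unfold EndAt at *
        split_ifs with hc <;> simpa [hv, f0, h1, h2] using h3
      · obtain rfl : k = s.nat 0 0 - 1 - i := by omega
        unfold EndAt
        split_ifs with hc
        · simp [hv, f0] at hc ⊢
          exact fun h => absurd hc h
        · simp [hv, f0] at hc ⊢
          exact fun h => absurd h hc
  exact fun k hk => key k hk (by omega)

/-! ### The assignments -/

/-- An assignment evaluates its expressions in the memory at its start: they read only arrays below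
`20`, which it does not write to. -/
theorem assign_run (s : Memory) (c sA oA oB : NatExpr) {k : ℕ} (hk : s.nat 10 0 = k)
    (hsA : ∀ s' : Memory, (∀ a, a < 20 → s'.nat a = s.nat a) → sA.eval s' = sA.eval s)
    (hoA : ∀ s' : Memory, (∀ a, a < 20 → s'.nat a = s.nat a) → oA.eval s' = oA.eval s)
    (hoB : ∀ s' : Memory, (∀ a, a < 20 → s'.nat a = s.nat a) → oB.eval s' = oB.eval s) :
    (assign c sA oA oB).run s = (((s.writeNat 23 k (c.eval s)).writeNat 20 k (sA.eval s)).writeNat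
      21 k (oA.eval s)).writeNat 22 k (oB.eval s) := by
  have key : ∀ (s : Memory) a i x, 20 ≤ a → ∀ b, b < 20 → (s.writeNat a i x).nat b = s.nat b :=
    fun s a i x ha b hb => Memory.writeNat_nat_of_ne s (by omega) i x
  have h1 := key s 23 k (c.eval s) (by omega)
  have h2 : ∀ b, b < 20 →
      ((s.writeNat 23 k (c.eval s)).writeNat 20 k (sA.eval s)).nat b = s.nat b :=
    fun b hb => (key _ 20 k (sA.eval s) (by omega) b hb).trans (h1 b hb)
  have h3 : ∀ b, b < 20 → (((s.writeNat 23 k (c.eval s)).writeNat 20 k (sA.eval s)).writeNat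
      21 k (oA.eval s)).nat b = s.nat b :=
    fun b hb => (key _ 21 k (oA.eval s) (by omega) b hb).trans (h2 b hb)
  simp only [assign, run_block_cons, run_block_nil, run_setNat]
  have e : ∀ s' : Memory, s'.nat 10 = s.nat 10 → kk.eval s' = k := fun s' h => by simp [h, hk]
  rw [e s rfl, e _ (h1 10 (by omega)), hsA _ h1, e _ (h2 10 (by omega)), hoA _ h2,
    e _ (h3 10 (by omega)), hoB _ h3]

/-- The rule for a loop that makes one assignment per edge class. -/
theorem run_assign_loop {B : Cmd} (s : Memory) (P : ℕ → ℕ → ℕ → ℕ → ℕ → Prop)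
    (hw : ∀ a ∈ B.natWrites, 20 ≤ a) (hr : B.realWrites = [])
    (hB : ∀ k s', k < s.nat 0 0 → s'.nat 10 0 = k →
      (∀ a, a ≠ 10 → a < 20 → s'.nat a = s.nat a) → s'.real = s.real →
      ∃ c x y z, P k c x y z ∧ B.run s' =
        (((s'.writeNat 23 k c).writeNat 20 k x).writeNat 21 k y).writeNat 22 k z) :
    ∀ k < s.nat 0 0, P k (((count 10 0 B).run s).nat 23 k) (((count 10 0 B).run s).nat 20 k)
      (((count 10 0 B).run s).nat 21 k) (((count 10 0 B).run s).nat 22 k) := by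
  refine run_count (fun i s' => ∀ k < i, P k (s'.nat 23 k) (s'.nat 20 k) (s'.nat 21 k)
    (s'.nat 22 k)) (by simp) ?_
  intro i s' hi hv hf hfr hI k hk
  obtain ⟨c, x, y, z, h1, h2⟩ := hB i s' hi hv
    (fun a ha ha' => hf a ha (fun h => absurd (hw a h) (by omega)))
    (funext fun a => hfr a (by simp [hr]))
  rw [h2]
  rcases Nat.lt_succ_iff_lt_or_eq.1 hk with hk | rfl
  · simpa [hk.ne] using hI k hk
  · simpa using h1

/-- The effect of `assignWorse`, where `i` is the side that becomes part `A`. -/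
theorem assignWorse_run (s : Memory) (A : ℕ) (c oA oB : NatExpr) {k : ℕ} (hk : s.nat 10 0 = k)
    (hoA : ∀ s' : Memory, (∀ a, a < 20 → s'.nat a = s.nat a) → oA.eval s' = oA.eval s)
    (hoB : ∀ s' : Memory, (∀ a, a < 20 → s'.nat a = s.nat a) → oB.eval s' = oB.eval s) :
    ∃ i ≤ 1, s.real A (k + k + i) ≤ s.real A (k + k + (1 - i)) ∧
      (assignWorse A c oA oB).run s = (((s.writeNat 23 k (c.eval s)).writeNat 20 k i).writeNat
        21 k (oA.eval s)).writeNat 22 k (oB.eval s) := by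
  unfold assignWorse
  rw [run_ite]
  split_ifs with h
  · refine ⟨0, by omega, by simpa [hk] using h, ?_⟩
    rw [assign_run s _ _ _ _ hk (by simp) hoA hoB]; simp
  · refine ⟨1, by omega, by simp [hk] at h; simpa using h.le, ?_⟩
    rw [assign_run s _ _ _ _ hk (by simp) hoA hoB]; simp

theorem assignPrev_spec (s : Memory) : ∀ k < s.nat 0 0,
    (assignPrev.run s).nat 23 k = 0 ∧ (assignPrev.run s).nat 20 k ≤ 1 ∧
    s.real 6 (k + k + (assignPrev.run s).nat 20 k) ≤
      s.real 6 (k + k + (1 - (assignPrev.run s).nat 20 k)) ∧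
    (assignPrev.run s).nat 21 k = k ∧ (assignPrev.run s).nat 22 k = s.nat 13 k := by
  refine run_assign_loop s (fun k c x y z => c = 0 ∧ x ≤ 1 ∧
    s.real 6 (k + k + x) ≤ s.real 6 (k + k + (1 - x)) ∧ y = k ∧ z = s.nat 13 k)
    (by decide) (by decide) ?_
  intro k s' hk hv hf hfr
  have f13 := hf 13 (by decide) (by decide)
  obtain ⟨i, hi, h1, h2⟩ := assignWorse_run s' 6 (.lit 0) kk (.read 13 kk) hv
    (fun s'' h => by simp [h 10]) (fun s'' h => by simp [h 10, h 13])
  refine ⟨_, _, _, _, ⟨by simp, hi, by simpa [hfr] using h1, by simp [hv], ?_⟩, h2⟩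
  simp [hv, f13]

theorem assignMain_spec (s : Memory) : ∀ k < s.nat 0 0,
    (assignMain.run s).nat 23 k = 0 ∧
    (s.nat 14 k = 1 ∧ s.nat 17 k = 0 → (assignMain.run s).nat 20 k = s.nat 15 k) ∧
    (¬ (s.nat 14 k = 1 ∧ s.nat 17 k = 0) → (assignMain.run s).nat 20 k = 1 - s.nat 15 k) ∧
    (assignMain.run s).nat 21 k = k ∧
    (s.nat 18 (s.nat 13 k) = 1 → (assignMain.run s).nat 22 k = s.nat 19 (s.nat 13 k)) ∧
    (s.nat 18 (s.nat 13 k) ≠ 1 → (assignMain.run s).nat 22 k = s.nat 13 k) := by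
  refine run_assign_loop s (fun k c x y z => c = 0 ∧
    (s.nat 14 k = 1 ∧ s.nat 17 k = 0 → x = s.nat 15 k) ∧
    (¬ (s.nat 14 k = 1 ∧ s.nat 17 k = 0) → x = 1 - s.nat 15 k) ∧ y = k ∧
    (s.nat 18 (s.nat 13 k) = 1 → z = s.nat 19 (s.nat 13 k)) ∧
    (s.nat 18 (s.nat 13 k) ≠ 1 → z = s.nat 13 k))
    (by decide) (by decide) ?_
  intro k s' hk hv hf hfr
  have f13 := hf 13 (by decide) (by decide)
  have f14 := hf 14 (by decide) (by decide)
  have f15 := hf 15 (by decide) (by decide)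
  have f17 := hf 17 (by decide) (by decide)
  have f18 := hf 18 (by decide) (by decide)
  have f19 := hf 19 (by decide) (by decide)
  simp only [run_ite]
  split_ifs with h1 h2 h2
  all_goals
    rw [assign_run s' _ _ _ _ hv (fun s'' h => by simp [h 10, h 15])
      (fun s'' h => by simp [h 10]) (fun s'' h => by simp [h 10, h 13, h 19])]
    refine ⟨_, _, _, _, ?_, rfl⟩
    simp [hv, f13, f14, f15, f17, f18, f19] at h1 h2 ⊢
    simp [h1, h2]
  all_goals exact fun h h' => absurd h' (h1 h)

theorem assignRotateAll_spec (s : Memory) : ∀ k < s.nat 0 0,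
    (k = 0 → (assignRotateAll.run s).nat 23 k = 1 ∧ (assignRotateAll.run s).nat 20 k ≤ 1 ∧
      s.real 7 (k + k + (assignRotateAll.run s).nat 20 k) ≤
        s.real 7 (k + k + (1 - (assignRotateAll.run s).nat 20 k))) ∧
    (k ≠ 0 → (assignRotateAll.run s).nat 23 k = 0) ∧
    (k ≠ 0 → k + 1 ≠ s.nat 0 0 ∨ k = 1 → (assignRotateAll.run s).nat 20 k = 1 - s.nat 15 k) ∧
    (k ≠ 0 → k ≠ 1 → k + 1 = s.nat 0 0 → (assignRotateAll.run s).nat 20 k ≤ 1 ∧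
      s.real 6 (k + k + (assignRotateAll.run s).nat 20 k) ≤
        s.real 6 (k + k + (1 - (assignRotateAll.run s).nat 20 k))) ∧
    (k ≠ 1 → (assignRotateAll.run s).nat 21 k = k) ∧
    (k = 1 → (assignRotateAll.run s).nat 21 k = 0) ∧
    (k = 0 → (assignRotateAll.run s).nat 22 k = 1) ∧
    (k ≠ 0 → (assignRotateAll.run s).nat 22 k = s.nat 13 k) := by
  refine run_assign_loop s (fun k c x y z =>
    (k = 0 → c = 1 ∧ x ≤ 1 ∧ s.real 7 (k + k + x) ≤ s.real 7 (k + k + (1 - x))) ∧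
    (k ≠ 0 → c = 0) ∧
    (k ≠ 0 → k + 1 ≠ s.nat 0 0 ∨ k = 1 → x = 1 - s.nat 15 k) ∧
    (k ≠ 0 → k ≠ 1 → k + 1 = s.nat 0 0 → x ≤ 1 ∧
      s.real 6 (k + k + x) ≤ s.real 6 (k + k + (1 - x))) ∧
    (k ≠ 1 → y = k) ∧ (k = 1 → y = 0) ∧ (k = 0 → z = 1) ∧ (k ≠ 0 → z = s.nat 13 k))
    (by decide) (by decide) ?_
  intro k s' hk hv hf hfr
  have f0 := hf 0 (by decide) (by decide)
  have f13 := hf 13 (by decide) (by decide)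
  have f15 := hf 15 (by decide) (by decide)
  simp only [run_ite]
  split_ifs with h1 h2 h3
  · obtain ⟨i, hi, g1, g2⟩ := assignWorse_run s' 7 (.lit 1) (.lit 0) (.lit 1) hv (by simp) (by simp)
    refine ⟨_, _, _, _, ?_, g2⟩
    simp [hv] at h1
    subst h1
    simpa [hi, hfr] using g1
  · rw [assign_run s' _ _ _ _ hv (fun s'' h => by simp [h 10, h 15])
      (fun s'' h => by simp) (fun s'' h => by simp [h 10, h 13])]
    refine ⟨_, _, _, _, ?_, rfl⟩
    simp [hv] at h1 h2
    simp [hv, f15, f13, h2]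
  · obtain ⟨i, hi, g1, g2⟩ := assignWorse_run s' 6 (.lit 0) kk (.read 13 kk) hv
      (fun s'' h => by simp [h 10]) (fun s'' h => by simp [h 10, h 13])
    refine ⟨_, _, _, _, ?_, g2⟩
    simp [hv, f0] at h1 h2 h3
    rw [hfr] at g1
    simp [hv, f13, h1, h2, h3, hi, g1]
  · rw [assign_run s' _ _ _ _ hv (fun s'' h => by simp [h 10, h 15])
      (fun s'' h => by simp [h 10]) (fun s'' h => by simp [h 10, h 13])]
    refine ⟨_, _, _, _, ?_, rfl⟩
    simp [hv, f0] at h1 h2 h3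
    simp [hv, f15, f13, h1, h2, h3]

theorem assignRotateLast_spec (s : Memory) : ∀ k < s.nat 0 0,
    (k + 2 = s.nat 0 0 → (assignRotateLast.run s).nat 23 k = 1 ∧
      (assignRotateLast.run s).nat 20 k ≤ 1 ∧
      s.real 7 (k + k + (assignRotateLast.run s).nat 20 k) ≤
        s.real 7 (k + k + (1 - (assignRotateLast.run s).nat 20 k))) ∧
    (k + 2 ≠ s.nat 0 0 → (assignRotateLast.run s).nat 23 k = 0) ∧
    (k + 2 ≠ s.nat 0 0 → ¬ (s.nat 0 0 = 3 ∧ k = 0) →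
      (assignRotateLast.run s).nat 20 k = s.nat 15 k) ∧
    (s.nat 0 0 = 3 ∧ k = 0 → (assignRotateLast.run s).nat 20 k ≤ 1 ∧
      s.real 6 (k + k + (assignRotateLast.run s).nat 20 k) ≤
        s.real 6 (k + k + (1 - (assignRotateLast.run s).nat 20 k))) ∧
    (k + 1 ≠ s.nat 0 0 → (assignRotateLast.run s).nat 21 k = k) ∧
    (k + 1 = s.nat 0 0 → (assignRotateLast.run s).nat 21 k = 0) ∧
    (k + 2 ≠ s.nat 0 0 → (assignRotateLast.run s).nat 22 k = s.nat 0 0 - 2) ∧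
    (k + 2 = s.nat 0 0 → (assignRotateLast.run s).nat 22 k = s.nat 0 0 - 1) := by
  refine run_assign_loop s (fun k c x y z =>
    (k + 2 = s.nat 0 0 → c = 1 ∧ x ≤ 1 ∧ s.real 7 (k + k + x) ≤ s.real 7 (k + k + (1 - x))) ∧
    (k + 2 ≠ s.nat 0 0 → c = 0) ∧
    (k + 2 ≠ s.nat 0 0 → ¬ (s.nat 0 0 = 3 ∧ k = 0) → x = s.nat 15 k) ∧
    (s.nat 0 0 = 3 ∧ k = 0 → x ≤ 1 ∧ s.real 6 (k + k + x) ≤ s.real 6 (k + k + (1 - x))) ∧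
    (k + 1 ≠ s.nat 0 0 → y = k) ∧ (k + 1 = s.nat 0 0 → y = 0) ∧
    (k + 2 ≠ s.nat 0 0 → z = s.nat 0 0 - 2) ∧ (k + 2 = s.nat 0 0 → z = s.nat 0 0 - 1))
    (by decide) (by decide) ?_
  intro k s' hk hv hf hfr
  have f0 := hf 0 (by decide) (by decide)
  have f15 := hf 15 (by decide) (by decide)
  simp only [run_ite]
  split_ifs with h1 h2 h3
  · rw [assign_run s' _ _ _ _ hv (fun s'' h => by simp [h 10, h 15])
      (fun s'' h => by simp) (fun s'' h => by simp [h 0])]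
    refine ⟨_, _, _, _, ?_, rfl⟩
    simp [hv, f0] at h1
    have h4 : k + 2 ≠ s.nat 0 0 := by omega
    have h5 : ¬ (s.nat 0 0 = 3 ∧ k = 0) := by omega
    simp [hv, f0, f15, h1, h4]
    omega
  · obtain ⟨i, hi, g1, g2⟩ := assignWorse_run s' 7 (.lit 1) kk (.sub nn (.lit 1)) hv
      (fun s'' h => by simp [h 10]) (fun s'' h => by simp [h 0])
    refine ⟨_, _, _, _, ?_, g2⟩
    simp [hv, f0] at h1 h2
    rw [hfr] at g1
    have h5 : ¬ (s.nat 0 0 = 3 ∧ k = 0) := by omega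
    simp [hv, f0, h1, h2, hi, g1]
    omega
  · obtain ⟨i, hi, g1, g2⟩ := assignWorse_run s' 6 (.lit 0) kk (.sub nn (.lit 2)) hv
      (fun s'' h => by simp [h 10]) (fun s'' h => by simp [h 0])
    refine ⟨_, _, _, _, ?_, g2⟩
    simp [hv, f0] at h1 h2 h3
    rw [hfr] at g1
    rw [h3.2] at g1
    simpa [hv, f0, h3, hi] using g1
  · rw [assign_run s' _ _ _ _ hv (fun s'' h => by simp [h 10, h 15])
      (fun s'' h => by simp [h 10]) (fun s'' h => by simp [h 0])]
    refine ⟨_, _, _, _, ?_, rfl⟩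
    simp [hv, f0] at h1 h2 h3
    simp [hv, f0, f15, h1, h2]
    exact fun h h' => absurd h' (h3 h)

/-! ### The allocation found by the program -/

/-- The split of the edge classes that the assignment in the memory describes. -/
noncomputable def splitOf (s : Memory) : Split where
  lA k := ∑ g ∈ Finset.range (s.nat 0 1), if s.nat 5 g = k ∧ InA s g then s.real 2 g else 0
  lB k := ∑ g ∈ Finset.range (s.nat 0 1), if s.nat 5 g = k ∧ ¬ InA s g then s.real 2 g else 0
  rA k := ∑ g ∈ Finset.range (s.nat 0 1), if s.nat 5 g = k ∧ InA s g then s.real 3 g else 0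
  rB k := ∑ g ∈ Finset.range (s.nat 0 1), if s.nat 5 g = k ∧ ¬ InA s g then s.real 3 g else 0
  oA := s.nat 21
  oB := s.nat 22
  efxL k := ∀ g < s.nat 0 1, s.nat 5 g = k → ¬ InA s g →
    (∑ g ∈ Finset.range (s.nat 0 1), if s.nat 5 g = k ∧ ¬ InA s g then s.real 2 g else 0) -
      s.real 2 g ≤
    ∑ g ∈ Finset.range (s.nat 0 1), if s.nat 5 g = k ∧ InA s g then s.real 2 g else 0
  efxR k := ∀ g < s.nat 0 1, s.nat 5 g = k → InA s g →
    (∑ g ∈ Finset.range (s.nat 0 1), if s.nat 5 g = k ∧ InA s g then s.real 3 g else 0) -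
      s.real 3 g ≤
    ∑ g ∈ Finset.range (s.nat 0 1), if s.nat 5 g = k ∧ ¬ InA s g then s.real 3 g else 0

/-- The tables on which the allocation is based are complete. -/
structure Ready (s : Memory) : Prop where
  three : 3 ≤ s.nat 0 0
  isCut : IsCut (s.nat 0 1) (s.nat 0 0) (s.nat 5) (s.nat 6) (s.nat 7) (s.real 2) (s.real 3)
  left : ∀ k < s.nat 0 0, ∀ i ≤ 1,
    s.real 5 (k + k + i) = partSum (s.nat 0 1) (s.nat 5) (s.nat 7) (s.real 2) k i
  right : ∀ k < s.nat 0 0, ∀ i ≤ 1,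
    s.real 6 (k + k + i) = partSum (s.nat 0 1) (s.nat 5) (s.nat 7) (s.real 3) k i
  first : ∀ k < s.nat 0 0, ∀ i ≤ 1,
    s.real 7 (k + k + i) = partSum (s.nat 0 1) (s.nat 5) (s.nat 6) (s.real 3) k i
  next : ∀ k < s.nat 0 0, s.nat 13 k = nextPos (s.nat 0 0) k

/-- Completeness depends only on the tables that it mentions. -/
theorem Ready.of_eq {s s' : Memory} (h : Ready s) (h0 : s'.nat 0 = s.nat 0)
    (h5 : s'.nat 5 = s.nat 5) (h6 : s'.nat 6 = s.nat 6) (h7 : s'.nat 7 = s.nat 7)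
    (h13 : s'.nat 13 = s.nat 13) (r2 : s'.real 2 = s.real 2) (r3 : s'.real 3 = s.real 3)
    (r5 : s'.real 5 = s.real 5) (r6 : s'.real 6 = s.real 6) (r7 : s'.real 7 = s.real 7) :
    Ready s' := by
  obtain ⟨a1, a2, a3, a4, a5, a6⟩ := h
  constructor <;> simp only [h0, h5, h6, h7, h13, r2, r3, r5, r6, r7] <;> assumption

section Sums

variable {m n : ℕ} {e σB σD : ℕ → ℕ} {a b : ℕ → ℝ}

theorem partSum_nonneg {σ : ℕ → ℕ} {w : ℕ → ℝ} (hw : ∀ g < m, 0 ≤ w g) (k i : ℕ) :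
    0 ≤ partSum m e σ w k i := by
  refine Finset.sum_nonneg fun g hg => ?_
  split_ifs
  · exact hw g (Finset.mem_range.1 hg)
  · exact le_rfl

/-- The two parts together make up the class. -/
theorem partSum_add {σ : ℕ → ℕ} {w : ℕ → ℝ} (hσ : ∀ g < m, σ g ≤ 1) (k : ℕ) {i : ℕ} (hi : i ≤ 1) :
    partSum m e σ w k i + partSum m e σ w k (1 - i) =
      ∑ g ∈ Finset.range m, if e g = k then w g else 0 := by
  unfold partSum
  rw [← Finset.sum_add_distrib]
  refine Finset.sum_congr rfl fun g hg => ?_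
  have h1 := hσ g (Finset.mem_range.1 hg)
  by_cases hk : e g = k
  · rcases (by omega : (σ g = i ∧ σ g ≠ 1 - i) ∨ (σ g ≠ i ∧ σ g = 1 - i)) with ⟨h, h'⟩ | ⟨h, h'⟩
    · rw [if_pos ⟨hk, h⟩, if_neg (fun hc => h' hc.2), if_pos hk, add_zero]
    · rw [if_neg (fun hc => h hc.2), if_pos ⟨hk, h'⟩, if_pos hk, zero_add]
  · simp [hk]

/-- The signed difference is the excess of a part over the other one. -/
theorem signedSum_eq {σ : ℕ → ℕ} {w : ℕ → ℝ} (hσ : ∀ g < m, σ g ≤ 1) (k : ℕ) {i : ℕ} (hi : i ≤ 1) :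
    sgn i * signedSum m e σ w k = partSum m e σ w k i - partSum m e σ w k (1 - i) := by
  unfold partSum signedSum
  rw [← Finset.sum_sub_distrib, Finset.mul_sum]
  refine Finset.sum_congr rfl fun g hg => ?_
  have h1 := hσ g (Finset.mem_range.1 hg)
  have h2 : (i = 0 ∨ i = 1) ∧ (σ g = 0 ∨ σ g = 1) := by omega
  by_cases hk : e g = k
  · obtain ⟨rfl | rfl, h | h⟩ := h2 <;> simp [hk, h, sgn]
  · simp [hk]

/-- Re-balancing for the second endpoint does not increase its value of the better part. -/
theorem IsCut.le_first (h : IsCut m n e σB σD a b) {k : ℕ} (hk : k < n) {i j : ℕ} (hi : i ≤ 1)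
    (hj : j ≤ 1) (hle : partSum m e σB b k i ≤ partSum m e σB b k (1 - i)) :
    partSum m e σD b k j ≤ partSum m e σB b k (1 - i) := by
  have h1 := h.bound k hk
  have h2 := signedSum_eq (e := e) (w := b) h.sideB k hi
  have h3 := signedSum_eq (e := e) (w := b) h.sideD k hj
  have h4 := partSum_add (e := e) (w := b) h.sideB k hi
  have h5 := partSum_add (e := e) (w := b) h.sideD k hj
  have habs : ∀ i x, |sgn i * x| = |x| := by
    intro i x; rcases sgn_eq_or i with h | h <;> simp [h]
  rw [← habs i (signedSum m e σB b k), ← habs j (signedSum m e σD b k), h2, h3,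
    abs_of_nonpos (a := partSum m e σB b k i - _) (by linarith), abs_le] at h1
  linarith [h1.2]

end Sums

/-- An edge class marked `0` in array `23` is split by its final split, which is EFX for the right
endpoint. -/
theorem Ready.splitOf_final {s : Memory} (h : Ready s) {k i : ℕ} (hk : k < s.nat 0 0) (hi : i ≤ 1)
    (h23 : s.nat 23 k = 0) (h20 : s.nat 20 k = i) :
    (splitOf s).lA k = s.real 5 (k + k + i) ∧ (splitOf s).lB k = s.real 5 (k + k + (1 - i)) ∧
    (splitOf s).rA k = s.real 6 (k + k + i) ∧ (splitOf s).rB k = s.real 6 (k + k + (1 - i)) ∧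
    (splitOf s).efxR k := by
  have hA : ∀ g < s.nat 0 1, (s.nat 5 g = k ∧ InA s g ↔ s.nat 5 g = k ∧ s.nat 7 g = i) := by
    intro g hg
    refine and_congr_right fun he => ?_
    unfold InA; rw [he, h23, h20]; simp
  have hB : ∀ g < s.nat 0 1, (s.nat 5 g = k ∧ ¬ InA s g ↔ s.nat 5 g = k ∧ s.nat 7 g = 1 - i) := by
    intro g hg
    refine and_congr_right fun he => ?_
    have := h.isCut.sideD g hg
    unfold InA; rw [he, h23, h20]; simp; omega
  have eA : ∀ w : ℕ → ℝ, (∑ g ∈ Finset.range (s.nat 0 1),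
      if s.nat 5 g = k ∧ InA s g then w g else 0) =
      partSum (s.nat 0 1) (s.nat 5) (s.nat 7) w k i := by
    intro w
    refine Finset.sum_congr rfl fun g hg => ?_
    rw [Finset.mem_range] at hg
    exact if_congr (hA g hg) rfl rfl
  have eB : ∀ w : ℕ → ℝ, (∑ g ∈ Finset.range (s.nat 0 1),
      if s.nat 5 g = k ∧ ¬ InA s g then w g else 0) =
      partSum (s.nat 0 1) (s.nat 5) (s.nat 7) w k (1 - i) := by
    intro w
    refine Finset.sum_congr rfl fun g hg => ?_
    rw [Finset.mem_range] at hg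
    exact if_congr (hB g hg) rfl rfl
  rw [h.left k hk i hi, h.left k hk _ (by omega), h.right k hk i hi, h.right k hk _ (by omega)]
  refine ⟨?_, ?_, ?_, ?_, ?_⟩
  · exact eA _
  · exact eB _
  · exact eA _
  · exact eB _
  · intro g hg he hgA
    have h1 := ((hA g hg).1 ⟨he, hgA⟩).2
    have h2 := h.isCut.efxD g hg
    rw [he, h1, signedSum_eq h.isCut.sideD k hi] at h2
    rw [eA, eB]
    linarith

/-- An edge class not marked `0` in array `23` is split by its first split, which is EFX for the
left endpoint. -/
theorem Ready.splitOf_first {s : Memory} (h : Ready s) {k i : ℕ} (hk : k < s.nat 0 0) (hi : i ≤ 1)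
    (h23 : s.nat 23 k ≠ 0) (h20 : s.nat 20 k = i) :
    (splitOf s).rA k = s.real 7 (k + k + i) ∧ (splitOf s).rB k = s.real 7 (k + k + (1 - i)) ∧
    0 ≤ (splitOf s).lA k ∧ 0 ≤ (splitOf s).lB k ∧ (splitOf s).efxL k := by
  have hA : ∀ g < s.nat 0 1, (s.nat 5 g = k ∧ InA s g ↔ s.nat 5 g = k ∧ s.nat 6 g = i) := by
    intro g hg
    refine and_congr_right fun he => ?_
    unfold InA; rw [he, h20]; simp [h23]
  have hB : ∀ g < s.nat 0 1, (s.nat 5 g = k ∧ ¬ InA s g ↔ s.nat 5 g = k ∧ s.nat 6 g = 1 - i) := by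
    intro g hg
    refine and_congr_right fun he => ?_
    have := h.isCut.sideB g hg
    unfold InA; rw [he, h20]; simp [h23]; omega
  have eA : ∀ w : ℕ → ℝ, (∑ g ∈ Finset.range (s.nat 0 1),
      if s.nat 5 g = k ∧ InA s g then w g else 0) =
      partSum (s.nat 0 1) (s.nat 5) (s.nat 6) w k i := by
    intro w
    refine Finset.sum_congr rfl fun g hg => ?_
    rw [Finset.mem_range] at hg
    exact if_congr (hA g hg) rfl rfl
  have eB : ∀ w : ℕ → ℝ, (∑ g ∈ Finset.range (s.nat 0 1),
      if s.nat 5 g = k ∧ ¬ InA s g then w g else 0) =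
      partSum (s.nat 0 1) (s.nat 5) (s.nat 6) w k (1 - i) := by
    intro w
    refine Finset.sum_congr rfl fun g hg => ?_
    rw [Finset.mem_range] at hg
    exact if_congr (hB g hg) rfl rfl
  rw [h.first k hk i hi, h.first k hk _ (by omega)]
  refine ⟨?_, ?_, ?_, ?_, ?_⟩
  · exact eA _
  · exact eB _
  · exact (partSum_nonneg h.isCut.left_nonneg k i).trans_eq (eA _).symm
  · exact (partSum_nonneg h.isCut.left_nonneg k (1 - i)).trans_eq (eB _).symm
  · intro g hg he hgA
    have h1 := ((hB g hg).1 ⟨he, hgA⟩).2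
    have h2 := h.isCut.efxB g hg
    rw [he, h1, signedSum_eq h.isCut.sideB k (by omega), (by omega : 1 - (1 - i) = i)] at h2
    rw [eA, eB]
    linarith

/-- All scans are done, from a start that prefers its next edge class. -/
structure Scanned (s : Memory) : Prop where
  ready : Ready s
  start : ∀ i ≤ 1, ∃ j ≤ 1,
    s.real 6 (s.nat 0 0 - 1 + (s.nat 0 0 - 1) + i) ≤ s.real 5 (0 + 0 + j)
  primary : ∀ k < s.nat 0 0, PrimaryAt s k
  primary_zero : s.real 12 0 = s.real 12 (s.nat 0 0)
  envy : ∀ k < s.nat 0 0, EnvyAt s k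
  shift : ∀ k < s.nat 0 0, ShiftAt s k
  endAt : ∀ k < s.nat 0 0, EndAt s k

/-- Every scan is correct when it is made, and the later scans do not touch its tables. -/
theorem scans_spec (s : Memory) (h : Ready s) (hs : Prefers s (s.nat 0 0 - 1)) :
    Scanned (scans.run s) := by
  have hn := h.three
  set s₁ := scanPrimary.run s with hs₁
  set s₂ := scanEnvy.run s₁ with hs₂
  set s₃ := scanShift.run s₂ with hs₃
  set s₄ := scanEnd.run s₃ with hs₄
  have hr : scans.run s = s₄ := rfl
  rw [hr]
  obtain ⟨p1, p2⟩ := scanPrimary_spec s (by omega)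
  have p3 := scanEnvy_spec s₁
  have p4 := scanShift_spec s₂
  have p5 := scanEnd_spec s₃
  rw [← hs₁] at p1 p2
  rw [← hs₂] at p3
  rw [← hs₃] at p4
  rw [← hs₄] at p5
  have k1 : ∀ a, a ∉ scanPrimary.natWrites → s₁.nat a = s.nat a := fun a ha =>
    run_nat_of_notMem _ ha _
  have k2 : ∀ a, a ∉ scanEnvy.natWrites → s₂.nat a = s₁.nat a := fun a ha =>
    run_nat_of_notMem _ ha _
  have k3 : ∀ a, a ∉ scanShift.natWrites → s₃.nat a = s₂.nat a := fun a ha =>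
    run_nat_of_notMem _ ha _
  have k4 : ∀ a, a ∉ scanEnd.natWrites → s₄.nat a = s₃.nat a := fun a ha =>
    run_nat_of_notMem _ ha _
  have r1 : ∀ a, a ∉ scanPrimary.realWrites → s₁.real a = s.real a := fun a ha =>
    run_real_of_notMem _ ha _
  have r2 : s₂.real = s₁.real := funext fun a =>
    run_real_of_notMem _ (by simp [scanEnvy, realWrites]) _
  have r3 : s₃.real = s₁.real := (funext fun a =>
    run_real_of_notMem _ (by simp [scanShift, block, realWrites]) _).trans r2
  have r4 : s₄.real = s₁.real := (funext fun a =>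
    run_real_of_notMem _ (by simp [scanEnd, realWrites]) _).trans r3
  have e : ∀ a, a ∉ scanPrimary.natWrites → a ∉ scanEnvy.natWrites → a ∉ scanShift.natWrites →
      a ∉ scanEnd.natWrites → s₄.nat a = s.nat a := fun a h1 h2 h3 h4 => by
    rw [k4 a h4, k3 a h3, k2 a h2, k1 a h1]
  have e0 : s₄.nat 0 = s.nat 0 := e 0 (by decide) (by decide) (by decide) (by decide)
  have e0' : s₁.nat 0 = s.nat 0 := k1 0 (by decide)
  have e02 : s₂.nat 0 = s₁.nat 0 := k2 0 (by decide)
  have e03 : s₃.nat 0 = s₁.nat 0 := (k3 0 (by decide)).trans e02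
  have e04 : s₄.nat 0 = s₁.nat 0 := (k4 0 (by decide)).trans e03
  have e142 : s₂.nat 14 = s₁.nat 14 := k2 14 (by decide)
  have e144 : s₄.nat 14 = s₁.nat 14 := (k4 14 (by decide)).trans ((k3 14 (by decide)).trans e142)
  have e152 : s₂.nat 15 = s₁.nat 15 := k2 15 (by decide)
  have e153 : s₃.nat 15 = s₁.nat 15 := (k3 15 (by decide)).trans e152
  have e154 : s₄.nat 15 = s₁.nat 15 := (k4 15 (by decide)).trans e153
  have e163 : s₃.nat 16 = s₂.nat 16 := k3 16 (by decide)
  have e164 : s₄.nat 16 = s₂.nat 16 := (k4 16 (by decide)).trans e163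
  have e174 : s₄.nat 17 = s₃.nat 17 := k4 17 (by decide)
  have e184 : s₄.nat 18 = s₃.nat 18 := k4 18 (by decide)
  refine ⟨?_, ?_, ?_, ?_, ?_, ?_, ?_⟩
  · refine h.of_eq e0 (e 5 ?_ ?_ ?_ ?_) (e 6 ?_ ?_ ?_ ?_) (e 7 ?_ ?_ ?_ ?_) (e 13 ?_ ?_ ?_ ?_)
      ?_ ?_ ?_ ?_ ?_
    all_goals first
      | decide
      | rw [r4]; exact r1 _ (by decide)
  · intro i hi
    obtain ⟨j, hj, hij⟩ := hs i hi
    rw [h.next _ (by omega), nextPos, if_pos (by omega)] at hij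
    refine ⟨j, hj, ?_⟩
    rw [r4, e0, r1 5 (by decide), r1 6 (by decide)]
    exact hij
  · intro k hk
    have := p1 k (by rwa [← e0])
    unfold PrimaryAt idxP idxQ at *
    rwa [r4, e04, e144, e154]
  · rw [r4, e0]; exact p2
  · intro k hk
    have := p3 k (by rwa [e0', ← e0])
    unfold EnvyAt idxP idxQ at *
    rw [r2, e02, e142, e152] at this
    rwa [r4, e04, e144, e154, e164]
  · intro k hk
    have := p4 k (by rwa [e02, e0', ← e0])
    unfold ShiftAt idxP idxQ at *
    rw [r3, e153, e163] at this
    rwa [r4, e154, e164, e174, e184]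
  · intro k hk
    exact p5 k (by rwa [e03, e0', ← e0])

/-- The data of the scans in the memory satisfy the defining conditions of a `Scan`. -/
noncomputable def scanOf (s : Memory) (h : Scanned s) : Scan (s.nat 0 0) := by
  have side : ∀ k < s.nat 0 0, s.nat 15 k ≤ 1 := fun k hk => (h.primary k hk).1
  have l0 : ∀ k < s.nat 0 0, ∀ i ≤ 1, 0 ≤ s.real 5 (k + k + i) := fun k hk i hi => by
    rw [h.ready.left k hk i hi]; exact partSum_nonneg h.ready.isCut.left_nonneg k i
  have r0 : ∀ k < s.nat 0 0, ∀ i ≤ 1, 0 ≤ s.real 6 (k + k + i) := fun k hk i hi => by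
    rw [h.ready.right k hk i hi]; exact partSum_nonneg h.ready.isCut.right_nonneg k i
  have n3 := h.ready.three
  have best : ∀ k < s.nat 0 0, s.nat 14 k = 1 → ∀ i ≤ 1,
      s.real 5 (k + k + i) ≤ s.real 5 (idxP s k) := by
    intro k hk hp i hi
    have h1 := ((h.primary k hk).2.2.1 hp).1
    unfold idxP idxQ at *
    by_cases hi' : i = s.nat 15 k
    · rw [hi']
    · have : i = 1 - s.nat 15 k := by have := side k hk; omega
      rwa [this]
  have prz : s.nat 14 0 = 1 := (h.primary 0 (by omega)).2.1.2 (Or.inl (Or.inl rfl))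
  have prl : s.nat 14 (s.nat 0 0 - 1) = 1 :=
    (h.primary _ (by omega)).2.1.2 (Or.inl (Or.inr (by omega)))
  exact {
    lP := fun k => s.real 5 (idxP s k)
    lQ := fun k => s.real 5 (idxQ s k)
    rP := fun k => s.real 6 (idxP s k)
    rQ := fun k => s.real 6 (idxQ s k)
    Lsh := s.real 12
    Rsh := s.real 13
    prim := fun k => max (s.real 12 k) (max (s.real 5 (idxP s k)) (s.real 5 (idxQ s k)))
    pr := fun k => s.nat 14 k = 1
    env := fun k => s.nat 16 k = 1
    sh := fun k => s.nat 17 k = 1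
    lon := fun k => s.nat 18 k = 1
    d := s.nat 19
    three := n3
    lP_nonneg := fun k hk => l0 k hk _ (side k hk)
    lQ_nonneg := fun k hk => l0 k hk _ (by omega)
    rP_nonneg := fun k hk => r0 k hk _ (side k hk)
    rQ_nonneg := fun k hk => r0 k hk _ (by omega)
    left_best := fun k hk hp => ((h.primary k hk).2.2.1 hp).1
    right_best := fun k hk hp => ((h.primary k hk).2.2.2 hp).1
    pr_zero := prz
    pr_last := prl
    Lsh_le := fun k hk hk' hp => by
      have hk2 : k < s.nat 0 0 := by omega
      rcases (h.primary k hk2).2.1.1 hp with (h1 | h1) | (h1 | h1)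
      · omega
      · omega
      · exact h1.trans (best k hk2 hp 0 (by omega))
      · exact h1.trans (best k hk2 hp 1 le_rfl)
    le_Lsh := fun k hk hp => by
      have h1 := mt (h.primary k hk).2.1.2 hp
      simp only [not_or, not_le] at h1
      have key : ∀ i ≤ 1, s.real 5 (k + k + i) ≤ s.real 12 k := by
        intro i hi
        obtain rfl | rfl : i = 0 ∨ i = 1 := by omega
        · exact h1.2.1.le
        · exact h1.2.2.le
      exact ⟨key _ (side k hk), key _ (by omega)⟩
    Lsh_zero := by
      have h1 := ((h.primary _ (by omega)).2.2.1 prl).2.1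
      rw [h.primary_zero, ← h1, Nat.sub_add_cancel (by omega)]
    Lsh_succ := fun k hk hp => ((h.primary k (by omega)).2.2.1 hp).2.1
    Lsh_succ' := fun k hk hp => ((h.primary k (by omega)).2.2.2 hp).2.1
    Rsh_eq := fun k hk hp => ((h.primary k (by omega)).2.2.1 hp).2.2
    Rsh_eq' := fun k hk hp => ((h.primary k (by omega)).2.2.2 hp).2.2
    prim_eq := fun k hk => rfl
    start := by
      obtain ⟨j, hj, h1⟩ := h.start _ (side (s.nat 0 0 - 1) (by omega))
      exact h1.trans (best 0 (by omega) prz j hj)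
    start' := by
      obtain ⟨j, hj, h1⟩ := h.start (1 - s.nat 15 (s.nat 0 0 - 1)) (by omega)
      exact h1.trans (best 0 (by omega) prz j hj)
    env_last := fun hc => by
      have := ((h.envy _ (by omega)).1 hc).1
      omega
    env_iff := fun k hk => by
      have := h.envy k (by omega)
      unfold EnvyAt at this
      simp only [max_lt_iff]
      rw [this]
      exact ⟨fun h => h.2, fun h => ⟨hk, h⟩⟩
    sh_iff := fun k hk => (h.shift k hk).2.1
    lon_iff := fun k hk => (h.shift k hk).2.2
    d_lon := fun k hk hl => (h.endAt k (by omega)).1 hl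
    d_not := fun k hk hl => (h.endAt k (by omega)).2 hl }

/-- The program has found an allocation that satisfies the criterion for EFX. -/
def Allocated (s : Memory) : Prop :=
  (∀ p < s.nat 0 0, ∀ j, j ≠ p → (splitOf s).Content (s.nat 0 0) p j) ∧
  ∀ k < s.nat 0 0, s.nat 21 k < s.nat 0 0 ∧ s.nat 22 k < s.nat 0 0

theorem nextPos_lt {n k : ℕ} (hn : 0 < n) (hk : k < n) : nextPos n k < n := by
  unfold nextPos; split_ifs <;> omega

/-- Without a start, the best halves of the previous edge classes make everybody content. -/
theorem assignPrev_allocated (s : Memory) (h : Ready s)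
    (hs : ∀ k < s.nat 0 0, ¬ Prefers s k) : Allocated (assignPrev.run s) := by
  have sp := assignPrev_spec s
  set s' := assignPrev.run s with hs'
  have e : ∀ a, a ∉ assignPrev.natWrites → s'.nat a = s.nat a := fun a ha =>
    run_nat_of_notMem _ ha _
  have r : s'.real = s.real := funext fun a =>
    run_real_of_notMem _ (by simp [assignPrev, assignWorse, assign, block, realWrites]) _
  have e0 := e 0 (by decide)
  have h' : Ready s' := h.of_eq e0 (e 5 (by decide)) (e 6 (by decide)) (e 7 (by decide))
    (e 13 (by decide)) (by rw [r]) (by rw [r]) (by rw [r]) (by rw [r]) (by rw [r])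
  have hn := h.three
  have hl0 : ∀ k < s.nat 0 0, ∀ i ≤ 1, 0 ≤ s.real 5 (k + k + i) := fun k hk i hi => by
    rw [h.left k hk i hi]; exact partSum_nonneg h.isCut.left_nonneg k i
  have hr0 : ∀ k < s.nat 0 0, ∀ i ≤ 1, 0 ≤ s.real 6 (k + k + i) := fun k hk i hi => by
    rw [h.right k hk i hi]; exact partSum_nonneg h.isCut.right_nonneg k i
  have fin : ∀ k < s.nat 0 0, _ := fun k hk =>
    h'.splitOf_final (k := k) (by rwa [e0]) (sp k hk).2.1 (sp k hk).1 rfl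
  simp only [r] at fin
  unfold Allocated
  rw [e0]
  refine ⟨fun p hp j hj => Split.content_of_prev hn (fun k hk => (sp k hk).2.2.2.1)
    (fun k hk => ?_) (fun k hk => ?_) (fun k hk => ?_) (fun k hk => ?_) (fun k hk => ?_) hp j hj,
    fun k hk => ⟨?_, ?_⟩⟩
  · rw [← h.next k hk]; exact (sp k hk).2.2.2.2
  · rw [(fin k hk).1]; exact hl0 k hk _ (sp k hk).2.1
  · rw [(fin k hk).2.2.1, (fin k hk).2.2.2.1]; exact (sp k hk).2.2.1
  · rw [(fin k hk).2.2.2.1]; exact hr0 k hk _ (by omega)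
  · have hq : prevPos (s.nat 0 0) k < s.nat 0 0 := by unfold prevPos; split_ifs <;> omega
    have hqn : nextPos (s.nat 0 0) (prevPos (s.nat 0 0) k) = k := by
      unfold nextPos prevPos; split_ifs <;> omega
    rw [(fin k hk).2.1, (fin _ hq).2.2.2.1]
    have h1 := hs _ hq
    unfold Prefers at h1
    push Not at h1
    obtain ⟨i, hi, h1⟩ := h1
    rw [h.next _ hq, hqn] at h1
    refine (h1 (1 - s'.nat 20 k) (by omega)).le.trans ?_
    have h2 := (sp _ hq).2.2.1
    have h3 := (sp _ hq).2.1
    by_cases hi' : i = s'.nat 20 (prevPos (s.nat 0 0) k)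
    · rw [hi']; exact h2
    · rw [(by omega : i = 1 - s'.nat 20 (prevPos (s.nat 0 0) k))]
  · rw [(sp k hk).2.2.2.1]; exact hk
  · rw [(sp k hk).2.2.2.2, h.next k hk]; exact nextPos_lt (by omega) hk

/-- The tests of the program express the exceptional situations. -/
theorem rotateAllTest_holds (s : Memory) (h : Scanned s) :
    rotateAllTest.Holds s ↔ (scanOf s h).RotateAll := by
  simp [rotateAllTest, Scan.RotateAll, scanOf, idxP, idxQ]

theorem rotateLastTest_holds (s : Memory) (h : Scanned s) :
    rotateLastTest.Holds s ↔ (scanOf s h).RotateLast := by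
  simp [rotateLastTest, Scan.RotateLast, scanOf, idxP, idxQ]

/-- The values of the parts of an edge class that keeps its final split. -/
theorem Scanned.keeps_or_swaps {s s' : Memory} (h : Scanned s) (h' : Ready s')
    (e0 : s'.nat 0 = s.nat 0) (r : s'.real = s.real) {k : ℕ} (hk : k < s.nat 0 0)
    (h23 : s'.nat 23 k = 0) :
    (s'.nat 20 k = s.nat 15 k → (scanOf s h).Keeps (splitOf s') k) ∧
    (s'.nat 20 k = 1 - s.nat 15 k → (scanOf s h).Swaps (splitOf s') k) ∧
    (s'.nat 20 k ≤ 1 → (splitOf s').efxR k ∧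
      (splitOf s').rA k = s.real 6 (k + k + s'.nat 20 k) ∧
      (splitOf s').rB k = s.real 6 (k + k + (1 - s'.nat 20 k))) := by
  have hside := (h.primary k hk).1
  have fin : s'.nat 20 k ≤ 1 → _ := fun hi =>
    h'.splitOf_final (k := k) (by rwa [e0]) hi h23 rfl
  rw [r] at fin
  refine ⟨fun h1 => ?_, fun h1 => ?_, fun h1 => ?_⟩
  · obtain ⟨a1, a2, a3, a4, -⟩ := fin (by omega)
    rw [h1] at a1 a2 a3 a4
    exact ⟨a1, a2, a3, a4⟩
  · obtain ⟨a1, a2, a3, a4, -⟩ := fin (by omega)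
    rw [h1] at a1 a2 a3 a4
    rw [(by omega : 1 - (1 - s.nat 15 k) = s.nat 15 k)] at a2 a4
    exact ⟨a1, a2, a3, a4⟩
  · obtain ⟨-, -, a3, a4, a5⟩ := fin h1
    exact ⟨a5, a3, a4⟩

/-- The values of the parts of an edge class that keeps its first split. -/
theorem Scanned.recut {s s' : Memory} (h : Scanned s) (h' : Ready s')
    (e0 : s'.nat 0 = s.nat 0) (r : s'.real = s.real) {k : ℕ} (hk : k < s.nat 0 0)
    (h23 : s'.nat 23 k = 1) (h20 : s'.nat 20 k ≤ 1)
    (hle : s.real 7 (k + k + s'.nat 20 k) ≤ s.real 7 (k + k + (1 - s'.nat 20 k))) :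
    (scanOf s h).Recut (splitOf s') k := by
  obtain ⟨a1, a2, a3, a4, a5⟩ :=
    h'.splitOf_first (k := k) (by rwa [e0]) h20 (by omega) rfl
  rw [r] at a1 a2
  have hside := (h.primary k hk).1
  have hc := h.ready.isCut
  have hf := h.ready.first k hk
  have hr := h.ready.right k hk
  refine ⟨a5, by rw [a1, a2]; exact hle, ?_, ?_, a3, a4⟩
  · have h1 := partSum_add (e := s.nat 5) (w := s.real 3) hc.sideB k h20
    have h2 := partSum_add (e := s.nat 5) (w := s.real 3) hc.sideD k hside
    rw [a1, a2, hf _ h20, hf _ (by omega), h1, ← h2, ← hr _ hside, ← hr _ (by omega)]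
    rfl
  · rw [hf _ h20, hf _ (by omega)] at hle
    have := hc.le_first hk h20 hside hle
    rw [← hf _ (by omega), ← hr _ hside] at this
    rw [a2]
    exact this

/-- Outside the two exceptional situations the main allocation makes everybody content. -/
theorem assignMain_allocated (s : Memory) (h : Scanned s) (hA : ¬ (scanOf s h).RotateAll)
    (hL : ¬ (scanOf s h).RotateLast) : Allocated (assignMain.run s) := by
  have sp := assignMain_spec s
  set s' := assignMain.run s with hs'
  have e : ∀ a, a ∉ assignMain.natWrites → s'.nat a = s.nat a := fun a ha =>
    run_nat_of_notMem _ ha _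
  have r : s'.real = s.real := funext fun a =>
    run_real_of_notMem _ (by simp [assignMain, assign, block, realWrites]) _
  have e0 := e 0 (by decide)
  have h' : Ready s' := h.ready.of_eq e0 (e 5 (by decide)) (e 6 (by decide)) (e 7 (by decide))
    (e 13 (by decide)) (by rw [r]) (by rw [r]) (by rw [r]) (by rw [r]) (by rw [r])
  have hn := h.ready.three
  have hnx := h.ready.next
  have hM : (scanOf s h).IsMain (splitOf s') := by
    refine ⟨fun k hk hp hs => ?_, fun k hk hps => ?_, fun k hk => (sp k hk).2.2.2.1,
      fun k hk hl => ?_, fun k hk hl => ?_, fun k hk => ?_⟩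
    · have hs1 : s.nat 17 k ≠ 1 := hs
      have := (h.shift k hk).1
      exact (h.keeps_or_swaps h' e0 r hk (sp k hk).1).1 ((sp k hk).2.1 ⟨hp, by omega⟩)
    · refine (h.keeps_or_swaps h' e0 r hk (sp k hk).1).2.1 ((sp k hk).2.2.1 ?_)
      rintro ⟨h1, h2⟩
      have : s.nat 17 k = 1 := hps h1
      omega
    · rw [← hnx k hk] at hl ⊢
      exact (sp k hk).2.2.2.2.1 hl
    · rw [← hnx k hk] at hl ⊢
      exact (sp k hk).2.2.2.2.2 hl
    · have hside := (h.primary k hk).1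
      refine ((h.keeps_or_swaps h' e0 r hk (sp k hk).1).2.2 ?_).1
      by_cases hc : s.nat 14 k = 1 ∧ s.nat 17 k = 0
      · rw [(sp k hk).2.1 hc]; exact hside
      · rw [(sp k hk).2.2.1 hc]; omega
  unfold Allocated
  rw [e0]
  refine ⟨fun p hp j hj => ?_, fun k hk => ⟨?_, ?_⟩⟩
  · rcases Nat.eq_zero_or_pos p with rfl | hpos
    · refine hM.content_zero (fun h1 h2 => hA ⟨h1, Or.inl h2⟩) (fun h1 h2 h3 => ?_) j hj
      by_contra hc
      exact hL ⟨h1, h2, h3, not_le.1 hc⟩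
    · obtain ⟨k, rfl⟩ : ∃ k, p = k + 1 := ⟨p - 1, by omega⟩
      refine hM.content_succ hp (fun h1 h2 h3 h4 h5 => ?_) j hj
      by_contra hc
      have e1 : s.nat 0 0 - 2 = k := by omega
      have e2 : s.nat 0 0 - 1 = k + 1 := by omega
      refine hA ⟨h2, Or.inr ?_⟩
      rw [e1, e2]
      exact ⟨h3, h4, h5, not_le.1 hc⟩
  · rw [(sp k hk).2.2.2.1]; exact hk
  · have h1 := nextPos_lt (by omega : 0 < s.nat 0 0) hk
    by_cases hl : s.nat 18 (s.nat 13 k) = 1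
    · rw [(sp k hk).2.2.2.2.1 hl]
      rw [hnx k hk] at hl ⊢
      exact ((scanOf s h).d_of_lon h1 hl).2.1
    · rw [(sp k hk).2.2.2.2.2 hl, hnx k hk]; exact h1

theorem assignRotateAll_allocated (s : Memory) (h : Scanned s) (hA : (scanOf s h).RotateAll) :
    Allocated (assignRotateAll.run s) := by
  have sp := assignRotateAll_spec s
  set s' := assignRotateAll.run s with hs'
  have e : ∀ a, a ∉ assignRotateAll.natWrites → s'.nat a = s.nat a := fun a ha =>
    run_nat_of_notMem _ ha _
  have r : s'.real = s.real := funext fun a => run_real_of_notMem _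
    (by simp [assignRotateAll, assignWorse, assign, block, realWrites]) _
  have e0 := e 0 (by decide)
  have h' : Ready s' := h.ready.of_eq e0 (e 5 (by decide)) (e 6 (by decide)) (e 7 (by decide))
    (e 13 (by decide)) (by rw [r]) (by rw [r]) (by rw [r]) (by rw [r]) (by rw [r])
  have hn := h.ready.three
  have hnx := h.ready.next
  obtain ⟨z1, z2, z3⟩ := (sp 0 (by omega)).1 rfl
  have hl : s.nat 0 0 - 1 < s.nat 0 0 := by omega
  obtain ⟨w1, w2⟩ := (sp _ hl).2.2.2.1 (by omega) (by omega) (by omega)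
  have hlast := h.keeps_or_swaps h' e0 r hl ((sp _ hl).2.1 (by omega))
  have hoB : ∀ k < s.nat 0 0, s'.nat 22 k = nextPos (s.nat 0 0) k := by
    intro k hk
    rcases Nat.eq_zero_or_pos k with rfl | hpos
    · rw [(sp 0 hk).2.2.2.2.2.2.1 rfl]; unfold nextPos; rw [if_neg (by omega)]
    · rw [(sp k hk).2.2.2.2.2.2.2 (by omega), hnx k hk]
  have hM : (scanOf s h).IsRotateAll (splitOf s') := by
    refine ⟨h.recut h' e0 r (by omega) z1 z2 z3, fun k hk hk' => ?_, ?_, ?_, fun k hk hk1 => ?_, ?_,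
      hoB⟩
    · exact (h.keeps_or_swaps h' e0 r (by omega) ((sp k (by omega)).2.1 (by omega))).2.1
        ((sp k (by omega)).2.2.1 (by omega) (Or.inl (by omega)))
    · have hside := (h.primary _ hl).1
      by_cases hc : s'.nat 20 (s.nat 0 0 - 1) = s.nat 15 (s.nat 0 0 - 1)
      · exact Or.inl (hlast.1 hc)
      · exact Or.inr (hlast.2.1 (by omega))
    · rw [(hlast.2.2 w1).2.1, (hlast.2.2 w1).2.2]; exact w2
    · exact (sp k hk).2.2.2.2.1 hk1
    · exact (sp 1 (by omega)).2.2.2.2.2.1 rfl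
  unfold Allocated
  rw [e0]
  refine ⟨fun p hp j hj => hM.content hA hp j hj, fun k hk => ⟨?_, ?_⟩⟩
  · by_cases hk1 : k = 1
    · rw [(sp k hk).2.2.2.2.2.1 hk1]; omega
    · rw [(sp k hk).2.2.2.2.1 hk1]; exact hk
  · rw [hoB k hk]; exact nextPos_lt (by omega) hk

theorem assignRotateLast_allocated (s : Memory) (h : Scanned s) (hL : (scanOf s h).RotateLast) :
    Allocated (assignRotateLast.run s) := by
  have sp := assignRotateLast_spec s
  set s' := assignRotateLast.run s with hs'
  have e : ∀ a, a ∉ assignRotateLast.natWrites → s'.nat a = s.nat a := fun a ha =>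
    run_nat_of_notMem _ ha _
  have r : s'.real = s.real := funext fun a => run_real_of_notMem _
    (by simp [assignRotateLast, assignWorse, assign, block, realWrites]) _
  have e0 := e 0 (by decide)
  have h' : Ready s' := h.ready.of_eq e0 (e 5 (by decide)) (e 6 (by decide)) (e 7 (by decide))
    (e 13 (by decide)) (by rw [r]) (by rw [r]) (by rw [r]) (by rw [r]) (by rw [r])
  have hn := h.ready.three
  have h2 : s.nat 0 0 - 2 < s.nat 0 0 := by omega
  have hl : s.nat 0 0 - 1 < s.nat 0 0 := by omega
  obtain ⟨z1, z2, z3⟩ := (sp _ h2).1 (by omega)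
  have keeps : ∀ k < s.nat 0 0, k + 2 ≠ s.nat 0 0 → _ := fun k hk hk2 =>
    h.keeps_or_swaps h' e0 r hk ((sp k hk).2.1 hk2)
  have hM : (scanOf s h).IsRotateLast (splitOf s') := by
    refine ⟨h.recut h' e0 r h2 z1 z2 z3, fun k hk hk' => ?_, ?_, fun h3 => ?_, ?_,
      fun k hk => ?_, ?_, fun k hk hk' => ?_, ?_, fun k hk hk' => ?_⟩
    · exact (keeps k (by omega) (by omega)).1 ((sp k (by omega)).2.2.1 (by omega) (by omega))
    · have k0 := keeps 0 (by omega) (by omega)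
      by_cases h3 : s.nat 0 0 = 3
      · have hside := (h.primary 0 (by omega)).1
        have := ((sp 0 (by omega)).2.2.2.1 ⟨h3, rfl⟩).1
        by_cases hc : s'.nat 20 0 = s.nat 15 0
        · exact Or.inl (k0.1 hc)
        · exact Or.inr ⟨h3, k0.2.1 (by omega)⟩
      · exact Or.inl (k0.1 ((sp 0 (by omega)).2.2.1 (by omega) (by omega)))
    · have k0 := keeps 0 (by omega) (by omega)
      obtain ⟨w1, w2⟩ := (sp 0 (by omega)).2.2.2.1 ⟨h3, rfl⟩
      rw [(k0.2.2 w1).2.1, (k0.2.2 w1).2.2]; exact w2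
    · exact (keeps _ hl (by omega)).1 ((sp _ hl).2.2.1 (by omega) (by omega))
    · exact (sp k (by omega)).2.2.2.2.1 (by omega)
    · exact (sp _ hl).2.2.2.2.2.1 (by omega)
    · exact (sp k hk).2.2.2.2.2.2.1 (by omega)
    · exact (sp _ h2).2.2.2.2.2.2.2 (by omega)
    · refine ((keeps k (by omega) (by omega)).2.2 ?_).1
      rw [(sp k (by omega)).2.2.1 (by omega) (by omega)]
      exact (h.primary k (by omega)).1
  unfold Allocated
  rw [e0]
  refine ⟨fun p hp j hj => hM.content hL hp j hj, fun k hk => ⟨?_, ?_⟩⟩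
  · by_cases hk1 : k + 1 = s.nat 0 0
    · rw [(sp k hk).2.2.2.2.2.1 hk1]; omega
    · rw [(sp k hk).2.2.2.2.1 hk1]; exact hk
  · by_cases hk1 : k + 2 = s.nat 0 0
    · rw [(sp k hk).2.2.2.2.2.2.2 hk1]; omega
    · rw [(sp k hk).2.2.2.2.2.2.1 hk1]; omega

/-- In each of the four cases the allocation satisfies the criterion for EFX. -/
theorem allocate_spec (s : Memory) (h : Ready s)
    (hs : (s.nat 24 0 = 1 ∧ Prefers s (s.nat 0 0 - 1)) ∨
      (s.nat 24 0 = 0 ∧ ∀ k < s.nat 0 0, ¬ Prefers s k)) : Allocated (allocate.run s) := by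
  unfold allocate
  rw [run_ite]
  rcases hs with ⟨h1, h2⟩ | ⟨h1, h2⟩
  · rw [if_pos (by simpa using h1)]
    have hS := scans_spec s h h2
    rw [run, run_ite, run_ite]
    split_ifs with hA hL
    · exact assignRotateAll_allocated _ hS ((rotateAllTest_holds _ hS).1 hA)
    · exact assignRotateLast_allocated _ hS ((rotateLastTest_holds _ hS).1 hL)
    · exact assignMain_allocated _ hS (mt (rotateAllTest_holds _ hS).2 hA)
        (mt (rotateLastTest_holds _ hS).2 hL)
  · rw [if_neg (by simp [h1])]
    exact assignPrev_allocated s h h2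

/-! ### Renumbering from the start -/

section Renumber

variable {m n st : ℕ} {e e' σB σD σ : ℕ → ℕ} {a b w : ℕ → ℝ}

theorem relPos_lt (hst : st < n) {k : ℕ} (hk : k < n) : relPos n st k < n := by
  unfold relPos; split_ifs <;> omega

theorem relPos_inj (hst : st < n) {k j : ℕ} (hk : k < n) (hj : j < n) :
    relPos n st k = relPos n st j ↔ k = j := by
  unfold relPos; split_ifs <;> omega

theorem relPos_surj (hst : st < n) {k : ℕ} (hk : k < n) : ∃ j < n, relPos n st j = k := by
  by_cases h : st + k < n
  · exact ⟨st + k, h, by unfold relPos; rw [if_pos (by omega)]; omega⟩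
  · exact ⟨st + k - n, by omega, by unfold relPos; rw [if_neg (by omega)]; omega⟩

theorem nextPos_relPos (hst : st < n) {k : ℕ} (hk : k < n) :
    nextPos n (relPos n st k) = relPos n st (nextPos n k) := by
  unfold nextPos relPos; split_ifs <;> omega

theorem relPos_nextPos_self {k : ℕ} (hk : k < n) : relPos n (nextPos n k) k = n - 1 := by
  unfold nextPos relPos; split_ifs <;> omega

theorem partSum_relPos (hst : st < n) (he : ∀ g < m, e g < n)
    (he' : ∀ g < m, e' g = relPos n st (e g)) {k : ℕ} (hk : k < n) (i : ℕ) :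
    partSum m e' σ w (relPos n st k) i = partSum m e σ w k i := by
  refine Finset.sum_congr rfl fun g hg => ?_
  rw [Finset.mem_range] at hg
  rw [he' g hg]
  exact if_congr (and_congr_left' (relPos_inj hst (he g hg) hk)) rfl rfl

theorem signedSum_relPos (hst : st < n) (he : ∀ g < m, e g < n)
    (he' : ∀ g < m, e' g = relPos n st (e g)) {k : ℕ} (hk : k < n) :
    signedSum m e' σ w (relPos n st k) = signedSum m e σ w k := by
  refine Finset.sum_congr rfl fun g hg => ?_
  rw [Finset.mem_range] at hg
  rw [he' g hg]
  exact if_congr (relPos_inj hst (he g hg) hk) rfl rfl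

/-- The conditions on the splits do not depend on the numbering of the edge classes. -/
theorem IsCut.reindex (h : IsCut m n e σB σD a b) (hst : st < n)
    (he' : ∀ g < m, e' g = relPos n st (e g)) : IsCut m n e' σB σD a b := by
  refine ⟨h.left_nonneg, h.right_nonneg, fun g hg => ?_, h.sideB, h.sideD, fun g hg => ?_,
    fun g hg => ?_, fun k hk => ?_⟩
  · rw [he' g hg]; exact relPos_lt hst (h.edge g hg)
  · rw [he' g hg, signedSum_relPos hst h.edge he' (h.edge g hg)]; exact h.efxB g hg
  · rw [he' g hg, signedSum_relPos hst h.edge he' (h.edge g hg)]; exact h.efxD g hg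
  · obtain ⟨j, hj, rfl⟩ := relPos_surj hst hk
    rw [signedSum_relPos hst h.edge he' hj, signedSum_relPos hst h.edge he' hj]
    exact h.bound j hj

end Renumber

/-- The preference of a start, in terms of the items instead of the tables of sums; in this form it
is seen not to depend on the numbering. -/
theorem Ready.prefers_iff {s : Memory} (h : Ready s) {k : ℕ} (hk : k < s.nat 0 0) :
    Prefers s k ↔ ∀ i ≤ 1, ∃ j ≤ 1,
      partSum (s.nat 0 1) (s.nat 5) (s.nat 7) (s.real 3) k i ≤
        partSum (s.nat 0 1) (s.nat 5) (s.nat 7) (s.real 2) (nextPos (s.nat 0 0) k) j := by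
  unfold Prefers
  refine forall₂_congr fun i hi => exists_congr fun j => and_congr_right fun hj => ?_
  rw [h.right k hk i hi, h.next k hk,
    h.left _ (nextPos_lt (by have := h.three; omega) hk) j hj]

/-- After the preparation the tables are complete, and the positions are counted from the start: the
class before the start is the last one. -/
theorem prepare_spec (s : Memory) (hn : 3 ≤ s.nat 0 0) (h7 : ∀ g < s.nat 0 1, s.nat 7 g = 0)
    (ha : ∀ g < s.nat 0 1, 0 ≤ s.real 2 g) (hb : ∀ g < s.nat 0 1, 0 ≤ s.real 3 g)
    (he : ∀ g < s.nat 0 1, s.nat 5 g < s.nat 0 0) (h12 : s.nat 12 0 = 0) (h24 : s.nat 24 0 = 0) :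
    Ready (prepare.run s) ∧
    (((prepare.run s).nat 24 0 = 1 ∧ Prefers (prepare.run s) (s.nat 0 0 - 1)) ∨
      ((prepare.run s).nat 24 0 = 0 ∧ ∀ k < s.nat 0 0, ¬ Prefers (prepare.run s) k)) ∧
    (prepare.run s).nat 12 0 < s.nat 0 0 ∧
    ∀ g < s.nat 0 1, (prepare.run s).nat 5 g =
      relPos (s.nat 0 0) ((prepare.run s).nat 12 0) (s.nat 5 g) := by
  simp only [prepare, run_block_cons, run_block_nil]
  -- the intermediate memories are opaque variables, lest the unifier unfold the program
  obtain ⟨s₁, hs₁⟩ : ∃ x, x = cut.run s := ⟨_, rfl⟩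
  rw [← hs₁]
  obtain ⟨s₂, hs₂⟩ : ∃ x, x = nextPositions.run s₁ := ⟨_, rfl⟩
  rw [← hs₂]
  obtain ⟨s₃, hs₃⟩ : ∃ x, x = sums.run s₂ := ⟨_, rfl⟩
  rw [← hs₃]
  obtain ⟨s₄, hs₄⟩ : ∃ x, x = findStart.run s₃ := ⟨_, rfl⟩
  rw [← hs₄]
  obtain ⟨s₅, hs₅⟩ : ∃ x, x = reindex.run s₄ := ⟨_, rfl⟩
  rw [← hs₅]
  obtain ⟨s₆, hs₆⟩ : ∃ x, x = sums.run s₅ := ⟨_, rfl⟩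
  rw [← hs₆]
  have k1 : ∀ a, a ∉ cut.natWrites → s₁.nat a = s.nat a := fun a ha => by
    rw [hs₁]; exact run_nat_of_notMem cut ha s
  have k2 : ∀ a, a ∉ nextPositions.natWrites → s₂.nat a = s₁.nat a := fun a ha => by
    rw [hs₂]; exact run_nat_of_notMem nextPositions ha s₁
  have k3 : ∀ a, a ∉ sums.natWrites → s₃.nat a = s₂.nat a := fun a ha => by
    rw [hs₃]; exact run_nat_of_notMem sums ha s₂
  have k4 : ∀ a, a ∉ findStart.natWrites → s₄.nat a = s₃.nat a := fun a ha => by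
    rw [hs₄]; exact run_nat_of_notMem findStart ha s₃
  have k5 : ∀ a, a ∉ reindex.natWrites → s₅.nat a = s₄.nat a := fun a ha => by
    rw [hs₅]; exact run_nat_of_notMem reindex ha s₄
  have k6 : ∀ a, a ∉ sums.natWrites → s₆.nat a = s₅.nat a := fun a ha => by
    rw [hs₆]; exact run_nat_of_notMem sums ha s₅
  have r1 : ∀ a, a ∉ cut.realWrites → s₁.real a = s.real a := fun a ha => by
    rw [hs₁]; exact run_real_of_notMem cut ha s
  have r2 : ∀ a, s₂.real a = s₁.real a := fun a => by
    rw [hs₂]; exact run_real_of_notMem nextPositions (by simp [nextPositions, realWrites]) s₁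
  have r3 : ∀ a, a ∉ sums.realWrites → s₃.real a = s₂.real a := fun a ha => by
    rw [hs₃]; exact run_real_of_notMem sums ha s₂
  have r4 : ∀ a, s₄.real a = s₃.real a := fun a => by
    rw [hs₄]; exact run_real_of_notMem findStart (by simp [findStart, block, realWrites]) s₃
  have r5 : ∀ a, s₅.real a = s₄.real a := fun a => by
    rw [hs₅]; exact run_real_of_notMem reindex (by simp [reindex, realWrites]) s₄
  have r6 : ∀ a, a ∉ sums.realWrites → s₆.real a = s₅.real a := fun a ha => by
    rw [hs₆]; exact run_real_of_notMem sums ha s₅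
  -- the tables before and after renumbering
  have e10 : s₁.nat 0 = s.nat 0 := k1 0 (by decide)
  have e15 : s₁.nat 5 = s.nat 5 := k1 5 (by decide)
  have e20 : s₂.nat 0 = s.nat 0 := (k2 0 (by decide)).trans e10
  have e25 : s₂.nat 5 = s.nat 5 := (k2 5 (by decide)).trans e15
  have e30 : s₃.nat 0 = s.nat 0 := (k3 0 (by decide)).trans e20
  have e35 : s₃.nat 5 = s.nat 5 := (k3 5 (by decide)).trans e25
  have e36 : s₃.nat 6 = s₁.nat 6 := (k3 6 (by decide)).trans (k2 6 (by decide))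
  have e37 : s₃.nat 7 = s₁.nat 7 := (k3 7 (by decide)).trans (k2 7 (by decide))
  have e313 : s₃.nat 13 = s₂.nat 13 := k3 13 (by decide)
  have q32 : s₃.real 2 = s.real 2 := (r3 2 (by decide)).trans ((r2 2).trans (r1 2 (by decide)))
  have q33 : s₃.real 3 = s.real 3 := (r3 3 (by decide)).trans ((r2 3).trans (r1 3 (by decide)))
  have e40 : s₄.nat 0 = s.nat 0 := (k4 0 (by decide)).trans e30
  have e45 : s₄.nat 5 = s.nat 5 := (k4 5 (by decide)).trans e35
  have e50 : s₅.nat 0 = s.nat 0 := (k5 0 (by decide)).trans e40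
  have e512 : s₅.nat 12 = s₄.nat 12 := k5 12 (by decide)
  have e56 : s₅.nat 6 = s₁.nat 6 := (k5 6 (by decide)).trans ((k4 6 (by decide)).trans e36)
  have e57 : s₅.nat 7 = s₁.nat 7 := (k5 7 (by decide)).trans ((k4 7 (by decide)).trans e37)
  have q52 : s₅.real 2 = s.real 2 := (r5 2).trans ((r4 2).trans q32)
  have q53 : s₅.real 3 = s.real 3 := (r5 3).trans ((r4 3).trans q33)
  have e60 : s₆.nat 0 = s.nat 0 := (k6 0 (by decide)).trans e50
  have e65 : s₆.nat 5 = s₅.nat 5 := k6 5 (by decide)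
  have e66 : s₆.nat 6 = s₁.nat 6 := (k6 6 (by decide)).trans e56
  have e67 : s₆.nat 7 = s₁.nat 7 := (k6 7 (by decide)).trans e57
  have e612 : s₆.nat 12 = s₄.nat 12 := (k6 12 (by decide)).trans e512
  have e613 : s₆.nat 13 = s₂.nat 13 := (k6 13 (by decide)).trans
    ((k5 13 (by decide)).trans ((k4 13 (by decide)).trans e313))
  have e624 : s₆.nat 24 = s₄.nat 24 := (k6 24 (by decide)).trans (k5 24 (by decide))
  have q62 : s₆.real 2 = s.real 2 := (r6 2 (by decide)).trans q52
  have q63 : s₆.real 3 = s.real 3 := (r6 3 (by decide)).trans q53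
  have hcut := cut_spec s h7 ha hb he
  rw [← hs₁] at hcut
  have hnext := nextPositions_spec s₁
  rw [← hs₂, e10] at hnext
  have hready₃ : Ready s₃ := by
    have hsum := sums_spec s₂
      (by rw [e20, k2 6 (by decide)]; exact hcut.sideB)
      (by rw [e20, k2 7 (by decide)]; exact hcut.sideD)
    rw [← hs₃, e20, e25, k2 6 (by decide), k2 7 (by decide), r2, r2, r1 2 (by decide),
      r1 3 (by decide)] at hsum
    constructor
    · rwa [e30]
    · rw [e30, e35, e36, e37, q32, q33]; exact hcut
    · rw [e30, e35, e37, q32]; exact fun k hk i hi => (hsum k hk i hi).1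
    · rw [e30, e35, e37, q33]; exact fun k hk i hi => (hsum k hk i hi).2.1
    · rw [e30, e35, e36, q33]; exact fun k hk i hi => (hsum k hk i hi).2.2
    · rw [e30, e313]; exact hnext
  have hstart := findStart_spec s₃
    (by rw [k3 12 (by decide), k2 12 (by decide), k1 12 (by decide)]; exact h12)
    (by rw [k3 24 (by decide), k2 24 (by decide), k1 24 (by decide)]; exact h24)
  rw [← hs₄, e30] at hstart
  have hst : s₄.nat 12 0 < s.nat 0 0 := by
    rcases hstart with ⟨-, h, -⟩ | ⟨-, k, hk, h, -⟩
    · rw [h]; omega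
    · rw [h, e313, hnext k hk]; exact nextPos_lt (by omega) hk
  have hre := reindex_spec s₄
  rw [← hs₅, e40, e45] at hre
  have hready₆ : Ready s₆ := by
    have hsum := sums_spec s₅
      (by rw [e50, e56]; exact hcut.sideB) (by rw [e50, e57]; exact hcut.sideD)
    rw [← hs₆, e50, e56, e57, q52, q53] at hsum
    constructor
    · rwa [e60]
    · rw [e60, e65, e66, e67, q62, q63]; exact hcut.reindex hst hre
    · rw [e60, e65, e67, q62]; exact fun k hk i hi => (hsum k hk i hi).1
    · rw [e60, e65, e67, q63]; exact fun k hk i hi => (hsum k hk i hi).2.1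
    · rw [e60, e65, e66, q63]; exact fun k hk i hi => (hsum k hk i hi).2.2
    · rw [e60, e613]; exact hnext
  have hpref : ∀ k < s.nat 0 0, Prefers s₆ (relPos (s.nat 0 0) (s₄.nat 12 0) k) ↔ Prefers s₃ k := by
    intro k hk
    have hk' := relPos_lt hst hk
    rw [hready₆.prefers_iff (by rwa [e60]), hready₃.prefers_iff (by rwa [e30])]
    rw [e60, e65, e67, q62, q63, e30, e35, e37, q32, q33, nextPos_relPos hst hk]
    refine forall₂_congr fun i hi => exists_congr fun j => and_congr_right fun hj => ?_
    rw [partSum_relPos hst he hre hk, partSum_relPos hst he hre (nextPos_lt (by omega) hk)]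
  refine ⟨hready₆, ?_, by rw [e612]; exact hst, by rw [e65, e612]; exact hre⟩
  rw [e624]
  rcases hstart with ⟨h1, h2, h3⟩ | ⟨h1, k, hk, h2, h3⟩
  · right
    refine ⟨h1, fun k hk => ?_⟩
    obtain ⟨j, hj, rfl⟩ := relPos_surj hst hk
    rw [hpref j hj]
    exact h3 j hj
  · left
    refine ⟨h1, ?_⟩
    have := (hpref k hk).2 h3
    rwa [h2, e313, hnext k hk, relPos_nextPos_self hk] at this

/-! ### Correctness of the program -/

section Input

variable {n m : ℕ} (I : Instance n m) (G : MultiGraph n m)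

/-- The input lists the endpoints of an item as minimum and maximum. -/
theorem sym2_inf_sup (z : Sym2 (Fin n)) : s(z.inf, z.sup) = z := by
  induction z using Sym2.ind with
  | _ x y =>
    rcases le_total x y with h | h
    · simp [h]
    · simp [h, Sym2.eq_swap]

theorem input_one {g : ℕ} (hg : g < m) :
    (inputMemory I G).nat 1 g = ((G.ends ⟨g, hg⟩).inf : ℕ) := by
  simp [inputMemory, table, hg]

theorem input_two {g : ℕ} (hg : g < m) :
    (inputMemory I G).nat 2 g = ((G.ends ⟨g, hg⟩).sup : ℕ) := by
  simp [inputMemory, table, hg]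

theorem input_real_zero {g : ℕ} (hg : g < m) :
    (inputMemory I G).real 0 g = I.val (G.ends ⟨g, hg⟩).inf {⟨g, hg⟩} := by
  simp [inputMemory, table, hg]

theorem input_real_one {g : ℕ} (hg : g < m) :
    (inputMemory I G).real 1 g = I.val (G.ends ⟨g, hg⟩).sup {⟨g, hg⟩} := by
  simp [inputMemory, table, hg]

theorem input_size : (inputMemory I G).nat 0 0 = n ∧ (inputMemory I G).nat 0 1 = m := by
  simp [inputMemory]

/-- All other arrays are empty at the start. -/
theorem input_zero {a : ℕ} (ha : 3 ≤ a) (i : ℕ) : (inputMemory I G).nat a i = 0 := by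
  match a, ha with
  | k + 3, _ => rfl

/-- The tables of endpoints describe the skeleton. -/
theorem joined_input {u x : ℕ} :
    Joined (inputMemory I G) u x ↔ ∃ (hu : u < n) (hx : x < n), G.skeleton.Adj ⟨u, hu⟩ ⟨x, hx⟩ := by
  unfold Joined
  rw [(input_size I G).2]
  constructor
  · rintro ⟨g, hg, h⟩
    rw [input_one I G hg, input_two I G hg] at h
    rcases h with ⟨rfl, rfl⟩ | ⟨rfl, rfl⟩
    · exact ⟨Fin.isLt _, Fin.isLt _, ⟨g, hg⟩, (sym2_inf_sup _).symm⟩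
    · exact ⟨Fin.isLt _, Fin.isLt _, ⟨g, hg⟩, (sym2_inf_sup _).symm.trans Sym2.eq_swap⟩
  · rintro ⟨hu, hx, g, hg⟩
    refine ⟨g, g.isLt, ?_⟩
    rw [input_one I G g.isLt, input_two I G g.isLt]
    have h := (sym2_inf_sup (G.ends g)).trans hg
    rw [Sym2.eq_iff] at h
    rcases h with ⟨h1, h2⟩ | ⟨h1, h2⟩
    · left; simp only [Fin.eta]; rw [h1, h2]; exact ⟨rfl, rfl⟩
    · right; simp only [Fin.eta]; rw [h1, h2]; exact ⟨rfl, rfl⟩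

end Input

theorem mod_of_lt_two {n x : ℕ} (hx : x < n + n) :
    x % n = if x < n then x else x - n := by
  split_ifs with h
  · exact Nat.mod_eq_of_lt h
  · rw [Nat.mod_eq_sub_mod (by omega), Nat.mod_eq_of_lt (by omega)]

/-- The state after tracing and classifying: the walk goes twice round the cycle, and item `g` joins
vertex number `e g` of the walk, to which it has value `a g`, with the next vertex, to which it has
value `b g`. -/
structure Traversed {n m : ℕ} (I : Instance n m) (G : MultiGraph n m) (w : ℕ → Fin n) (e : ℕ → ℕ)
    (a b : ℕ → ℝ) : Prop where
  inj : ∀ i < n + n, ∀ j < n + n, w i = w j ↔ i % n = j % n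
  edge : ∀ g < m, e g < n
  ends : ∀ g (hg : g < m), G.ends ⟨g, hg⟩ = s(w (e g), w (e g + 1))
  left : ∀ g (hg : g < m), a g = I.val (w (e g)) {⟨g, hg⟩}
  right : ∀ g (hg : g < m), b g = I.val (w (e g + 1)) {⟨g, hg⟩}

/-- The walk of length `2 n` meets the vertices in their order on the cycle, and every item joins
two consecutive vertices of its first round. -/
theorem traversed {n m : ℕ} (I : Instance n m) (G : MultiGraph n m) (hG : G.IsMultiCycle) :
    ∃ w : ℕ → Fin n,
      (∀ p < n + n, (((classify.run (trace.run (inputMemory I G))).nat 4 p : ℕ) = w p)) ∧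
      Traversed I G w ((classify.run (trace.run (inputMemory I G))).nat 5)
        ((classify.run (trace.run (inputMemory I G))).real 2)
        ((classify.run (trace.run (inputMemory I G))).real 3) := by
  obtain ⟨hn, ⟨φ⟩⟩ := hG
  obtain ⟨i0, i1⟩ := input_size I G
  obtain ⟨s, hs⟩ : ∃ x, x = inputMemory I G := ⟨_, rfl⟩
  have hJ : ∀ u x, Joined s u x ↔ ∃ (hu : u < n) (hx : x < n),
      G.skeleton.Adj ⟨u, hu⟩ ⟨x, hx⟩ := fun u x => by rw [hs]; exact joined_input I G
  have j1 : ∀ g (hg : g < m), s.nat 1 g = ((G.ends ⟨g, hg⟩).inf : ℕ) := fun g hg => by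
    rw [hs]; exact input_one I G hg
  have j2 : ∀ g (hg : g < m), s.nat 2 g = ((G.ends ⟨g, hg⟩).sup : ℕ) := fun g hg => by
    rw [hs]; exact input_two I G hg
  have v1 : ∀ g (hg : g < m), s.real 0 g = I.val (G.ends ⟨g, hg⟩).inf {⟨g, hg⟩} := fun g hg => by
    rw [hs]; exact input_real_zero I G hg
  have v2 : ∀ g (hg : g < m), s.real 1 g = I.val (G.ends ⟨g, hg⟩).sup {⟨g, hg⟩} := fun g hg => by
    rw [hs]; exact input_real_one I G hg
  rw [← hs] at i0 i1 ⊢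
  obtain ⟨s₁, hs₁⟩ : ∃ x, x = trace.run s := ⟨_, rfl⟩
  have ht := trace_spec s (by omega) (by rw [hs]; exact input_zero I G (by omega) 0)
    (fun u hu z => by
      rw [i0] at hu
      by_cases hz : z < n
      · obtain ⟨v, hv, hvz⟩ := exists_adj_ne hn φ ⟨u, hu⟩ ⟨z, hz⟩
        exact ⟨v, (hJ _ _).2 ⟨hu, v.isLt, hv⟩, fun h => hvz (Fin.ext h)⟩
      · obtain ⟨v, hv, -⟩ := exists_adj_ne hn φ ⟨u, hu⟩ ⟨u, hu⟩
        exact ⟨v, (hJ _ _).2 ⟨hu, v.isLt, hv⟩, fun h => hz (h ▸ v.isLt)⟩)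
    (fun u x h => by rw [i0]; exact ((hJ u x).1 h).2.1)
  have f0 : s₁.nat 0 = s.nat 0 := by rw [hs₁]; exact run_nat_of_notMem trace (by decide) s
  have f1 : s₁.nat 1 = s.nat 1 := by rw [hs₁]; exact run_nat_of_notMem trace (by decide) s
  have f2 : s₁.nat 2 = s.nat 2 := by rw [hs₁]; exact run_nat_of_notMem trace (by decide) s
  have g0 : s₁.real 0 = s.real 0 := by rw [hs₁]; exact run_real_of_notMem trace (by decide) s
  have g1 : s₁.real 1 = s.real 1 := by rw [hs₁]; exact run_real_of_notMem trace (by decide) s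
  rw [← hs₁] at ht ⊢
  rw [i0] at ht
  obtain ⟨t0, t1⟩ := ht
  have t1 : ∀ k < n + n, (∃ (hu : s₁.nat 4 k < n) (hx : s₁.nat 4 (k + 1) < n),
      G.skeleton.Adj ⟨_, hu⟩ ⟨_, hx⟩) ∧ s₁.nat 4 (k + 1) ≠ s₁.nat 4 (k - 1) := by
    intro k hk
    refine ⟨(hJ _ _).1 ?_, (t1 k hk).2⟩
    have := (t1 k hk).1
    unfold Joined at *
    rwa [f0, f1, f2] at this
  have hlt : ∀ k ≤ n + n, s₁.nat 4 k < n := by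
    intro k hk
    rcases Nat.eq_or_lt_of_le hk with rfl | hk
    · have := (t1 (n + n - 1) (by omega)).1.2.1
      rwa [Nat.sub_add_cancel (by omega)] at this
    · exact (t1 k hk).1.1
  obtain ⟨w, hw⟩ : ∃ w : ℕ → Fin n, ∀ k ≤ n + n, s₁.nat 4 k = w k :=
    ⟨fun k => if h : s₁.nat 4 k < n then ⟨_, h⟩ else ⟨0, by omega⟩, fun k hk => by
      simp only [dif_pos (hlt k hk)]⟩
  have hadj : ∀ k < n + n, G.skeleton.Adj (w k) (w (k + 1)) := by
    intro k hk
    obtain ⟨hu, hx, h⟩ := (t1 k hk).1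
    have e1 : (⟨_, hu⟩ : Fin n) = w k := Fin.ext (hw k hk.le)
    have e2 : (⟨_, hx⟩ : Fin n) = w (k + 1) := Fin.ext (hw (k + 1) hk)
    rwa [e1, e2] at h
  obtain ⟨c1, c2⟩ := cycle_walk hn φ w (n + n) (by omega) hadj (fun k hk h => by
    have := (t1 (k + 1) hk).2
    rw [Nat.add_sub_cancel, hw _ (by omega), hw _ (by omega)] at this
    exact this (by rw [h]))
  have hcl := classify_spec s₁ (fun g hg => by
    rw [f0, i1] at hg
    obtain ⟨k, hk, h⟩ := c2 (G.ends ⟨g, hg⟩).inf (G.ends ⟨g, hg⟩).sup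
      ⟨⟨g, hg⟩, (sym2_inf_sup _).symm⟩
    refine ⟨k, by rwa [f0, i0], ?_⟩
    unfold Classified
    rw [f1, f2, j1 g hg, j2 g hg, hw k (by omega), hw (k + 1) (by omega)]
    rcases h with ⟨h1, h2⟩ | ⟨h1, h2⟩
    · exact ⟨_, _, Or.inl ⟨by rw [h1], by rw [h2], rfl, rfl⟩⟩
    · exact ⟨_, _, Or.inr ⟨by rw [h1], by rw [h2], rfl, rfl⟩⟩)
  obtain ⟨s₂, hs₂⟩ : ∃ x, x = classify.run s₁ := ⟨_, rfl⟩
  have f4 : s₂.nat 4 = s₁.nat 4 := by rw [hs₂]; exact run_nat_of_notMem classify (by decide) s₁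
  rw [← hs₂] at hcl ⊢
  rw [f0, i0, i1] at hcl
  have hcl' : ∀ g (hg : g < m), ((G.ends ⟨g, hg⟩).inf = w (s₂.nat 5 g) ∧
      (G.ends ⟨g, hg⟩).sup = w (s₂.nat 5 g + 1) ∧
      s₂.real 2 g = s.real 0 g ∧ s₂.real 3 g = s.real 1 g) ∨
      ((G.ends ⟨g, hg⟩).sup = w (s₂.nat 5 g) ∧ (G.ends ⟨g, hg⟩).inf = w (s₂.nat 5 g + 1) ∧
      s₂.real 2 g = s.real 1 g ∧ s₂.real 3 g = s.real 0 g) := by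
    intro g hg
    obtain ⟨h1, h2⟩ := hcl g hg
    unfold Classified at h2
    rw [f1, f2, j1 g hg, j2 g hg, hw _ (by omega), hw (_ + 1) (by omega), g0, g1] at h2
    simpa only [Fin.val_inj] using h2
  refine ⟨w, fun p hp => by rw [f4]; exact hw p hp.le, fun i hi j hj => c1 i hi.le j hj.le,
    fun g hg => (hcl g hg).1, fun g hg => ?_, fun g hg => ?_, fun g hg => ?_⟩
  · rcases hcl' g hg with ⟨h1, h2, -, -⟩ | ⟨h1, h2, -, -⟩
    · rw [← h1, ← h2, sym2_inf_sup]
    · rw [← h1, ← h2, Sym2.eq_swap, sym2_inf_sup]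
  · rcases hcl' g hg with ⟨h1, -, h3, -⟩ | ⟨h1, -, h3, -⟩
    · rw [h3, v1 g hg, ← h1]
    · rw [h3, v2 g hg, ← h1]
  · rcases hcl' g hg with ⟨-, h2, -, h4⟩ | ⟨-, h2, -, h4⟩
    · rw [h4, v2 g hg, ← h2]
    · rw [h4, v1 g hg, ← h2]

/-- The values of the items, with positions counted from the start `st`. -/
theorem Traversed.val_eq {n m : ℕ} {I : Instance n m} {G : MultiGraph n m} {w : ℕ → Fin n}
    {e : ℕ → ℕ} {a b : ℕ → ℝ} (h : Traversed I G w e a b) (hI : I.IsOn G) (hn : 3 ≤ n) {st : ℕ}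
    (hst : st < n) {p : ℕ} (hp : p < n) (g : Fin m) :
    I.val (w (st + p)) {g} = (if relPos n st (e g) = p then a g else 0) +
      (if relPos n st (e g) = prevPos n p then b g else 0) := by
  have he := h.edge g g.isLt
  have c1 : w (st + p) = w (e g) ↔ relPos n st (e g) = p := by
    rw [h.inj _ (by omega) _ (by omega), mod_of_lt_two (by omega),
      mod_of_lt_two (by omega)]
    unfold relPos; split_ifs <;> omega
  have c2 : w (st + p) = w (e g + 1) ↔ relPos n st (e g) = prevPos n p := by
    rw [h.inj _ (by omega) _ (by omega), mod_of_lt_two (by omega),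
      mod_of_lt_two (by omega)]
    unfold relPos prevPos; split_ifs <;> omega
  have hne : prevPos n p ≠ p := by unfold prevPos; split_ifs <;> omega
  by_cases h1 : relPos n st (e g) = p
  · rw [if_pos h1, if_neg (fun h2 => hne (h2.symm.trans h1)), add_zero, c1.2 h1,
      h.left g g.isLt]
  · by_cases h2 : relPos n st (e g) = prevPos n p
    · rw [if_neg h1, if_pos h2, zero_add, c2.2 h2, h.right g g.isLt]
    · rw [if_neg h1, if_neg h2, add_zero]
      refine le_antisymm (not_lt.1 fun hpos => ?_) (I.val_nonneg _ _)
      rw [hI, h.ends g g.isLt, Sym2.mem_iff] at hpos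
      rcases hpos with hc | hc
      · exact h1 (c1.1 hc)
      · exact h2 (c2.1 hc)

/-- The program outputs a complete EFX allocation: position `p`, counted from the start `st`, is
vertex number `st + p` of the walk, which stays within its two rounds. -/
theorem program_correct {n m : ℕ} (I : Instance n m) (G : MultiGraph n m) (hadd : I.IsAdditive)
    (hI : I.IsOn G) (hG : G.IsMultiCycle) : ∃ X : Fin n → Finset (Fin m),
      Outputs (program.run (inputMemory I G)) X ∧ IsCompleteAllocation X ∧ I.IsEFX X := by
  have hn := hG.1
  obtain ⟨i0, i1⟩ := input_size I G
  obtain ⟨w, hw, hT⟩ := traversed I G hG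
  simp only [program, run_block_cons, run_block_nil]
  have hz : ∀ a, 3 ≤ a → a ∉ (seq trace classify).natWrites →
      ∀ i, (classify.run (trace.run (inputMemory I G))).nat a i = 0 := by
    intro a ha ha' i
    have := run_nat_of_notMem (seq trace classify) ha' (inputMemory I G)
    rw [run] at this
    rw [this]
    exact input_zero I G ha i
  have h0 : (classify.run (trace.run (inputMemory I G))).nat 0 = (inputMemory I G).nat 0 := by
    have := run_nat_of_notMem (a := 0) (seq trace classify) (by decide) (inputMemory I G)
    rwa [run] at this
  obtain ⟨s₂, hs₂⟩ : ∃ x, x = classify.run (trace.run (inputMemory I G)) := ⟨_, rfl⟩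
  rw [← hs₂] at hw hT hz h0 ⊢
  have n2 : s₂.nat 0 0 = n := by rw [h0, i0]
  have m2 : s₂.nat 0 1 = m := by rw [h0, i1]
  obtain ⟨hready, hstart, hst, hre⟩ := prepare_spec s₂ (by omega)
    (fun g _ => hz 7 (by omega) (by decide) g)
    (fun g hg => by rw [m2] at hg; rw [hT.left g hg]; exact I.val_nonneg _ _)
    (fun g hg => by rw [m2] at hg; rw [hT.right g hg]; exact I.val_nonneg _ _)
    (fun g hg => by rw [m2] at hg; rw [n2]; exact hT.edge g hg)
    (hz 12 (by omega) (by decide) 0) (hz 24 (by omega) (by decide) 0)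
  obtain ⟨s₃, hs₃⟩ : ∃ x, x = prepare.run s₂ := ⟨_, rfl⟩
  have p0 : s₃.nat 0 = s₂.nat 0 := by rw [hs₃]; exact run_nat_of_notMem prepare (by decide) s₂
  have p4 : s₃.nat 4 = s₂.nat 4 := by rw [hs₃]; exact run_nat_of_notMem prepare (by decide) s₂
  have q2 : s₃.real 2 = s₂.real 2 := by rw [hs₃]; exact run_real_of_notMem prepare (by decide) s₂
  have q3 : s₃.real 3 = s₂.real 3 := by rw [hs₃]; exact run_real_of_notMem prepare (by decide) s₂
  rw [← hs₃] at hready hstart hst hre ⊢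
  have hall := allocate_spec s₃ hready (by rw [p0]; exact hstart)
  obtain ⟨s₄, hs₄⟩ : ∃ x, x = allocate.run s₃ := ⟨_, rfl⟩
  have a0 : s₄.nat 0 = s₃.nat 0 := by rw [hs₄]; exact run_nat_of_notMem allocate (by decide) s₃
  have a4 : s₄.nat 4 = s₃.nat 4 := by rw [hs₄]; exact run_nat_of_notMem allocate (by decide) s₃
  have a5 : s₄.nat 5 = s₃.nat 5 := by rw [hs₄]; exact run_nat_of_notMem allocate (by decide) s₃
  have a12 : s₄.nat 12 = s₃.nat 12 := by rw [hs₄]; exact run_nat_of_notMem allocate (by decide) s₃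
  have b2 : s₄.real 2 = s₃.real 2 := by rw [hs₄]; exact run_real_of_notMem allocate (by decide) s₃
  have b3 : s₄.real 3 = s₃.real 3 := by rw [hs₄]; exact run_real_of_notMem allocate (by decide) s₃
  rw [← hs₄] at hall ⊢
  have hout := output_spec s₄
  obtain ⟨s₅, hs₅⟩ : ∃ x, x = output.run s₄ := ⟨_, rfl⟩
  rw [← hs₅] at hout ⊢
  have n4 : s₄.nat 0 0 = n := by rw [a0, p0, n2]
  have m4 : s₄.nat 0 1 = m := by rw [a0, p0, m2]
  obtain ⟨hcont, hown⟩ := hall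
  rw [n4] at hcont hown
  rw [m4] at hout
  rw [n2] at hst hre
  rw [m2] at hre
  set st := s₃.nat 12 0 with hst'
  have hinj : ∀ p < n, ∀ j < n, w (st + p) = w (st + j) ↔ p = j := by
    intro p hp j hj
    rw [hT.inj _ (by omega) _ (by omega), mod_of_lt_two (by omega),
      mod_of_lt_two (by omega)]
    split_ifs <;> omega
  have hsurj : ∀ i, ∃ p < n, w (st + p) = i := by
    have : Function.Surjective fun p : Fin n => w (st + p) := by
      refine Finite.surjective_of_injective fun p j h => ?_
      exact Fin.ext ((hinj p p.isLt j j.isLt).1 h)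
    intro i
    obtain ⟨p, hp⟩ := this i
    exact ⟨p, p.isLt, hp⟩
  have hitem : ∀ g < m, s₅.nat 3 g = w (st + if InA s₄ g then s₄.nat 21 (s₄.nat 5 g) else
      s₄.nat 22 (s₄.nat 5 g)) ∧ s₄.nat 5 g < n := by
    intro g hg
    have he : s₄.nat 5 g < n := by
      rw [a5, hre g hg]; exact relPos_lt hst (hT.edge g hg)
    refine ⟨?_, he⟩
    have ho := hown _ he
    split_ifs with hA
    · rw [(hout g hg).1 hA, a4, p4, a12, hw _ (by omega)]
    · rw [(hout g hg).2 hA, a4, p4, a12, hw _ (by omega)]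
  refine ⟨fun i => Finset.univ.filter fun g : Fin m => s₅.nat 3 g = i, fun i g => by simp, ?_⟩
  refine isEFX_of_content (by omega) I hadd (fun p => w (st + p)) hsurj
    (fun g => s₄.nat 5 g) (fun g => (hitem g g.isLt).2) (fun g => s₄.real 2 g)
    (fun g => s₄.real 3 g) (fun p hp g => ?_) (fun g => InA s₄ g) (splitOf s₄)
    (fun k _ => ?_) (fun k _ => ?_) (fun k _ => ?_) (fun k _ => ?_)
    (fun k hk => (hown k hk).1) (fun k hk => (hown k hk).2)
    (fun k hk hE g => ?_) (fun k hk hE g => ?_) (fun p hp j _ hj => hcont p hp j hj) _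
    (fun p hp g => ?_)
  · simp only [a5, hre g g.isLt, b2, b3, q2, q3]
    exact hT.val_eq hI hn hst hp g
  · simp only [splitOf]; rw [m4, Finset.sum_range]
  · simp only [splitOf]; rw [m4, Finset.sum_range]
  · simp only [splitOf]; rw [m4, Finset.sum_range]
  · simp only [splitOf]; rw [m4, Finset.sum_range]
  · exact hE g (by rw [m4]; exact g.isLt)
  · exact hE g (by rw [m4]; exact g.isLt)
  · have ho := hown _ (hitem g g.isLt).2
    simp only [Finset.mem_filter, Finset.mem_univ, true_and]
    rw [(hitem g g.isLt).1, Fin.val_inj, hinj _ (by split_ifs <;> omega) p hp]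
    rfl

end CycleEFX
end FairDivision

theorem mainTheorem2 :
    ∃ (c : FairDivision.Program) (p : Polynomial ℕ),
      ∀ (n m : ℕ) (I : FairDivision.Instance n m) (G : FairDivision.MultiGraph n m),
        I.IsAdditive → I.IsOn G → G.IsMultiCycle →
          ∃ (s : FairDivision.Memory) (t : ℕ) (X : Fin n → Finset (Fin m)),
            FairDivision.Run c (FairDivision.inputMemory I G) s t ∧
              t ≤ p.eval (n + m) ∧
              FairDivision.Outputs s X ∧
              FairDivision.IsCompleteAllocation X ∧
              I.IsEFX X := by
  refine ⟨FairDivision.CycleEFX.program.toProgram, FairDivision.CycleEFX.program.time,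
    fun n m I G hadd hI hG => ?_⟩
  obtain ⟨X, h1, h2, h3⟩ := FairDivision.CycleEFX.program_correct I G hadd hI hG
  obtain ⟨i0, i1⟩ := FairDivision.CycleEFX.input_size I G
  obtain ⟨t, ht, hrun⟩ := FairDivision.Cmd.exists_run _ FairDivision.CycleEFX.program_wf
    FairDivision.CycleEFX.zero_notMem_program (n + m) (FairDivision.inputMemory I G) (by
      intro b hb
      obtain rfl | rfl : b = 0 ∨ b = 1 := by omega
      · omega
      · omega)
  exact ⟨_, t, X, hrun, ht, h1, h2, h3⟩
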